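/- For $r\ge 0$ let $H^r=H^r(\mathbb R^d;\mathbb C)$ with norm $\|(1-\Delta)^{r/2}u\|_{L^2}$, and let $(H^r)^7$ carry the maximum of the seven norms. Fix $d\in\{1,2,3\}$, $s>d/2$, $\beta\in\mathbb R$ and $\varphi_{\rm in}\in H^{s+4}$. Let $T^*\in(0,\infty]$ be the existence time of the maximal solution $\varphi$ in $H^{s+4}$ of $$ i\partial_t\varphi=-\tfrac12\Delta\varphi+\beta|\varphi|^2\varphi,\qquad \varphi(0)=\varphi_{\rm in}, $$ and suppose that for some $\delta t_0>0$ the solution is defined on $(-\delta t_0,T^*)$ and is a smooth ($C^\infty$) map from $(-\delta t_0,T^*)$ to $H^{s+4}$. Let $0<T<T^*$. For a time step $\delta t>0$ and a real-valued $\Upsilon_{-1/2}\in H^{s+4}$, the augmented relaxation scheme computes vectors $$X_n=(\Upsilon_{n-1/2},\Upsilon_{n+1/2},\varphi_{n-1},\varphi_n,\varphi_{n+1},v_{n-1/2},v_{n+1/2})\in (H^{s+2})^7$$ as follows. $X_0$ is given by $\Upsilon_{-1/2}$, $\varphi_0=\varphi_{\rm in}$, $\Upsilon_{1/2}=2|\varphi_0|^2-\Upsilon_{-1/2}$,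 $$\bigl(2\pm i\delta t(-\tfrac12\Delta+\beta\Upsilon_{\pm1/2})\bigr)\varphi_{\pm1}=\bigl(2\mp i\delta t(-\tfrac12\Delta+\beta\Upsilon_{\pm1/2})\bigr)\varphi_0,\quad v_{-1/2}=\frac{\varphi_0-\varphi_{-1}}{\delta t},\quad v_{1/2}=\frac{\varphi_1-\varphi_0}{\delta t},$$ and $X_{n+1}$ is obtained from $X_n$ (for $(n+1)\delta t\le T$) by $$ i\frac{\varphi_{n+2}-\varphi_{n+1}}{\delta t}+\tfrac12\Delta\frac{\varphi_{n+2}+\varphi_{n+1}}2=\beta\,\Upsilon_{n+3/2}\frac{\varphi_{n+2}+\varphi_{n+1}}2,\qquad \frac{\Upsilon_{n+3/2}-\Upsilon_{n-1/2}}{2\delta t}=\Xi_{n+1/2},$$ $$ i\frac{v_{n+3/2}-v_{n-1/2}}{2\delta t}+\tfrac12\Delta\frac{v_{n+3/2}+2v_{n+1/2}+v_{n-1/2}}4=\beta V_{n+1/2},$$ where $\Xi_{n+1/2}=2\,\mathrm{Re}\bigl(v_{n+1/2}\overline{(\varphi_{n+1}+\varphi_n)/2}\bigr)$ and $$V_{n+1/2}=\frac{\Upsilon_{n+3/2}+\Upsilon_{n-1/2}}2\cdot\frac{v_{n+3/2}+2v_{n+1/2}+v_{n-1/2}}4+\Xi_{n+1/2}\frac{\varphi_{n+2}+\varphi_{n+1}+\varphi_n+\varphi_{n-1}}4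 .$$ (This is the augmented form of the classical relaxation scheme $\frac{\Upsilon_{n+1/2}+\Upsilon_{n-1/2}}2=|\varphi_n|^2$, $i\frac{\varphi_{n+1}-\varphi_n}{\delta t}=(-\frac12\Delta+\beta\Upsilon_{n+1/2})\frac{\varphi_{n+1}+\varphi_n}2$, with $v_{n+1/2}=(\varphi_{n+1}-\varphi_n)/\delta t$.) Suppose that $R_1,R_2>0$ are such that for every real-valued $\Upsilon_{-1/2}\in H^{s+4}$ with $\|\Upsilon_{-1/2}\|_{H^{s+4}}\le R_1$ and every $\delta t\in(0,\delta t_0)$, the vectors $X_n$, $n\delta t\le T$, exist and are uniquely determined in $(H^{s+2})^7$, and satisfy $\|X_n\|_{(H^{s+2})^7}\le R_2$. Let $$X(t)=\bigl(|\varphi(t-\tfrac{\delta t}2)|^2,|\varphi(t+\tfrac{\delta t}2)|^2,\varphi(t-\delta t),\varphi(t),\varphi(t+\delta t),\partial_t\varphi(t-\tfrac{\delta t}2),\partial_t\varphi(t+\tfrac{\delta t}2)\bigr).$$ Then there exist $C>0$ and $\delta t_1\in(0,\delta t_0)$ with $T+\delta t_1\le T^*$ such that for all real-valued $\Upsilon_{-1/2}\in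 H^{s+4}$ with $\|\Upsilon_{-1/2}\|_{H^{s+4}}\le R_1$, all $n\in\mathbb N$ and all $\delta t\in(0,\delta t_1)$ with $n\delta t\le T$, $$\|X_n-X(n\delta t)\|_{(H^s)^7}\le C\Bigl(\bigl\|\Upsilon_{-1/2}-|\varphi(-\tfrac{\delta t}2)|^2\bigr\|_{H^{s+4}}+\delta t^2\Bigr).$$ -/

import Mathlib

open MeasureTheory FourierTransform
open scoped ENNReal ContDiff ComplexConjugate

noncomputable section

namespace Relaxation

/-- The space `ℝ^d` with its Euclidean norm. -/
abbrev E (d : ℕ) : Type := EuclideanSpace ℝ (Fin d)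

/-- The space `L²(ℝ^d; ℂ)`. -/
abbrev L2 (d : ℕ) : Type := Lp ℂ 2 (volume : Measure (E d))

/-- The function `ξ ↦ (1 + |2πξ|²)^(r/2) (𝓕 u)(ξ)`. Mathlib's Fourier transform uses the character
`e^{-2πi x·ξ}`, so that `2πξ` is the usual frequency variable, and this is the symbol of
`(1 - Δ)^(r/2)`. -/
def weightedFourier {d : ℕ} (r : ℝ) (u : L2 d) : E d → ℂ :=
  fun ξ => (((1 + (2 * Real.pi * ‖ξ‖) ^ 2) ^ (r / 2) : ℝ) : ℂ) * (𝓕 u : L2 d) ξ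

theorem weightedFourier_add {d : ℕ} (r : ℝ) (u v : L2 d) :
    weightedFourier r (u + v) =ᵐ[volume] weightedFourier r u + weightedFourier r v := by
  have h : (𝓕 (u + v) : L2 d) = 𝓕 u + 𝓕 v := FourierTransform.fourier_add u v
  filter_upwards [Lp.coeFn_add (𝓕 u : L2 d) (𝓕 v)] with ξ hξ
  simp only [weightedFourier, Pi.add_apply, h, hξ, mul_add]

theorem weightedFourier_smul {d : ℕ} (r : ℝ) (c : ℂ) (u : L2 d) :
    weightedFourier r (c • u) =ᵐ[volume] c • weightedFourier r u := by
  have h : (𝓕 (c • u) : L2 d) = c • 𝓕 u := FourierTransform.fourier_smul c u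
  filter_upwards [Lp.coeFn_smul c (𝓕 u : L2 d)] with ξ hξ
  simp only [weightedFourier, Pi.smul_apply, h, hξ, smul_eq_mul]
  ring

/-- The Sobolev space `H^r(ℝ^d; ℂ)`, `r ≥ 0`, as a subspace of `L²`. -/
def sobolevSubmodule (d : ℕ) (r : ℝ) : Submodule ℂ (L2 d) where
  carrier := {u | MemLp (weightedFourier r u) 2 volume}
  add_mem' {u v} hu hv := (memLp_congr_ae (weightedFourier_add r u v)).2 (hu.add hv)
  zero_mem' := by
    have h := weightedFourier_smul r 0 (0 : L2 d)
    rw [zero_smul, zero_smul] at h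
    exact (memLp_congr_ae h).2 MemLp.zero
  smul_mem' c u hu := (memLp_congr_ae (weightedFourier_smul r c u)).2 (hu.const_smul c)

/-- The Sobolev space `H^r(ℝ^d; ℂ)`, `r ≥ 0`, as a type of its own, which carries the Sobolev
norm (and not the `L²` norm). -/
def Sob (d : ℕ) (r : ℝ) : Type := sobolevSubmodule d r

namespace Sob

variable {d : ℕ} {r : ℝ}

instance : AddCommGroup (Sob d r) := inferInstanceAs (AddCommGroup (sobolevSubmodule d r))

instance : Module ℂ (Sob d r) := inferInstanceAs (Module ℂ (sobolevSubmodule d r))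

/-- The inclusion of `H^r` into `L²`. -/
def toL2 : Sob d r →ₗ[ℂ] L2 d := (sobolevSubmodule d r).subtype

instance : CoeFun (Sob d r) (fun _ => E d → ℂ) := ⟨fun u => ⇑(u.toL2)⟩

/-- The linear map `u ↦ (1 + |2πξ|²)^(r/2) 𝓕 u` from `H^r` to `L²`. -/
def weighted : Sob d r →ₗ[ℂ] L2 d where
  toFun u := MemLp.toLp (weightedFourier r u.toL2) u.2
  map_add' u v := (MemLp.toLp_congr _ (u.2.add v.2) (weightedFourier_add r u.toL2 v.toL2)).trans
    (MemLp.toLp_add u.2 v.2)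
  map_smul' c u := (MemLp.toLp_congr _ (u.2.const_smul c)
    (weightedFourier_smul r c u.toL2)).trans (MemLp.toLp_const_smul c u.2)

theorem weighted_injective : Function.Injective (weighted : Sob d r → L2 d) := by
  rw [← LinearMap.ker_eq_bot, LinearMap.ker_eq_bot']
  intro u hu
  have h1 : weightedFourier r u.toL2 =ᵐ[volume] 0 :=
    (MemLp.coeFn_toLp u.2).symm.trans ((congrArg (fun w : L2 d => ⇑w) hu) ▸ Lp.coeFn_zero ℂ 2 _)
  have h2 : (𝓕 u.toL2 : L2 d) = 0 := by
    rw [Lp.eq_zero_iff_ae_eq_zero]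
    filter_upwards [h1] with ξ hξ
    have hpos : (0 : ℝ) < (1 + (2 * Real.pi * ‖ξ‖) ^ 2) ^ (r / 2) := by positivity
    simpa [weightedFourier, hpos.ne'] using hξ
  have h3 : u.toL2 = 0 := by
    rw [← norm_eq_zero, ← Lp.norm_fourier_eq, h2, norm_zero]
  exact Subtype.ext h3

/-- `‖u‖_{H^r} = ‖(1 + |2πξ|²)^(r/2) 𝓕 u‖_{L²}`. -/
instance : NormedAddCommGroup (Sob d r) :=
  NormedAddCommGroup.induced _ _ (weighted : Sob d r →ₗ[ℂ] L2 d) weighted_injective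

instance : NormedSpace ℂ (Sob d r) :=
  NormedSpace.induced ℂ _ _ (weighted : Sob d r →ₗ[ℂ] L2 d)

end Sob

open Classical in
/-- The `H^r` norm of a function, with the value `∞` if the function is not in `H^r`. -/
def sobolevENorm {d : ℕ} (r : ℝ) (f : E d → ℂ) : ℝ≥0∞ :=
  if h : MemLp f 2 volume then eLpNorm (weightedFourier r h.toLp) 2 volume else ⊤

theorem Sob.enorm_eq_sobolevENorm {d : ℕ} {r : ℝ} (u : Sob d r) : ‖u‖ₑ = sobolevENorm r u := by
  have h : MemLp (⇑u.toL2) 2 volume := Lp.memLp _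
  have h1 : ‖u‖ₑ = ‖u.weighted‖ₑ := by
    rw [← ofReal_norm, ← ofReal_norm]; rfl
  have h2 : ‖u.weighted‖ₑ = eLpNorm (weightedFourier r u.toL2) 2 volume :=
    Lp.enorm_toLp (hf := u.2)
  rw [h1, h2, sobolevENorm, dif_pos h, Lp.toLp_coeFn]

theorem sobolevENorm_lt_top_iff {d : ℕ} {r : ℝ} (f : E d → ℂ) :
    sobolevENorm r f < ⊤ ↔ ∃ u : Sob d r, f =ᵐ[volume] u := by
  constructor
  · intro hf
    by_cases h : MemLp f 2 volume
    · rw [sobolevENorm, dif_pos h] at hf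
      refine ⟨⟨h.toLp, ?_, hf⟩, h.coeFn_toLp.symm⟩
      exact AEStronglyMeasurable.mul (Continuous.aestronglyMeasurable (by
        refine Complex.continuous_ofReal.comp (Continuous.rpow_const (by fun_prop) ?_)
        intro x; left; positivity)) (Lp.aestronglyMeasurable _)
    · simp [sobolevENorm, h] at hf
  · rintro ⟨u, hu⟩
    have h0 : MemLp (⇑u.toL2) 2 volume := Lp.memLp _
    have h : MemLp f 2 volume := (memLp_congr_ae hu).2 h0
    have h1 : h.toLp = u.toL2 := (MemLp.toLp_congr h h0 hu).trans (Lp.toLp_coeFn _ _)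
    rw [sobolevENorm, dif_pos h, h1]
    exact u.2.2

/-- The norm of `(H^r)^7`, that is, the largest of the seven `H^r` norms (`∞` outside the
space). -/
def sobolevENorm7 {d : ℕ} (r : ℝ) (F : Fin 7 → E d → ℂ) : ℝ≥0∞ := ⨆ i, sobolevENorm r (F i)

open Classical in
/-- The Laplacian `Δ u = 𝓕⁻¹ (-|2πξ|² 𝓕 u)` of `u ∈ H²(ℝ^d)`. -/
def lap {d : ℕ} (u : L2 d) : L2 d :=
  if h : MemLp (fun ξ => ((-(2 * Real.pi * ‖ξ‖) ^ 2 : ℝ) : ℂ) * (𝓕 u : L2 d) ξ) 2 volume then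
    𝓕⁻ h.toLp
  else 0

/-- `(-½ Δ + β Υ) u`. -/
def schrodingerOp {d : ℕ} (β : ℝ) (Υ : E d → ℂ) (u : L2 d) : E d → ℂ :=
  fun x => -(1 / 2) * lap u x + β * Υ x * u x

/-- `φ` is a solution in `C(J; H^r)` of the cubic nonlinear Schrödinger equation
`i ∂_t φ = -½ Δ φ + β |φ|² φ` on the time interval `J`. The time derivative is taken in `L²`. -/
def IsNLSSolutionOn {d : ℕ} {r : ℝ} (β : ℝ) (J : Set ℝ) (φ : ℝ → Sob d r) : Prop :=
  ContinuousOn φ J ∧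
  ∀ t ∈ J, ∃ g : L2 d, HasDerivWithinAt (fun τ => (φ τ).toL2) g J t ∧
    ∀ᵐ x, Complex.I * g x = -(1 / 2) * lap (φ t).toL2 x + β * (‖φ t x‖ : ℂ) ^ 2 * φ t x

/-- `Tstar ∈ (0, ∞]` is an upper bound for the lifespan of all the solutions in `C([0, T'); H^r)`
of the Cauchy problem with initial datum `φin`. -/
def BoundsLifespan {d : ℕ} {r : ℝ} (β : ℝ) (φin : Sob d r) (Tstar : EReal) : Prop :=
  ∀ (T' : ℝ) (ψ : ℝ → Sob d r), IsNLSSolutionOn β (Set.Ico 0 T') ψ → ψ 0 = φin → (T' : EReal) ≤ Tstar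

/-- `Φ_{n+1/2} = Υ_{n+1/2} (φ_{n+1} + φ_n) / 2`. -/
def discPhi {d : ℕ} (Υ φ φ' : E d → ℂ) : E d → ℂ := fun x => Υ x * ((φ' x + φ x) / 2)

/-- `Ξ_{n+1/2} = 2 Re (v_{n+1/2} conj ((φ_{n+1} + φ_n) / 2))`. -/
def discXi {d : ℕ} (v φ φ' : E d → ℂ) : E d → ℂ :=
  fun x => ((2 * (v x * conj ((φ' x + φ x) / 2)).re : ℝ) : ℂ)

/-- One step of the augmented relaxation scheme, from
`X = X_n = (Υ_{n-1/2}, Υ_{n+1/2}, φ_{n-1}, φ_n, φ_{n+1}, v_{n-1/2}, v_{n+1/2})` to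
`X' = X_{n+1} = (Υ_{n+1/2}, Υ_{n+3/2}, φ_n, φ_{n+1}, φ_{n+2}, v_{n+1/2}, v_{n+3/2})`. -/
structure IsStep {d : ℕ} {r : ℝ} (β δt : ℝ) (X X' : Fin 7 → Sob d r) : Prop where
  shift_Υ : X' 0 = X 1
  shift_φ : X' 2 = X 3
  shift_φ' : X' 3 = X 4
  shift_v : X' 5 = X 6
  /-- `i (φ_{n+2} - φ_{n+1}) / δt + ½ Δ ((φ_{n+2} + φ_{n+1}) / 2) = β Φ_{n+3/2}` -/
  eq_φ : ∀ᵐ x, Complex.I * ((X' 4 x - X 4 x) / δt)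
      + 1 / 2 * lap ((1 / 2 : ℂ) • (X' 4 + X 4).toL2) x
    = β * discPhi (X' 1) (X 4) (X' 4) x
  /-- `(Υ_{n+3/2} - Υ_{n-1/2}) / (2 δt) = Ξ_{n+1/2}` -/
  eq_Υ : ∀ᵐ x, (X' 1 x - X 0 x) / (2 * δt) = discXi (X 6) (X 3) (X 4) x
  /-- `i (v_{n+3/2} - v_{n-1/2}) / (2 δt) + ½ Δ ((v_{n+3/2} + 2 v_{n+1/2} + v_{n-1/2}) / 4)
  = β V_{n+1/2}`, where
  `V_{n+1/2} = (Υ_{n+3/2} + Υ_{n-1/2}) / 2 · (v_{n+3/2} + 2 v_{n+1/2} + v_{n-1/2}) / 4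
  + Ξ_{n+1/2} (φ_{n+2} + φ_{n+1} + φ_n + φ_{n-1}) / 4` -/
  eq_v : ∀ᵐ x, Complex.I * ((X' 6 x - X 5 x) / (2 * δt))
      + 1 / 2 * lap ((1 / 4 : ℂ) • (X' 6 + (2 : ℂ) • X 6 + X 5).toL2) x
    = β * ((X' 1 x + X 0 x) / 2 * ((X' 6 x + 2 * X 6 x + X 5 x) / 4)
      + discXi (X 6) (X 3) (X 4) x * ((X' 4 x + X 4 x + X 3 x + X 2 x) / 4))

/-- `X = X_0` is the vector of initial data built from `φ_0 = φin` and `Υ_{-1/2} = Υin`. -/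
structure IsInitial {d : ℕ} {r r' : ℝ} (β δt : ℝ) (φin Υin : Sob d r')
    (X : Fin 7 → Sob d r) : Prop where
  init_Υ : (X 0).toL2 = Υin.toL2
  init_φ : (X 3).toL2 = φin.toL2
  /-- `Υ_{1/2} = 2 |φ_0|² - Υ_{-1/2}` -/
  eq_Υ : ∀ᵐ x, X 1 x = 2 * (‖φin x‖ : ℂ) ^ 2 - Υin x
  /-- `(2 - i δt (-½ Δ + β Υ_{-1/2})) φ_{-1} = (2 + i δt (-½ Δ + β Υ_{-1/2})) φ_0` -/
  eq_φ_neg : ∀ᵐ x, 2 * X 2 x - Complex.I * δt * schrodingerOp β (X 0) (X 2).toL2 x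
    = 2 * φin x + Complex.I * δt * schrodingerOp β (X 0) φin.toL2 x
  /-- `(2 + i δt (-½ Δ + β Υ_{1/2})) φ_1 = (2 - i δt (-½ Δ + β Υ_{1/2})) φ_0` -/
  eq_φ_pos : ∀ᵐ x, 2 * X 4 x + Complex.I * δt * schrodingerOp β (X 1) (X 4).toL2 x
    = 2 * φin x - Complex.I * δt * schrodingerOp β (X 1) φin.toL2 x
  /-- `v_{-1/2} = (φ_0 - φ_{-1}) / δt` -/
  eq_v_neg : X 5 = (1 / δt : ℂ) • (X 3 - X 2)
  /-- `v_{1/2} = (φ_1 - φ_0) / δt` -/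
  eq_v_pos : X 6 = (1 / δt : ℂ) • (X 4 - X 3)

/-- `(X_n)` is the numerical solution with time step `δt` and initial data `φ_0 = φin`,
`Υ_{-1/2} = Υin`, up to time `T` (the vectors `X_n` with `n δt > T` play no role). -/
def IsNumericalSolution {d : ℕ} {r r' : ℝ} (β δt T : ℝ) (φin Υin : Sob d r')
    (X : ℕ → Fin 7 → Sob d r) : Prop :=
  IsInitial β δt φin Υin (X 0) ∧ ∀ n : ℕ, ((n + 1 : ℕ) : ℝ) * δt ≤ T → IsStep β δt (X n) (X (n + 1))

/-- The function is real valued. -/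
def IsRealValued {d : ℕ} {r : ℝ} (u : Sob d r) : Prop := ∀ᵐ x, (u x).im = 0

/-- The vector `X(t) = (|φ(t - δt/2)|², |φ(t + δt/2)|², φ(t - δt), φ(t), φ(t + δt),
∂_t φ(t - δt/2), ∂_t φ(t + δt/2))` of the exact solution. -/
def exactVec {d : ℕ} {r : ℝ} (φ : ℝ → Sob d r) (δt t : ℝ) : Fin 7 → E d → ℂ :=
  ![fun x => (‖φ (t - δt / 2) x‖ : ℂ) ^ 2,
    fun x => (‖φ (t + δt / 2) x‖ : ℂ) ^ 2,
    φ (t - δt), φ t, φ (t + δt),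
    (deriv φ (t - δt / 2) : Sob d r), (deriv φ (t + δt / 2) : Sob d r)]

end Relaxation

end

/-!
The augmented scheme, in which the velocity `v` is an unknown of its own, is stable in `H^s` and
consistent to second order along the exact solution; this makes it second order accurate.

For `s > d/2` the space `H^s` is an algebra stable under complex conjugation (`Sob.mulS`,
`Sob.conjS`, from `Sob.exists_mul`: Young's inequality for the convolution of the Fourier
transforms), so that each nonlinear term of the scheme is a bounded multilinear map, Lipschitz on
bounded sets. The Laplacian is a bounded map from `H^{s+2}` to `H^s` (`Sob.lapS`). All the equations,
which are given almost everywhere, thus become identities in `H^s` (`Sob.IsStep.equation_φ`,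
`Sob.IsStep.equation_Υ`, `Sob.IsStep.equation_v`).

*Consistency.* Along a smooth curve the centered difference quotients are second order accurate,
with constants uniform on compact time intervals (`exists_centered_le`). Together with the equation
and its time derivative (`deriv_equation`) this bounds the residual of the exact solution by `C δ²`
(`Sob.exists_exactSob_residual_le`).

*Stability.* The linear part of the equation for `φ` is a Cayley transform, a unitary Fourier
multiplier (`Sob.norm_emb_le_of_crankNicolson`). The equation for `v` is a two step recursion. With
`w_n = v_{n-1/2} + v_{n+1/2}` it reads
`(i/(2δ)) (w_{n+1} - w_n) + (1/8) Δ (w_{n+1} + w_n) = f_n`. The quantity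
`q_n = ½ (1 - ¼ i δ Δ) w_n` (`Sob.wavePart`) is propagated by the same Cayley transform, while
`p_n = v_{n-1/2} - q_n` satisfies `p_{n+1} = -p_n + i δ f_n` (`Sob.wavePart_add_wavePart`).
Conversely `‖w_n‖ ≤ 2 ‖q_n‖`, so that `p_n`, `q_n` control both velocities. Hence the norm
`Sob.errNorm` of the error grows by a factor `1 + O(δ)` per step, up to the residual
(`Sob.IsStep.errNorm_le`); here both the numerical and the exact solution have to be bounded in
`H^s`. The discrete Gronwall inequality (`discrete_gronwall`) gives the error bound in terms of the
initial error.

*Initial error.* `q_0` involves `Δ w_0`, so the initial error has to be measured in `H^{s+2}`; this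
is why data in `H^{s+4}` are required. The first step starts from the exact datum `φ_0`, so that the
error of `φ_{±1}` is `O(δ (ε + δ²))`, where `ε` is the error of `Υ_{-1/2}`, and the difference
quotients `v_{±1/2}` have an error `O(ε + δ²)` (`Sob.exists_initial_error_le`).
-/

noncomputable section

namespace Relaxation

/-! ### Fourier inversion on `L¹ ∩ L²` and convolutions -/

open scoped Convolution

/-- The `L²` inverse Fourier transform, defined by density, agrees on `L¹ ∩ L²` with the one given by
the integral: both have the same integral against every test function. -/
theorem ae_eq_fourierInv_of_integrable {d : ℕ} {f : E d → ℂ} (hf : Integrable f)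
    (hf2 : MemLp f 2 volume) :
    (𝓕⁻ (hf2.toLp f) : L2 d) =ᵐ[volume] (𝓕⁻ f : E d → ℂ) := by
  have hrep : (𝓕⁻ f : E d → ℂ) = VectorFourier.fourierIntegral Real.fourierChar volume
      (-innerₗ (E d)) f := rfl
  have hLc : Continuous fun p : E d × E d => (-innerₗ (E d)) p.1 p.2 := by
    simp only [LinearMap.neg_apply, innerₗ_apply_apply]; fun_prop
  have hcont : Continuous (𝓕⁻ f : E d → ℂ) := by
    rw [hrep]
    exact VectorFourier.fourierIntegral_continuous Real.continuous_fourierChar hLc hf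
  refine ae_eq_of_integral_contDiff_smul_eq ?_ hcont.locallyIntegrable ?_
  · exact (Lp.memLp _).locallyIntegrable (by norm_num)
  intro g hg hgs
  have hgs' : HasCompactSupport (fun x => (g x : ℂ)) :=
    hgs.comp_left (g := fun y : ℝ => (y : ℂ)) Complex.ofReal_zero
  let G : SchwartzMap (E d) ℂ := hgs'.toSchwartzMap (Complex.ofRealCLM.contDiff.comp hg)
  have hG : ∀ x, G x = g x := fun x => rfl
  -- the inverse Fourier transform in `L²` is the one of tempered distributions
  have h1 := congrArg (fun D : TemperedDistribution (E d) ℂ => D G)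
    (Lp.fourierInv_toTemperedDistribution_eq (hf2.toLp f))
  simp only [TemperedDistribution.fourierInv_apply, Lp.toTemperedDistribution_apply] at h1
  have h2 : ∫ x, g x • (𝓕⁻ (hf2.toLp f) : L2 d) x
      = ∫ x, G x • (𝓕⁻ (hf2.toLp f) : L2 d) x := by
    refine integral_congr_ae (Filter.Eventually.of_forall fun x => ?_)
    simp [hG]
  rw [h2, ← h1]
  have h3 : ∫ x, (𝓕⁻ G : SchwartzMap (E d) ℂ) x • (hf2.toLp f) x
      = ∫ x, f x • VectorFourier.fourierIntegral Real.fourierChar volume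
        (-innerₗ (E d)).flip G x := by
    refine integral_congr_ae ?_
    filter_upwards [hf2.coeFn_toLp] with x hx
    rw [hx, smul_eq_mul, smul_eq_mul, mul_comm]
    congr 1
    rw [SchwartzMap.fourierInv_coe]
    have : (-innerₗ (E d)).flip = -innerₗ (E d) := by
      ext x y; simp [real_inner_comm]
    rw [this]; rfl
  rw [h3, ← VectorFourier.integral_fourierIntegral_smul_eq_flip Real.continuous_fourierChar hLc hf
    G.integrable, ← hrep]
  refine integral_congr_ae (Filter.Eventually.of_forall fun x => ?_)
  simp [hG, mul_comm]

theorem ae_eq_fourierInv_fourier {d : ℕ} {u : L2 d} (h : Integrable (𝓕 u : L2 d)) :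
    u =ᵐ[volume] (𝓕⁻ (⇑(𝓕 u : L2 d)) : E d → ℂ) := by
  have := ae_eq_fourierInv_of_integrable h (Lp.memLp _)
  rwa [Lp.toLp_coeFn, fourierInv_fourier_eq] at this

theorem fourierInv_convolution {d : ℕ} {f g : E d → ℂ} (hf : Integrable f) (hg : Integrable g)
    (x : E d) : 𝓕⁻ (f ⋆[ContinuousLinearMap.mul ℂ ℂ] g) x = 𝓕⁻ f x * 𝓕⁻ g x := by
  simp only [Real.fourierInv_eq_fourier_neg]
  exact Real.fourier_mul_convolution_eq hf hg (-x)

/-- Young's inequality `‖F ⋆ G‖_{L²} ≤ ‖F‖_{L¹} ‖G‖_{L²}`, for functions with values in `[0, ∞]`. -/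
theorem lintegral_convolution_sq_le {d : ℕ} {F G : E d → ℝ≥0∞} (hF : AEMeasurable F)
    (hG : AEMeasurable G) :
    ∫⁻ x, (∫⁻ y, F y * G (x - y)) ^ 2 ≤ (∫⁻ y, F y) ^ 2 * ∫⁻ x, G x ^ 2 := by
  have hG' : ∀ x, AEMeasurable fun y => G (x - y) := fun x =>
    hG.comp_quasiMeasurePreserving (quasiMeasurePreserving_sub_left volume x)
  have hG2 : AEMeasurable (fun p : E d × E d => G (p.1 - p.2)) (volume.prod volume) :=
    hG.comp_quasiMeasurePreserving (quasiMeasurePreserving_sub_of_right_invariant volume volume)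
  -- the Cauchy–Schwarz inequality for the measure `F y dy`
  have h1 : ∀ x, (∫⁻ y, F y * G (x - y)) ^ 2 ≤ (∫⁻ y, F y) * ∫⁻ y, F y * G (x - y) ^ 2 := by
    intro x
    have h := ENNReal.lintegral_mul_le_Lp_mul_Lq volume (p := 2) (q := 2)
      (by norm_num [Real.holderConjugate_iff])
      (f := fun y => F y ^ (1 / 2 : ℝ)) (g := fun y => F y ^ (1 / 2 : ℝ) * G (x - y))
      (hF.pow_const _) ((hF.pow_const _).mul (hG' x))
    have e1 : ∀ a : ℝ≥0∞, a ^ (1 / 2 : ℝ) * a ^ (1 / 2 : ℝ) = a := fun a => by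
      rw [← ENNReal.rpow_add_of_nonneg _ _ (by norm_num) (by norm_num)]; norm_num
    have e2 : ∀ a : ℝ≥0∞, (a ^ (1 / 2 : ℝ)) ^ (2 : ℝ) = a := fun a => by
      rw [← ENNReal.rpow_mul]; norm_num
    simp only [Pi.mul_apply, ← mul_assoc, e1, ENNReal.mul_rpow_of_nonneg _ _ zero_le_two, e2] at h
    calc _ ≤ ((∫⁻ y, F y) ^ (1 / 2 : ℝ) * (∫⁻ y, F y * G (x - y) ^ (2 : ℝ)) ^ (1 / 2 : ℝ)) ^ 2 := by
          gcongr
      _ = _ := by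
          have e3 : ∀ a : ℝ≥0∞, (a ^ (1 / 2 : ℝ)) ^ 2 = a := fun a => by rw [pow_two, e1]
          simp only [mul_pow, e3, ENNReal.rpow_two]
  calc _ ≤ ∫⁻ x, (∫⁻ y, F y) * ∫⁻ y, F y * G (x - y) ^ 2 := lintegral_mono h1
    _ = (∫⁻ y, F y) * ∫⁻ x, ∫⁻ y, F y * G (x - y) ^ 2 := by
        rw [lintegral_const_mul'']
        exact (AEMeasurable.mul hF.comp_snd (hG2.pow_const 2)).lintegral_prod_right'
    _ = (∫⁻ y, F y) * ∫⁻ y, ∫⁻ x, F y * G (x - y) ^ 2 := by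
        rw [lintegral_lintegral_swap]
        exact AEMeasurable.mul hF.comp_snd (hG2.pow_const 2)
    _ = (∫⁻ y, F y) * ∫⁻ y, F y * ∫⁻ x, G x ^ 2 := by
        congr 1
        refine lintegral_congr fun y => ?_
        rw [lintegral_const_mul'', lintegral_sub_right_eq_self (fun x => G x ^ 2) y]
        exact (hG.comp_quasiMeasurePreserving
          (measurePreserving_sub_right volume y).quasiMeasurePreserving).pow_const 2
    _ = _ := by
        rw [lintegral_mul_const'' _ hF, pow_two, mul_assoc]

/-! ### Sobolev spaces on the Fourier side, inclusions and the Laplacian -/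

/-- The function `1 + |2πξ|²`, the symbol of `1 - Δ`. -/
def bracket {d : ℕ} (ξ : E d) : ℝ := 1 + (2 * Real.pi * ‖ξ‖) ^ 2

theorem one_le_bracket {d : ℕ} (ξ : E d) : 1 ≤ bracket ξ := by
  unfold bracket; nlinarith [sq_nonneg (2 * Real.pi * ‖ξ‖)]

theorem bracket_pos {d : ℕ} (ξ : E d) : 0 < bracket ξ := zero_lt_one.trans_le (one_le_bracket ξ)

theorem continuous_bracket {d : ℕ} : Continuous (bracket : E d → ℝ) := by
  unfold bracket; fun_prop

theorem continuous_bracket_rpow {d : ℕ} (r : ℝ) :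
    Continuous (fun ξ : E d => bracket ξ ^ r) :=
  continuous_bracket.rpow_const fun ξ => Or.inl (bracket_pos ξ).ne'

namespace Sob

variable {d : ℕ} {r ρ : ℝ}

/-- The Fourier transform of an element of `H^r`, as a function. -/
def ft (u : Sob d r) : E d → ℂ := ⇑(𝓕 u.toL2 : L2 d)

theorem aestronglyMeasurable_ft (u : Sob d r) : AEStronglyMeasurable (ft u) volume :=
  Lp.aestronglyMeasurable _

theorem coe_weighted (u : Sob d r) :
    u.weighted =ᵐ[volume] fun ξ => ((bracket ξ ^ (r / 2) : ℝ) : ℂ) * ft u ξ :=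
  MemLp.coeFn_toLp u.2

theorem norm_coe_weighted (u : Sob d r) :
    ∀ᵐ ξ, ‖u.weighted ξ‖ = bracket ξ ^ (r / 2) * ‖ft u ξ‖ := by
  filter_upwards [coe_weighted u] with ξ hξ
  rw [hξ, norm_mul, Complex.norm_real, Real.norm_of_nonneg (Real.rpow_nonneg (bracket_pos ξ).le _)]

theorem norm_eq_norm_weighted (u : Sob d r) : ‖u‖ = ‖u.weighted‖ := rfl

theorem ext_ae {u v : Sob d r} (h : (u : E d → ℂ) =ᵐ[volume] v) : u = v :=
  Subtype.ext (Lp.ext h)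

theorem toL2_injective : Function.Injective (toL2 : Sob d r → L2 d) := Subtype.val_injective

theorem toL2_eq_of_ft {u : Sob d r} {v : Sob d ρ} (h : ft u =ᵐ[volume] ft v) :
    u.toL2 = v.toL2 := by
  have h1 : (𝓕 u.toL2 : L2 d) = 𝓕 v.toL2 := Lp.ext h
  simpa only [fourierInv_fourier_eq] using congrArg (fun w : L2 d => (𝓕⁻ w : L2 d)) h1

theorem ext_ft {u v : Sob d r} (h : ft u =ᵐ[volume] ft v) : u = v :=
  toL2_injective (toL2_eq_of_ft h)

theorem ft_add (u v : Sob d r) : ft (u + v) =ᵐ[volume] fun ξ => ft u ξ + ft v ξ := by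
  have h : (𝓕 (u + v).toL2 : L2 d) = 𝓕 u.toL2 + 𝓕 v.toL2 := by
    rw [map_add]; exact FourierTransform.fourier_add _ _
  unfold ft; rw [h]; exact Lp.coeFn_add _ _

theorem ft_smul (c : ℂ) (u : Sob d r) : ft (c • u) =ᵐ[volume] fun ξ => c * ft u ξ := by
  have h : (𝓕 (c • u).toL2 : L2 d) = c • 𝓕 u.toL2 := by
    rw [map_smul]; exact FourierTransform.fourier_smul _ _
  unfold ft; rw [h]; exact Lp.coeFn_smul _ _

theorem ft_sub (u v : Sob d r) : ft (u - v) =ᵐ[volume] fun ξ => ft u ξ - ft v ξ := by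
  have h : u - v = u + (-1 : ℂ) • v := by module
  rw [h]
  filter_upwards [ft_add u ((-1 : ℂ) • v), ft_smul (-1) v] with ξ h1 h2
  rw [h1, h2]; ring

theorem coe_add (u v : Sob d r) :
    ((u + v : Sob d r) : E d → ℂ) =ᵐ[volume] fun x => u x + v x := by
  rw [map_add]; exact Lp.coeFn_add _ _

theorem coe_sub (u v : Sob d r) :
    ((u - v : Sob d r) : E d → ℂ) =ᵐ[volume] fun x => u x - v x := by
  rw [map_sub]; exact Lp.coeFn_sub _ _

theorem coe_smul (c : ℂ) (u : Sob d r) :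
    ((c • u : Sob d r) : E d → ℂ) =ᵐ[volume] fun x => c * u x := by
  rw [map_smul]; exact Lp.coeFn_smul _ _

theorem norm_le_of_ft_le {u : Sob d r} {v : Sob d ρ} {K : ℝ}
    (h : ∀ᵐ ξ, bracket ξ ^ (r / 2) * ‖ft u ξ‖ ≤ K * (bracket ξ ^ (ρ / 2) * ‖ft v ξ‖)) :
    ‖u‖ ≤ K * ‖v‖ := by
  rw [norm_eq_norm_weighted, norm_eq_norm_weighted]
  refine Lp.norm_le_mul_norm_of_ae_le_mul ?_
  filter_upwards [h, norm_coe_weighted u, norm_coe_weighted v] with ξ h1 h2 h3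
  rwa [h2, h3]

/-- A pointwise bound for the Fourier transforms gives the same bound for the Sobolev norms. -/
theorem norm_le_add_of_ft_le {u v w : Sob d r} {c : ℝ} (hc : 0 ≤ c)
    (h : ∀ᵐ ξ, ‖ft u ξ‖ ≤ ‖ft v ξ‖ + c * ‖ft w ξ‖) : ‖u‖ ≤ ‖v‖ + c * ‖w‖ := by
  have hv := (Lp.memLp v.weighted).norm
  have hw := (Lp.memLp w.weighted).norm
  have h1 : ‖u.weighted‖ ≤ ‖hv.toLp + c • hw.toLp‖ := by
    refine Lp.norm_le_norm_of_ae_le ?_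
    filter_upwards [h, norm_coe_weighted u, norm_coe_weighted v, norm_coe_weighted w,
      Lp.coeFn_add hv.toLp (c • hw.toLp), Lp.coeFn_smul c hw.toLp, hv.coeFn_toLp, hw.coeFn_toLp]
      with ξ h hu hv hw h1 h2 h3 h4
    have hb := Real.rpow_nonneg (bracket_pos ξ).le (r / 2)
    rw [h1, Pi.add_apply, h2, Pi.smul_apply, h3, h4, hu, hv, hw, smul_eq_mul,
      Real.norm_of_nonneg (by positivity)]
    nlinarith [mul_le_mul_of_nonneg_left h hb]
  have h2 : ∀ x : L2 d, ∀ hx : MemLp (fun ξ => ‖x ξ‖) 2 volume, ‖hx.toLp‖ = ‖x‖ := by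
    intro x hx
    rw [Lp.norm_toLp, eLpNorm_norm, ← Lp.norm_def]
  calc ‖u‖ = ‖u.weighted‖ := rfl
    _ ≤ ‖hv.toLp‖ + ‖c • hw.toLp‖ := h1.trans (norm_add_le _ _)
    _ = _ := by rw [norm_smul, h2, h2, Real.norm_of_nonneg hc]; rfl

theorem enorm_sq_eq_lintegral (u : Sob d r) :
    ‖u‖ₑ ^ 2 = ∫⁻ ξ, (ENNReal.ofReal (bracket ξ ^ (r / 2)) * ‖ft u ξ‖ₑ) ^ 2 := by
  have h0 : ‖u‖ₑ = ‖u.weighted‖ₑ := by rw [← ofReal_norm, ← ofReal_norm]; rfl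
  rw [h0, Lp.enorm_def, eLpNorm_eq_lintegral_rpow_enorm_toReal two_ne_zero ENNReal.ofNat_ne_top,
    ← ENNReal.rpow_natCast, ← ENNReal.rpow_mul]
  simp only [ENNReal.toReal_ofNat, Nat.cast_ofNat, one_div, inv_mul_cancel₀ (two_ne_zero' ℝ),
    ENNReal.rpow_one]
  refine lintegral_congr_ae ?_
  filter_upwards [norm_coe_weighted u] with ξ h
  rw [ENNReal.rpow_two, ← ofReal_norm, h, ENNReal.ofReal_mul (Real.rpow_nonneg (bracket_pos ξ).le _),
    ofReal_norm]

/-- A function with finite weighted `L²` norm is the Fourier transform of an element of `H^r`. -/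
theorem exists_ft_eq (hr : 0 ≤ r) {f : E d → ℂ} (hf : AEStronglyMeasurable f volume)
    (h : ∫⁻ ξ, (ENNReal.ofReal (bracket ξ ^ (r / 2)) * ‖f ξ‖ₑ) ^ 2 < ⊤) :
    ∃ u : Sob d r, ft u =ᵐ[volume] f := by
  have hm : MemLp (fun ξ => ((bracket ξ ^ (r / 2) : ℝ) : ℂ) * f ξ) 2 volume := by
    refine ⟨((Complex.continuous_ofReal.comp
      (continuous_bracket_rpow (r / 2))).aestronglyMeasurable).mul hf, ?_⟩
    rw [eLpNorm_lt_top_iff_lintegral_rpow_enorm_lt_top two_ne_zero ENNReal.ofNat_ne_top]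
    refine lt_of_le_of_lt (le_of_eq (lintegral_congr fun ξ => ?_)) h
    rw [enorm_mul, ENNReal.toReal_ofNat, ENNReal.rpow_two, ← ofReal_norm (Complex.ofReal _),
      Complex.norm_real, Real.norm_of_nonneg (Real.rpow_nonneg (bracket_pos ξ).le _)]
  have hf2 : MemLp f 2 volume := by
    refine hm.mono hf (Filter.Eventually.of_forall fun ξ => ?_)
    rw [norm_mul, Complex.norm_real, Real.norm_of_nonneg (Real.rpow_nonneg (bracket_pos ξ).le _)]
    exact le_mul_of_one_le_left (norm_nonneg _)
      (Real.one_le_rpow (one_le_bracket ξ) (by positivity))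
  have h1 : (𝓕 (𝓕⁻ hf2.toLp : L2 d) : L2 d) =ᵐ[volume] f := by
    rw [fourier_fourierInv_eq]; exact hf2.coeFn_toLp
  refine ⟨⟨𝓕⁻ hf2.toLp, ?_⟩, h1⟩
  refine (memLp_congr_ae ?_).2 hm
  filter_upwards [h1] with ξ hξ
  rw [weightedFourier, hξ]; rfl

/-- The inclusion `H^r ⊆ H^ρ` for `ρ ≤ r`. -/
def emb (h : ρ ≤ r) : Sob d r →L[ℂ] Sob d ρ :=
  have hle : ∀ ξ : E d, bracket ξ ^ (ρ / 2) ≤ bracket ξ ^ (r / 2) := fun ξ =>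
    Real.rpow_le_rpow_of_exponent_le (one_le_bracket ξ) (by linarith)
  LinearMap.mkContinuous
    { toFun := fun u => ⟨u.toL2, by
        refine MemLp.mono u.2 ?_ (Filter.Eventually.of_forall fun ξ => ?_)
        · exact ((Complex.continuous_ofReal.comp
            (continuous_bracket_rpow (ρ / 2))).aestronglyMeasurable).mul u.aestronglyMeasurable_ft
        · simp only [weightedFourier, norm_mul, Complex.norm_real]
          refine mul_le_mul_of_nonneg_right ?_ (norm_nonneg _)
          rw [Real.norm_of_nonneg (by positivity), Real.norm_of_nonneg (by positivity)]
          exact hle ξ⟩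
      map_add' := fun _ _ => rfl
      map_smul' := fun _ _ => rfl } 1 fun u => by
    refine norm_le_of_ft_le (Filter.Eventually.of_forall fun ξ => ?_)
    rw [one_mul]
    exact mul_le_mul_of_nonneg_right (hle ξ) (norm_nonneg _)

@[simp] theorem toL2_emb (h : ρ ≤ r) (u : Sob d r) : (emb h u).toL2 = u.toL2 := rfl

@[simp] theorem ft_emb (h : ρ ≤ r) (u : Sob d r) : ft (emb h u) = ft u := rfl

theorem norm_emb_le (h : ρ ≤ r) (u : Sob d r) : ‖emb h u‖ ≤ ‖u‖ := by
  rw [← one_mul ‖u‖]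
  refine norm_le_of_ft_le (Filter.Eventually.of_forall fun ξ => ?_)
  rw [one_mul, ft_emb]
  exact mul_le_mul_of_nonneg_right (Real.rpow_le_rpow_of_exponent_le (one_le_bracket ξ)
    (by linarith)) (norm_nonneg _)

/-- `sobolevENorm` only depends on the class of the function almost everywhere. -/
theorem sobolevENorm_eq_of_ae {f : E d → ℂ} {u : Sob d r} (h : f =ᵐ[volume] u) :
    sobolevENorm r f = ‖u‖ₑ := by
  have h0 : MemLp (⇑u.toL2) 2 volume := Lp.memLp _
  have h1 : MemLp f 2 volume := (memLp_congr_ae h).2 h0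
  rw [u.enorm_eq_sobolevENorm, sobolevENorm, sobolevENorm, dif_pos h0, dif_pos h1,
    MemLp.toLp_congr h1 h0 h]

theorem bracket_mul_rpow (h : ρ + 2 ≤ r) (ξ : E d) :
    (2 * Real.pi * ‖ξ‖) ^ 2 * bracket ξ ^ (ρ / 2) ≤ bracket ξ ^ (r / 2) := by
  calc _ ≤ bracket ξ ^ (1 : ℝ) * bracket ξ ^ (ρ / 2) := by
        refine mul_le_mul_of_nonneg_right ?_ (Real.rpow_nonneg (bracket_pos ξ).le _)
        rw [Real.rpow_one]; unfold bracket; linarith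
    _ = bracket ξ ^ (1 + ρ / 2) := (Real.rpow_add (bracket_pos ξ) _ _).symm
    _ ≤ _ := Real.rpow_le_rpow_of_exponent_le (one_le_bracket ξ) (by linarith)

theorem memLp_laplacian_symbol (h : 2 ≤ r) (u : Sob d r) :
    MemLp (fun ξ => ((-(2 * Real.pi * ‖ξ‖) ^ 2 : ℝ) : ℂ) * (𝓕 u.toL2 : L2 d) ξ) 2 volume := by
  refine MemLp.mono u.2 (AEStronglyMeasurable.mul (by fun_prop) (Lp.aestronglyMeasurable _))
    (Filter.Eventually.of_forall fun ξ => ?_)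
  simp only [weightedFourier, norm_mul]
  refine mul_le_mul_of_nonneg_right ?_ (norm_nonneg _)
  have := bracket_mul_rpow (ρ := 0) (by simpa using h) ξ
  rw [Complex.norm_real, Complex.norm_real, norm_neg, Real.norm_of_nonneg (by positivity),
    Real.norm_of_nonneg (by positivity)]
  simpa [bracket] using this

theorem fourier_lap (h : 2 ≤ r) (u : Sob d r) : (𝓕 (lap u.toL2) : L2 d) =ᵐ[volume]
    fun ξ => -((2 * Real.pi * ‖ξ‖) ^ 2 : ℝ) * ft u ξ := by
  rw [lap, dif_pos (memLp_laplacian_symbol h u), fourier_fourierInv_eq]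
  refine (MemLp.coeFn_toLp _).trans (Filter.Eventually.of_forall fun ξ => ?_)
  simp [ft]

theorem exists_toL2_eq_lap (h0 : 0 ≤ ρ) (h : ρ + 2 ≤ r) (u : Sob d r) :
    ∃ v : Sob d ρ, v.toL2 = lap u.toL2 := by
  have h2 : 2 ≤ r := by linarith
  refine ⟨⟨lap u.toL2, ?_⟩, rfl⟩
  refine MemLp.mono u.2 (AEStronglyMeasurable.mul (Complex.continuous_ofReal.comp
      (continuous_bracket_rpow (ρ / 2))).aestronglyMeasurable (Lp.aestronglyMeasurable _)) ?_
  filter_upwards [fourier_lap h2 u] with ξ hξ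
  have := bracket_mul_rpow h ξ
  change ‖((bracket ξ ^ (ρ / 2) : ℝ) : ℂ) * (𝓕 (lap u.toL2) : L2 d) ξ‖
    ≤ ‖((bracket ξ ^ (r / 2) : ℝ) : ℂ) * ft u ξ‖
  have hb : ∀ a : ℝ, 0 ≤ bracket ξ ^ a := fun a => Real.rpow_nonneg (bracket_pos ξ).le a
  rw [hξ, norm_mul, norm_mul, norm_mul, norm_neg, Complex.norm_real,
    Complex.norm_real, Complex.norm_real, Real.norm_of_nonneg (hb _),
    Real.norm_of_nonneg (by positivity), Real.norm_of_nonneg (hb _), ← mul_assoc,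
    mul_comm (bracket ξ ^ (ρ / 2))]
  exact mul_le_mul_of_nonneg_right this (norm_nonneg _)

theorem ft_of_toL2_eq_lap (h : 2 ≤ r) {u : Sob d r} {v : Sob d ρ} (hv : v.toL2 = lap u.toL2) :
    ft v =ᵐ[volume] fun ξ => -((2 * Real.pi * ‖ξ‖) ^ 2 : ℝ) * ft u ξ := by
  have h1 := fourier_lap h u
  rwa [← hv] at h1

theorem norm_le_of_toL2_eq_lap (h0 : 0 ≤ ρ) (h : ρ + 2 ≤ r) {u : Sob d r} {v : Sob d ρ}
    (hv : v.toL2 = lap u.toL2) : ‖v‖ ≤ 1 * ‖u‖ := by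
  refine norm_le_of_ft_le ?_
  filter_upwards [ft_of_toL2_eq_lap (by linarith) hv] with ξ hξ
  have := bracket_mul_rpow h ξ
  rw [hξ, norm_mul, norm_neg, Complex.norm_real, Real.norm_of_nonneg (by positivity), one_mul,
    ← mul_assoc, mul_comm (_ ^ _)]
  exact mul_le_mul_of_nonneg_right this (norm_nonneg _)

/-- The Laplacian as a bounded operator from `H^r` to `H^ρ`, for `0 ≤ ρ ≤ r - 2`. -/
def lapS (h0 : 0 ≤ ρ) (h : ρ + 2 ≤ r) : Sob d r →L[ℂ] Sob d ρ :=
  have hft : ∀ u : Sob d r, ft (exists_toL2_eq_lap h0 h u).choose =ᵐ[volume]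
      fun ξ => -((2 * Real.pi * ‖ξ‖) ^ 2 : ℝ) * ft u ξ := fun u =>
    ft_of_toL2_eq_lap (by linarith) (exists_toL2_eq_lap h0 h u).choose_spec
  LinearMap.mkContinuous
    { toFun := fun u => (exists_toL2_eq_lap h0 h u).choose
      map_add' := fun u v => by
        refine ext_ft ?_
        filter_upwards [hft (u + v), hft u, hft v, ft_add u v, ft_add
          (exists_toL2_eq_lap h0 h u).choose (exists_toL2_eq_lap h0 h v).choose]
          with ξ h1 h2 h3 h4 h5
        rw [h1, h5, h2, h3, h4]; ring
      map_smul' := fun c u => by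
        refine ext_ft ?_
        filter_upwards [hft (c • u), hft u, ft_smul c u, ft_smul c
          (exists_toL2_eq_lap h0 h u).choose] with ξ h1 h2 h3 h4
        rw [RingHom.id_apply, h1, h4, h2, h3]; ring } 1 fun u =>
    norm_le_of_toL2_eq_lap h0 h (exists_toL2_eq_lap h0 h u).choose_spec

@[simp] theorem toL2_lapS (h0 : 0 ≤ ρ) (h : ρ + 2 ≤ r) (u : Sob d r) :
    (lapS h0 h u).toL2 = lap u.toL2 := (exists_toL2_eq_lap h0 h u).choose_spec

theorem ft_lapS (h0 : 0 ≤ ρ) (h : ρ + 2 ≤ r) (u : Sob d r) : ft (lapS h0 h u) =ᵐ[volume]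
    fun ξ => -((2 * Real.pi * ‖ξ‖) ^ 2 : ℝ) * ft u ξ :=
  ft_of_toL2_eq_lap (by linarith) (toL2_lapS h0 h u)

theorem norm_lapS_le (h0 : 0 ≤ ρ) (h : ρ + 2 ≤ r) (u : Sob d r) : ‖lapS h0 h u‖ ≤ ‖u‖ := by
  simpa using norm_le_of_toL2_eq_lap h0 h (toL2_lapS h0 h u)

end Sob

/-! ### The algebra `H^r` for `r > d/2` -/

namespace Sob

variable {d : ℕ} {r ρ : ℝ}

theorem lintegral_bracket_rpow_lt_top (hr : (d : ℝ) / 2 < r) :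
    ∫⁻ ξ : E d, ENNReal.ofReal (bracket ξ ^ (-r)) < ⊤ := by
  have hr0 : 0 ≤ r := le_trans (by positivity) hr.le
  have h := (integrable_rpow_neg_one_add_norm_sq (E := E d) (μ := volume) (r := 2 * r)
    (by simp only [finrank_euclideanSpace, Fintype.card_fin]; linarith)).lintegral_lt_top
  refine lt_of_le_of_lt (lintegral_mono fun ξ => ENNReal.ofReal_le_ofReal ?_) h
  rw [show -(2 * r) / 2 = -r by ring]
  refine Real.rpow_le_rpow_of_nonpos (by positivity) ?_ (by linarith)
  unfold bracket
  have h1 : (1 : ℝ) ≤ 2 * Real.pi := by linarith [Real.pi_gt_three]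
  have h2 : ‖ξ‖ ≤ 2 * Real.pi * ‖ξ‖ := le_mul_of_one_le_left (norm_nonneg _) h1
  gcongr

/-- For `r > d/2` the Fourier transform maps `H^r` continuously to `L¹`. -/
theorem exists_lintegral_ft_le (hr : (d : ℝ) / 2 < r) :
    ∃ C : ℝ≥0∞, C ≠ ⊤ ∧ ∀ u : Sob d r, ∫⁻ ξ, ‖ft u ξ‖ₑ ≤ C * ‖u‖ₑ := by
  refine ⟨(∫⁻ ξ : E d, ENNReal.ofReal (bracket ξ ^ (-r))) ^ (1 / 2 : ℝ),
    (ENNReal.rpow_lt_top_of_nonneg (by norm_num) (lintegral_bracket_rpow_lt_top hr).ne).ne,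
    fun u => ?_⟩
  have h := ENNReal.lintegral_mul_le_Lp_mul_Lq volume (p := 2) (q := 2)
    (by norm_num [Real.holderConjugate_iff])
    (f := fun ξ : E d => ENNReal.ofReal (bracket ξ ^ (-r / 2)))
    (g := fun ξ => ENNReal.ofReal (bracket ξ ^ (r / 2)) * ‖ft u ξ‖ₑ)
    (continuous_bracket_rpow _).measurable.ennreal_ofReal.aemeasurable
    ((continuous_bracket_rpow _).measurable.ennreal_ofReal.aemeasurable.mul
      u.aestronglyMeasurable_ft.enorm)
  have e1 : ∀ ξ : E d, ENNReal.ofReal (bracket ξ ^ (-r / 2)) *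
      (ENNReal.ofReal (bracket ξ ^ (r / 2)) * ‖ft u ξ‖ₑ) = ‖ft u ξ‖ₑ := fun ξ => by
    rw [← mul_assoc, ← ENNReal.ofReal_mul (Real.rpow_nonneg (bracket_pos ξ).le _),
      ← Real.rpow_add (bracket_pos ξ)]
    simp [neg_div]
  have e2 : ∀ ξ : E d, ENNReal.ofReal (bracket ξ ^ (-r / 2)) ^ (2 : ℝ)
      = ENNReal.ofReal (bracket ξ ^ (-r)) := fun ξ => by
    rw [ENNReal.ofReal_rpow_of_nonneg (Real.rpow_nonneg (bracket_pos ξ).le _) zero_le_two,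
      ← Real.rpow_mul (bracket_pos ξ).le]
    ring_nf
  simp only [Pi.mul_apply, e1, e2] at h
  refine h.trans_eq ?_
  congr 1
  simp only [ENNReal.rpow_two]
  rw [← enorm_sq_eq_lintegral, ← ENNReal.rpow_natCast, ← ENNReal.rpow_mul]
  norm_num

theorem integrable_ft (hr : (d : ℝ) / 2 < r) (u : Sob d r) : Integrable (ft u) := by
  obtain ⟨C, hC, h⟩ := exists_lintegral_ft_le hr
  exact ⟨u.aestronglyMeasurable_ft, (h u).trans_lt (ENNReal.mul_lt_top hC.lt_top enorm_lt_top)⟩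

theorem coe_ae_eq_fourierInv_ft (hr : (d : ℝ) / 2 < r) (u : Sob d r) :
    (u : E d → ℂ) =ᵐ[volume] 𝓕⁻ (ft u) :=
  ae_eq_fourierInv_fourier (integrable_ft hr u)

theorem coe_ae_eq_fourierInv_of_ft {u : Sob d r} {f : E d → ℂ} (hf : Integrable f)
    (h : ft u =ᵐ[volume] f) : (u : E d → ℂ) =ᵐ[volume] 𝓕⁻ f := by
  have hf2 : MemLp f 2 volume := (memLp_congr_ae h).1 (Lp.memLp _)
  have h1 : (𝓕 u.toL2 : L2 d) = hf2.toLp f := Lp.ext (h.trans hf2.coeFn_toLp.symm)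
  have h2 := ae_eq_fourierInv_of_integrable hf hf2
  rwa [← h1, fourierInv_fourier_eq] at h2

/-- The weight `(1 + |2πξ|²)^(r/2)` is subadditive up to a factor. -/
theorem bracket_rpow_le (hr : 0 ≤ r) (ξ η : E d) :
    bracket ξ ^ (r / 2) ≤ 4 ^ (r / 2) * (bracket η ^ (r / 2) + bracket (ξ - η) ^ (r / 2)) := by
  have h1 : bracket ξ ≤ 4 * max (bracket η) (bracket (ξ - η)) := by
    have h2 : ‖ξ‖ ≤ ‖η‖ + ‖ξ - η‖ := by simpa using norm_add_le η (ξ - η)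
    have h3 : ‖ξ‖ ^ 2 ≤ 2 * ‖η‖ ^ 2 + 2 * ‖ξ - η‖ ^ 2 := by
      nlinarith [norm_nonneg ξ, sq_nonneg (‖η‖ - ‖ξ - η‖)]
    have h4 := mul_le_mul_of_nonneg_left h3 (sq_nonneg (2 * Real.pi))
    have h5 : bracket ξ ≤ 2 * bracket η + 2 * bracket (ξ - η) := by
      unfold bracket; nlinarith
    linarith [le_max_left (bracket η) (bracket (ξ - η)), le_max_right (bracket η) (bracket (ξ - η))]
  calc bracket ξ ^ (r / 2) ≤ (4 * max (bracket η) (bracket (ξ - η))) ^ (r / 2) :=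
        Real.rpow_le_rpow (bracket_pos ξ).le h1 (by positivity)
    _ = 4 ^ (r / 2) * max (bracket η) (bracket (ξ - η)) ^ (r / 2) :=
        Real.mul_rpow (by norm_num) ((bracket_pos η).le.trans (le_max_left _ _))
    _ ≤ _ := by
        gcongr
        have a := Real.rpow_nonneg (bracket_pos η).le (r / 2)
        have b := Real.rpow_nonneg (bracket_pos (ξ - η)).le (r / 2)
        rcases max_choice (bracket η) (bracket (ξ - η)) with h | h <;> rw [h] <;> linarith

/-- The algebra estimate for `H^r`, `r > d/2`, on the Fourier side. -/
theorem lintegral_weight_convolution_le (hr : 0 ≤ r) (u v : Sob d r) :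
    ∫⁻ ξ, (ENNReal.ofReal (bracket ξ ^ (r / 2)) *
        ‖(ft u ⋆[ContinuousLinearMap.mul ℂ ℂ] ft v) ξ‖ₑ) ^ 2
      ≤ ENNReal.ofReal (4 ^ (r / 2)) ^ 2 * (2 * ((∫⁻ ξ, ‖ft v ξ‖ₑ) ^ 2 * ‖u‖ₑ ^ 2
        + (∫⁻ ξ, ‖ft u ξ‖ₑ) ^ 2 * ‖v‖ₑ ^ 2)) := by
  set W : E d → ℝ≥0∞ := fun ξ => ENNReal.ofReal (bracket ξ ^ (r / 2)) with hW
  have hWm : Measurable W := (continuous_bracket_rpow _).measurable.ennreal_ofReal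
  have hum : AEMeasurable (fun ξ => ‖ft u ξ‖ₑ) volume := u.aestronglyMeasurable_ft.enorm
  have hvm : AEMeasurable (fun ξ => ‖ft v ξ‖ₑ) volume := v.aestronglyMeasurable_ft.enorm
  have hWu : AEMeasurable (fun ξ => W ξ * ‖ft u ξ‖ₑ) volume := hWm.aemeasurable.mul hum
  have hWv : AEMeasurable (fun ξ => W ξ * ‖ft v ξ‖ₑ) volume := hWm.aemeasurable.mul hvm
  set A : E d → ℝ≥0∞ := fun ξ => ∫⁻ y, ‖ft v y‖ₑ * (W (ξ - y) * ‖ft u (ξ - y)‖ₑ)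
  set D : E d → ℝ≥0∞ := fun ξ => ∫⁻ y, ‖ft u y‖ₑ * (W (ξ - y) * ‖ft v (ξ - y)‖ₑ)
  have hsub : ∀ (f : E d → ℝ≥0∞), AEMeasurable f → ∀ ξ, AEMeasurable fun y => f (ξ - y) :=
    fun f hf ξ => hf.comp_quasiMeasurePreserving (quasiMeasurePreserving_sub_left volume ξ)
  have hA : ∀ ξ, A ξ = ∫⁻ y, W y * ‖ft u y‖ₑ * ‖ft v (ξ - y)‖ₑ := fun ξ => by
    rw [← lintegral_sub_left_eq_self (fun y => W y * ‖ft u y‖ₑ * ‖ft v (ξ - y)‖ₑ) ξ]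
    refine lintegral_congr fun y => ?_
    rw [sub_sub_cancel, mul_comm]
  -- the weight at `ξ` is distributed over `y` and `ξ - y`
  have hpt : ∀ ξ, W ξ * ‖(ft u ⋆[ContinuousLinearMap.mul ℂ ℂ] ft v) ξ‖ₑ
      ≤ ENNReal.ofReal (4 ^ (r / 2)) * (A ξ + D ξ) := by
    intro ξ
    calc W ξ * ‖(ft u ⋆[ContinuousLinearMap.mul ℂ ℂ] ft v) ξ‖ₑ
        ≤ W ξ * ∫⁻ y, ‖ft u y‖ₑ * ‖ft v (ξ - y)‖ₑ := by
          gcongr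
          refine (enorm_integral_le_lintegral_enorm _).trans_eq (lintegral_congr fun y => ?_)
          simp [enorm_mul]
      _ = ∫⁻ y, W ξ * (‖ft u y‖ₑ * ‖ft v (ξ - y)‖ₑ) := by
          rw [lintegral_const_mul' _ _ ENNReal.ofReal_ne_top]
      _ ≤ ∫⁻ y, ENNReal.ofReal (4 ^ (r / 2)) * (W y * ‖ft u y‖ₑ * ‖ft v (ξ - y)‖ₑ
            + ‖ft u y‖ₑ * (W (ξ - y) * ‖ft v (ξ - y)‖ₑ)) := by
          refine lintegral_mono fun y => ?_
          have h : W ξ ≤ ENNReal.ofReal (4 ^ (r / 2)) * (W y + W (ξ - y)) := by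
            simp only [hW]
            rw [← ENNReal.ofReal_add (Real.rpow_nonneg (bracket_pos _).le _)
              (Real.rpow_nonneg (bracket_pos _).le _), ← ENNReal.ofReal_mul (by positivity)]
            exact ENNReal.ofReal_le_ofReal (bracket_rpow_le hr ξ y)
          calc _ ≤ ENNReal.ofReal (4 ^ (r / 2)) * (W y + W (ξ - y)) *
                (‖ft u y‖ₑ * ‖ft v (ξ - y)‖ₑ) := by gcongr
            _ = _ := by ring
      _ = _ := by
          rw [lintegral_const_mul' _ _ ENNReal.ofReal_ne_top, hA]
          congr 1
          exact lintegral_add_left' (hWu.mul (hsub _ hvm ξ)) _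
  have hAm : AEMeasurable A volume := by
    have : AEMeasurable (fun p : E d × E d => W (p.1 - p.2) * ‖ft u (p.1 - p.2)‖ₑ)
        (volume.prod volume) := hWu.comp_quasiMeasurePreserving
      (quasiMeasurePreserving_sub_of_right_invariant volume volume)
    exact (AEMeasurable.mul hvm.comp_snd this).lintegral_prod_right'
  calc _ ≤ ∫⁻ ξ, ENNReal.ofReal (4 ^ (r / 2)) ^ 2 * (2 * (A ξ ^ 2 + D ξ ^ 2)) := by
        refine lintegral_mono fun ξ => ?_
        calc _ ≤ (ENNReal.ofReal (4 ^ (r / 2)) * (A ξ + D ξ)) ^ 2 :=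
            pow_le_pow_left' (hpt ξ) 2
          _ ≤ _ := by
            rw [mul_pow]
            gcongr
            have h := ENNReal.rpow_add_le_mul_rpow_add_rpow (A ξ) (D ξ) one_le_two
            norm_num [ENNReal.rpow_two] at h
            exact h
    _ = ENNReal.ofReal (4 ^ (r / 2)) ^ 2 * (2 * (∫⁻ ξ, A ξ ^ 2 + D ξ ^ 2)) := by
        rw [lintegral_const_mul' _ _ (by finiteness), lintegral_const_mul' _ _ (by finiteness)]
    _ ≤ _ := by
        rw [lintegral_add_left' (hAm.pow_const 2), enorm_sq_eq_lintegral, enorm_sq_eq_lintegral]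
        gcongr
        · exact lintegral_convolution_sq_le hvm hWu
        · exact lintegral_convolution_sq_le hum hWv

/-- For `r > d/2` the space `H^r` is closed under pointwise products, with a norm estimate. -/
theorem exists_mul (hr : (d : ℝ) / 2 < r) : ∃ C : ℝ, 0 ≤ C ∧ ∀ u v : Sob d r, ∃ w : Sob d r,
    ((w : E d → ℂ) =ᵐ[volume] fun x => u x * v x) ∧ ‖w‖ ≤ C * ‖u‖ * ‖v‖ := by
  have hr0 : 0 ≤ r := le_trans (by positivity) hr.le
  obtain ⟨C, hC, hC1⟩ := exists_lintegral_ft_le hr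
  refine ⟨(4 : ℝ) ^ (r / 2) * 2 * C.toReal, by positivity, fun u v => ?_⟩
  have hI := (integrable_ft hr u).integrable_convolution (ContinuousLinearMap.mul ℂ ℂ)
    (integrable_ft hr v)
  have hle : ∫⁻ ξ, (ENNReal.ofReal (bracket ξ ^ (r / 2)) *
      ‖(ft u ⋆[ContinuousLinearMap.mul ℂ ℂ] ft v) ξ‖ₑ) ^ 2
      ≤ (ENNReal.ofReal (4 ^ (r / 2)) * 2 * C * ‖u‖ₑ * ‖v‖ₑ) ^ 2 := by
    refine (lintegral_weight_convolution_le hr0 u v).trans ?_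
    calc _ ≤ ENNReal.ofReal (4 ^ (r / 2)) ^ 2 * (2 * ((C * ‖v‖ₑ) ^ 2 * ‖u‖ₑ ^ 2
        + (C * ‖u‖ₑ) ^ 2 * ‖v‖ₑ ^ 2)) := by
          gcongr
          · exact hC1 v
          · exact hC1 u
      _ = _ := by ring
  have hfin : ENNReal.ofReal (4 ^ (r / 2)) * 2 * C * ‖u‖ₑ * ‖v‖ₑ < ⊤ := by
    have := enorm_ne_top (x := u); have := enorm_ne_top (x := v); finiteness
  obtain ⟨w, hw⟩ := exists_ft_eq hr0 hI.aestronglyMeasurable (hle.trans_lt (by finiteness))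
  refine ⟨w, ?_, ?_⟩
  · filter_upwards [coe_ae_eq_fourierInv_of_ft hI hw, coe_ae_eq_fourierInv_ft hr u,
      coe_ae_eq_fourierInv_ft hr v] with x h1 h2 h3
    rw [h1, h2, h3, fourierInv_convolution (integrable_ft hr u) (integrable_ft hr v)]
  · have h1 : ‖w‖ₑ ^ 2 ≤ (ENNReal.ofReal (4 ^ (r / 2)) * 2 * C * ‖u‖ₑ * ‖v‖ₑ) ^ 2 := by
      rw [enorm_sq_eq_lintegral]
      refine le_trans (le_of_eq (lintegral_congr_ae ?_)) hle
      filter_upwards [hw] with ξ hξ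
      rw [hξ]
    have h2 := (ENNReal.pow_le_pow_left_iff two_ne_zero).1 h1
    have h3 := ENNReal.toReal_mono hfin.ne h2
    have h4 : (0 : ℝ) ≤ 4 ^ (r / 2) := by positivity
    simpa only [ENNReal.toReal_mul, toReal_enorm, ENNReal.toReal_ofReal h4,
      ENNReal.toReal_ofNat] using h3

/-- The pointwise product on `H^r`, `r > d/2`, as a bounded bilinear map. -/
def mulS (hr : (d : ℝ) / 2 < r) : Sob d r →L[ℂ] Sob d r →L[ℂ] Sob d r :=
  have hc : ∀ u v : Sob d r, (((exists_mul hr).choose_spec.2 u v).choose : E d → ℂ)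
      =ᵐ[volume] fun x => u x * v x := fun u v =>
    ((exists_mul hr).choose_spec.2 u v).choose_spec.1
  LinearMap.mkContinuous₂
    (LinearMap.mk₂ ℂ (fun u v => ((exists_mul hr).choose_spec.2 u v).choose)
      (fun u u' v => ext_ae (by
        filter_upwards [hc (u + u') v, hc u v, hc u' v, coe_add u u', coe_add
          ((exists_mul hr).choose_spec.2 u v).choose ((exists_mul hr).choose_spec.2 u' v).choose]
          with x h1 h2 h3 h4 h5
        rw [h1, h5, h2, h3, h4]; ring))
      (fun c u v => ext_ae (by
        filter_upwards [hc (c • u) v, hc u v, coe_smul c u, coe_smul c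
          ((exists_mul hr).choose_spec.2 u v).choose] with x h1 h2 h3 h4
        rw [h1, h4, h2, h3]; ring))
      (fun u v v' => ext_ae (by
        filter_upwards [hc u (v + v'), hc u v, hc u v', coe_add v v', coe_add
          ((exists_mul hr).choose_spec.2 u v).choose ((exists_mul hr).choose_spec.2 u v').choose]
          with x h1 h2 h3 h4 h5
        rw [h1, h5, h2, h3, h4]; ring))
      (fun c u v => ext_ae (by
        filter_upwards [hc u (c • v), hc u v, coe_smul c v, coe_smul c
          ((exists_mul hr).choose_spec.2 u v).choose] with x h1 h2 h3 h4
        rw [h1, h4, h2, h3]; ring)))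
    (exists_mul hr).choose fun u v => ((exists_mul hr).choose_spec.2 u v).choose_spec.2

theorem coe_mulS (hr : (d : ℝ) / 2 < r) (u v : Sob d r) :
    (mulS hr u v : E d → ℂ) =ᵐ[volume] fun x => u x * v x :=
  ((exists_mul hr).choose_spec.2 u v).choose_spec.1

theorem fourierInv_conj_neg (f : E d → ℂ) (x : E d) :
    𝓕⁻ (fun ξ => conj (f (-ξ))) x = conj (𝓕⁻ f x) := by
  rw [Real.fourierInv_eq', Real.fourierInv_eq', ← integral_conj,
    ← integral_neg_eq_self]
  refine integral_congr_ae (Filter.Eventually.of_forall fun ξ => ?_)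
  simp [← Complex.exp_conj, Complex.conj_ofNat]

theorem exists_conj (hr : (d : ℝ) / 2 < r) (u : Sob d r) : ∃ w : Sob d r,
    ((w : E d → ℂ) =ᵐ[volume] fun x => conj (u x)) ∧ ‖w‖ = ‖u‖ := by
  have hr0 : 0 ≤ r := le_trans (by positivity) hr.le
  have hI : Integrable (fun ξ => conj (ft u (-ξ))) :=
    (integrable_ft hr u).comp_neg.norm.mono'
      (Complex.continuous_conj.comp_aestronglyMeasurable
        (integrable_ft hr u).comp_neg.aestronglyMeasurable)
      (Filter.Eventually.of_forall fun ξ => by simp)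
  have hle : ∫⁻ ξ, (ENNReal.ofReal (bracket ξ ^ (r / 2)) * ‖conj (ft u (-ξ))‖ₑ) ^ 2
      = ‖u‖ₑ ^ 2 := by
    rw [enorm_sq_eq_lintegral, ← lintegral_neg_eq_self]
    refine lintegral_congr fun ξ => ?_
    simp [bracket, ← ofReal_norm]
  obtain ⟨w, hw⟩ := exists_ft_eq hr0 hI.aestronglyMeasurable
    (hle.trans_lt (ENNReal.pow_lt_top enorm_lt_top))
  refine ⟨w, ?_, ?_⟩
  · filter_upwards [coe_ae_eq_fourierInv_of_ft hI hw, coe_ae_eq_fourierInv_ft hr u] with x h1 h2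
    rw [h1, h2, fourierInv_conj_neg]
  · have h1 : ‖w‖ₑ ^ 2 = ‖u‖ₑ ^ 2 := by
      rw [enorm_sq_eq_lintegral, ← hle]
      refine lintegral_congr_ae ?_
      filter_upwards [hw] with ξ hξ
      rw [hξ]
    have h2 : ‖w‖ₑ = ‖u‖ₑ := le_antisymm ((ENNReal.pow_le_pow_left_iff two_ne_zero).1 h1.le)
      ((ENNReal.pow_le_pow_left_iff two_ne_zero).1 h1.ge)
    simpa using congrArg ENNReal.toReal h2

/-- Complex conjugation on `H^r`, `r > d/2`. -/
def conjS (hr : (d : ℝ) / 2 < r) : Sob d r →L[ℝ] Sob d r :=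
  have hc : ∀ u : Sob d r, ((exists_conj hr u).choose : E d → ℂ) =ᵐ[volume]
      fun x => conj (u x) := fun u => (exists_conj hr u).choose_spec.1
  LinearMap.mkContinuous
    { toFun := fun u => (exists_conj hr u).choose
      map_add' := fun u v => ext_ae (by
        filter_upwards [hc (u + v), hc u, hc v, coe_add u v, coe_add
          (exists_conj hr u).choose (exists_conj hr v).choose] with x h1 h2 h3 h4 h5
        rw [h1, h5, h2, h3, h4, map_add])
      map_smul' := fun c u => ext_ae (by
        rw [← Complex.coe_smul, ← Complex.coe_smul]
        filter_upwards [hc ((c : ℂ) • u), hc u, coe_smul (c : ℂ) u, coe_smul (c : ℂ)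
          (exists_conj hr u).choose] with x h1 h2 h3 h4
        rw [RingHom.id_apply, h1, h4, h2, h3, map_mul, Complex.conj_ofReal]) } 1 fun u => by
    rw [one_mul]; exact (exists_conj hr u).choose_spec.2.le

theorem coe_conjS (hr : (d : ℝ) / 2 < r) (u : Sob d r) :
    (conjS hr u : E d → ℂ) =ᵐ[volume] fun x => conj (u x) := (exists_conj hr u).choose_spec.1

theorem norm_conjS (hr : (d : ℝ) / 2 < r) (u : Sob d r) : ‖conjS hr u‖ = ‖u‖ :=
  (exists_conj hr u).choose_spec.2

end Sob

/-! ### Difference quotients and nonlinear terms in a normed space -/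

section Curves

open Set

variable {H : Type*} [NormedAddCommGroup H] [NormedSpace ℝ H] {s : Set ℝ} {α γ : ℝ} {f : ℝ → H}

theorem exists_norm_le_of_contDiffOn (hf : ContDiffOn ℝ ∞ f s) (hI : Icc α γ ⊆ s) :
    ∃ C, 0 ≤ C ∧ ∀ t ∈ Icc α γ, ‖f t‖ ≤ C := by
  obtain ⟨C, hC⟩ := isCompact_Icc.exists_bound_of_continuousOn (hf.continuousOn.mono hI)
  exact ⟨max C 0, le_max_right _ _, fun t ht => (hC t ht).trans (le_max_left _ _)⟩

theorem contDiffOn_deriv_of_isOpen (hs : IsOpen s) (hf : ContDiffOn ℝ ∞ f s) :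
    ContDiffOn ℝ ∞ (deriv f) s := hf.deriv_of_isOpen hs le_rfl

theorem hasDerivAt_of_contDiffOn (hs : IsOpen s) (hf : ContDiffOn ℝ ∞ f s) {t : ℝ} (ht : t ∈ s) :
    HasDerivAt f (deriv f t) t :=
  ((hf.differentiableOn (by simp)).differentiableAt (hs.mem_nhds ht)).hasDerivAt

theorem exists_norm_sub_le_of_contDiffOn (hs : IsOpen s) (hf : ContDiffOn ℝ ∞ f s)
    (hI : Icc α γ ⊆ s) :
    ∃ C, 0 ≤ C ∧ ∀ x ∈ Icc α γ, ∀ y ∈ Icc α γ, ‖f y - f x‖ ≤ C * |y - x| := by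
  obtain ⟨C, hC0, hC⟩ := exists_norm_le_of_contDiffOn (contDiffOn_deriv_of_isOpen hs hf) hI
  refine ⟨C, hC0, fun x hx y hy => ?_⟩
  exact Convex.norm_image_sub_le_of_norm_deriv_le
    (fun t ht => (hasDerivAt_of_contDiffOn hs hf (hI ht)).differentiableAt) hC (convex_Icc α γ) hx hy

/-- `f (m + h) + f (m - h) - 2 f m` is `O(h²)`: its derivative in `h` is
`f' (m + h) - f' (m - h) = O(h)`. -/
theorem exists_centered_average_le (hs : IsOpen s) (hf : ContDiffOn ℝ ∞ f s) (hI : Icc α γ ⊆ s) :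
    ∃ C, 0 ≤ C ∧ ∀ m h : ℝ, 0 ≤ h → α ≤ m - h → m + h ≤ γ →
      ‖f (m + h) + f (m - h) - (2 : ℝ) • f m‖ ≤ C * h ^ 2 := by
  obtain ⟨C, hC0, hC⟩ := exists_norm_sub_le_of_contDiffOn hs (contDiffOn_deriv_of_isOpen hs hf) hI
  refine ⟨2 * C, by positivity, fun m h hh h1 h2 => ?_⟩
  have hd : ∀ x ∈ Icc 0 h, HasDerivWithinAt (fun x => f (m + x) + f (m - x))
      (deriv f (m + x) - deriv f (m - x)) (Icc 0 h) x := fun x hx => by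
    have a1 := (hasDerivAt_of_contDiffOn hs hf (t := m + x)
      (hI ⟨by linarith [hx.1, hx.2], by linarith [hx.1, hx.2]⟩)).comp_const_add m x
    have a2 := (hasDerivAt_of_contDiffOn hs hf (t := m - x)
      (hI ⟨by linarith [hx.1, hx.2], by linarith [hx.1, hx.2]⟩)).comp_const_sub m x
    simpa only [sub_eq_add_neg] using (a1.fun_add a2).hasDerivWithinAt
  have hb : ∀ x ∈ Ico 0 h, ‖deriv f (m + x) - deriv f (m - x)‖ ≤ 2 * C * h := fun x hx => by
    refine (hC (m - x) ⟨by linarith [hx.1, hx.2], by linarith [hx.1, hx.2]⟩ (m + x)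
      ⟨by linarith [hx.1, hx.2], by linarith [hx.1, hx.2]⟩).trans ?_
    rw [show m + x - (m - x) = 2 * x by ring, abs_of_nonneg (by linarith [hx.1])]
    nlinarith [hx.2]
  have := norm_image_sub_le_of_norm_deriv_le_segment' hd hb h ⟨hh, le_rfl⟩
  simp only [add_zero, sub_zero] at this
  rw [two_smul]
  nlinarith

/-- `f (m + h) - f (m - h) - 2 h f' m` is `O(h³)`: its derivative in `h` is
`f' (m + h) + f' (m - h) - 2 f' m = O(h²)`. -/
theorem exists_centered_difference_le (hs : IsOpen s) (hf : ContDiffOn ℝ ∞ f s)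
    (hI : Icc α γ ⊆ s) :
    ∃ C, 0 ≤ C ∧ ∀ m h : ℝ, 0 ≤ h → α ≤ m - h → m + h ≤ γ →
      ‖f (m + h) - f (m - h) - (2 * h) • deriv f m‖ ≤ C * h ^ 3 := by
  obtain ⟨C, hC0, hC⟩ := exists_centered_average_le hs (contDiffOn_deriv_of_isOpen hs hf) hI
  refine ⟨C, hC0, fun m h hh h1 h2 => ?_⟩
  have hd : ∀ x ∈ Icc 0 h, HasDerivWithinAt (fun x => f (m + x) - f (m - x) - (2 * x) • deriv f m)
      (deriv f (m + x) + deriv f (m - x) - (2 : ℝ) • deriv f m) (Icc 0 h) x := fun x hx => by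
    have a1 := (hasDerivAt_of_contDiffOn hs hf (t := m + x)
      (hI ⟨by linarith [hx.1, hx.2], by linarith [hx.1, hx.2]⟩)).comp_const_add m x
    have a2 := (hasDerivAt_of_contDiffOn hs hf (t := m - x)
      (hI ⟨by linarith [hx.1, hx.2], by linarith [hx.1, hx.2]⟩)).comp_const_sub m x
    have a3 := ((hasDerivAt_id x).const_mul 2).smul_const (deriv f m)
    simpa using ((a1.fun_sub a2).fun_sub a3).hasDerivWithinAt
  have hb : ∀ x ∈ Ico 0 h, ‖deriv f (m + x) + deriv f (m - x) - (2 : ℝ) • deriv f m‖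
      ≤ C * h ^ 2 := fun x hx => by
    refine (hC m x hx.1 (by linarith [hx.2]) (by linarith [hx.2])).trans ?_
    have := hx.1; have := hx.2.le
    gcongr
  have := norm_image_sub_le_of_norm_deriv_le_segment' hd hb h ⟨hh, le_rfl⟩
  simp only [add_zero, sub_zero, mul_zero, zero_smul, sub_self] at this
  exact this.trans_eq (by ring)

end Curves

section Source

variable {H : Type*} [NormedAddCommGroup H] [NormedSpace ℂ H]
  (B : H →L[ℂ] H →L[ℂ] H) (J : H →L[ℝ] H)

/-- `2 Re (v conj p)`, where `B` stands for the product and `J` for the conjugation. -/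
def xi (v p : H) : H := B v (J p) + B p (J v)

/-- The nonlinear term `U w + 2 Re (x conj p) y` of the equation for the time derivative. -/
def vSource (U w x p y : H) : H := B U w + B (xi B J x p) y

variable {B J} {M D : ℝ}

theorem norm_bilin_sub_le {a b a' b' : H} {M M' D D' : ℝ} (hb : ‖b‖ ≤ M) (ha : ‖a'‖ ≤ M')
    (hD : ‖a - a'‖ ≤ D) (hD' : ‖b - b'‖ ≤ D') :
    ‖B a b - B a' b'‖ ≤ ‖B‖ * (D * M + M' * D') := by
  have h : B a b - B a' b' = B (a - a') b + B a' (b - b') := by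
    simp only [map_sub, sub_apply]; abel
  have h0 : 0 ≤ D := (norm_nonneg _).trans hD
  have h1 : 0 ≤ M' := (norm_nonneg _).trans ha
  rw [h, mul_add]
  refine (norm_add_le _ _).trans (add_le_add ?_ ?_)
  · refine (B.le_opNorm₂ _ _).trans ?_
    rw [mul_assoc]; gcongr
  · refine (B.le_opNorm₂ _ _).trans ?_
    rw [mul_assoc]; gcongr

theorem norm_xi_le (hJ : ∀ x, ‖J x‖ ≤ ‖x‖) {v p : H} (hv : ‖v‖ ≤ M) (hp : ‖p‖ ≤ M) :
    ‖xi B J v p‖ ≤ 2 * ‖B‖ * M ^ 2 := by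
  have h0 : 0 ≤ M := (norm_nonneg _).trans hv
  have h1 : ‖B v (J p)‖ ≤ ‖B‖ * M * M := (B.le_opNorm₂ _ _).trans (by
    have := (hJ p).trans hp; gcongr)
  have h2 : ‖B p (J v)‖ ≤ ‖B‖ * M * M := (B.le_opNorm₂ _ _).trans (by
    have := (hJ v).trans hv; gcongr)
  refine (norm_add_le _ _).trans ?_
  linarith

theorem norm_xi_sub_le (hJ : ∀ x, ‖J x‖ ≤ ‖x‖) {v p v' p' : H} (hv : ‖v‖ ≤ M) (hp : ‖p‖ ≤ M)
    (hv' : ‖v'‖ ≤ M) (hp' : ‖p'‖ ≤ M) (h1 : ‖v - v'‖ ≤ D) (h2 : ‖p - p'‖ ≤ D) :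
    ‖xi B J v p - xi B J v' p'‖ ≤ 4 * ‖B‖ * M * D := by
  have a1 := norm_bilin_sub_le (B := B) (b := J p) (b' := J p') (D' := D) ((hJ p).trans hp) hv' h1
    (by rw [← map_sub]; exact (hJ _).trans h2)
  have a2 := norm_bilin_sub_le (B := B) (b := J v) (b' := J v') (D' := D) ((hJ v).trans hv) hp' h2
    (by rw [← map_sub]; exact (hJ _).trans h1)
  have h : xi B J v p - xi B J v' p'
      = (B v (J p) - B v' (J p')) + (B p (J v) - B p' (J v')) := by unfold xi; abel
  rw [h]
  refine (norm_add_le _ _).trans ?_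
  linarith

/-- Lipschitz constant of `vSource` on the ball of radius `M`. -/
theorem norm_vSource_sub_le (hJ : ∀ x, ‖J x‖ ≤ ‖x‖) {U w x p y U' w' x' p' y' : H}
    (hw : ‖w‖ ≤ M) (hx : ‖x‖ ≤ M) (hp : ‖p‖ ≤ M) (hy : ‖y‖ ≤ M)
    (hU' : ‖U'‖ ≤ M) (hx' : ‖x'‖ ≤ M) (hp' : ‖p'‖ ≤ M)
    (h1 : ‖U - U'‖ ≤ D) (h2 : ‖w - w'‖ ≤ D) (h3 : ‖x - x'‖ ≤ D) (h4 : ‖p - p'‖ ≤ D)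
    (h5 : ‖y - y'‖ ≤ D) :
    ‖vSource B J U w x p y - vSource B J U' w' x' p' y'‖
      ≤ (2 * ‖B‖ * M + 6 * ‖B‖ ^ 2 * M ^ 2) * D := by
  have a1 := norm_bilin_sub_le (B := B) hw hU' h1 h2
  have a2 := norm_bilin_sub_le (B := B) hy (norm_xi_le (B := B) hJ hx' hp')
    (norm_xi_sub_le (B := B) hJ hx hp hx' hp' h3 h4) h5
  have h : vSource B J U w x p y - vSource B J U' w' x' p' y'
      = (B U w - B U' w') + (B (xi B J x p) y - B (xi B J x' p') y') := by unfold vSource; abel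
  rw [h]
  refine (norm_add_le _ _).trans ?_
  linarith

theorem norm_average_two_le {x y : H} (hx : ‖x‖ ≤ M) (hy : ‖y‖ ≤ M) :
    ‖(1 / 2 : ℂ) • (x + y)‖ ≤ M := by
  have := norm_add_le x y
  rw [norm_smul]; norm_num; linarith

theorem norm_average_three_le {x y z : H} (hx : ‖x‖ ≤ M) (hy : ‖y‖ ≤ M) (hz : ‖z‖ ≤ M) :
    ‖(1 / 4 : ℂ) • (x + (2 : ℂ) • y + z)‖ ≤ M := by
  have h1 := norm_add₃_le (a := x) (b := (2 : ℂ) • y) (c := z)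
  have h2 : ‖(2 : ℂ) • y‖ = 2 * ‖y‖ := by rw [norm_smul]; norm_num
  rw [norm_smul]; norm_num; linarith

theorem norm_average_four_le {x y z w : H} (hx : ‖x‖ ≤ M) (hy : ‖y‖ ≤ M) (hz : ‖z‖ ≤ M)
    (hw : ‖w‖ ≤ M) : ‖(1 / 4 : ℂ) • (x + y + z + w)‖ ≤ M := by
  have h1 := norm_add₄_le (a := x) (b := y) (c := z) (d := w)
  rw [norm_smul]; norm_num; linarith

end Source

section Consistency

open Set

variable {H : Type*} [NormedAddCommGroup H] [NormedSpace ℂ H]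
  {B : H →L[ℂ] H →L[ℂ] H} {J : H →L[ℝ] H} {s : Set ℝ} {α γ : ℝ} {a l : ℝ → H} {β : ℝ}

theorem ContDiffOn.bilin {f g : ℝ → H} (hf : ContDiffOn ℝ ∞ f s) (hg : ContDiffOn ℝ ∞ g s) :
    ContDiffOn ℝ ∞ (fun t => B (f t) (g t)) s := by
  have := (B.bilinearRestrictScalars ℝ).isBoundedBilinearMap.contDiff (n := ∞).comp_contDiffOn
    (hf.prodMk hg)
  exact this

theorem HasDerivAt.bilin {f g : ℝ → H} {f' g' : H} {t : ℝ} (hf : HasDerivAt f f' t)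
    (hg : HasDerivAt g g' t) :
    HasDerivAt (fun t => B (f t) (g t)) (B f' (g t) + B (f t) g') t := by
  have := (B.bilinearRestrictScalars ℝ).hasFDerivAt_of_bilinear hf.hasFDerivAt hg.hasFDerivAt
  have h2 := this.hasDerivAt
  simpa [add_comm] using h2

theorem hasDerivAt_density {t : ℝ} (ha : HasDerivAt a (deriv a t) t) :
    HasDerivAt (fun t => B (a t) (J (a t))) (xi B J (deriv a t) (a t)) t :=
  HasDerivAt.bilin ha (J.hasFDerivAt.comp_hasDerivAt t ha)

/-- The time derivative of the equation `i a' + ½ l = β |a|² a`, where `l` stands for `Δ a`. -/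
theorem deriv_equation (hs : IsOpen s) (ha : ContDiffOn ℝ ∞ a s) (hl : ContDiffOn ℝ ∞ l s)
    (heq : ∀ t ∈ s, Complex.I • deriv a t + (1 / 2 : ℂ) • l t
      = (β : ℂ) • B (B (a t) (J (a t))) (a t)) {t : ℝ} (ht : t ∈ s) :
    Complex.I • deriv (deriv a) t + (1 / 2 : ℂ) • deriv l t
      = (β : ℂ) • vSource B J (B (a t) (J (a t))) (deriv a t) (deriv a t) (a t) (a t) := by
  have h1 := (hasDerivAt_of_contDiffOn hs (contDiffOn_deriv_of_isOpen hs ha) ht).const_smul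
    Complex.I
  have h2 := (hasDerivAt_of_contDiffOn hs hl ht).const_smul (1 / 2 : ℂ)
  have h3 := hasDerivAt_of_contDiffOn hs ha ht
  have h4 := (HasDerivAt.bilin (B := B) (hasDerivAt_density (B := B) (J := J) h3) h3).const_smul
    (β : ℂ)
  have h5 := (h1.add h2).congr_of_eventuallyEq (f₁ := fun t => (β : ℂ) • B (B (a t) (J (a t))) (a t))
    (by filter_upwards [hs.mem_nhds ht] with t ht using (heq t ht).symm)
  rw [vSource, add_comm (B _ _)]
  exact h5.unique h4

end Consistency

/-! ### Consistency of the difference equations -/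

section Residuals

open Set

variable {H : Type*} [NormedAddCommGroup H] [NormedSpace ℂ H]
  {B : H →L[ℂ] H →L[ℂ] H} {J : H →L[ℝ] H} {s : Set ℝ} {α γ : ℝ} {a l : ℝ → H} {β : ℝ}

/-- The centered second and first difference quotients are second order accurate. -/
theorem exists_centered_le {f : ℝ → H} (hs : IsOpen s) (hf : ContDiffOn ℝ ∞ f s)
    (hI : Icc α γ ⊆ s) :
    ∃ C, 0 ≤ C ∧ ∀ m h : ℝ, 0 ≤ h → α ≤ m - h → m + h ≤ γ →
      ‖f (m + h) + f (m - h) - (2 : ℂ) • f m‖ ≤ C * h ^ 2 ∧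
      ‖f (m + h) - f (m - h) - (2 * h : ℂ) • deriv f m‖ ≤ C * h ^ 3 := by
  obtain ⟨C, hC0, hC⟩ := exists_centered_average_le hs hf hI
  obtain ⟨C', hC0', hC'⟩ := exists_centered_difference_le hs hf hI
  refine ⟨C + C', by positivity, fun m h hh h1 h2 => ⟨?_, ?_⟩⟩
  · have := hC m h hh h1 h2
    rw [← Complex.coe_smul] at this
    push_cast at this
    have h3 : 0 ≤ C' * h ^ 2 := by positivity
    linarith
  · have := hC' m h hh h1 h2
    rw [← Complex.coe_smul] at this
    push_cast at this
    have h3 : 0 ≤ C * h ^ 3 := by positivity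
    linarith

/-- The Crank–Nicolson step is second order accurate along the exact solution. -/
theorem exists_cn_residual_le (hs : IsOpen s) (hI : Icc α γ ⊆ s) (ha : ContDiffOn ℝ ∞ a s)
    (hl : ContDiffOn ℝ ∞ l s) {ρ : ℝ → H} (hρ : ContDiffOn ℝ ∞ ρ s)
    (heq : ∀ t ∈ s, Complex.I • deriv a t + (1 / 2 : ℂ) • l t = (β : ℂ) • B (ρ t) (a t)) :
    ∃ C, 0 ≤ C ∧ ∀ m δ : ℝ, 0 < δ → α ≤ m - δ / 2 → m + δ / 2 ≤ γ →
      ‖(Complex.I / δ) • (a (m + δ / 2) - a (m - δ / 2))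
          + (1 / 4 : ℂ) • (l (m + δ / 2) + l (m - δ / 2))
          - (β : ℂ) • B (ρ m) ((1 / 2 : ℂ) • (a (m + δ / 2) + a (m - δ / 2)))‖ ≤ C * δ ^ 2 ∧
      ‖(1 / δ : ℂ) • (a (m + δ / 2) - a (m - δ / 2)) - deriv a m‖ ≤ C * δ ^ 2 := by
  obtain ⟨Ca, hCa0, hCa⟩ := exists_centered_le hs ha hI
  obtain ⟨Cl, hCl0, hCl⟩ := exists_centered_le hs hl hI
  obtain ⟨R, hR0, hR⟩ := exists_norm_le_of_contDiffOn hρ hI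
  refine ⟨Ca + Cl + |β| * (‖B‖ * R * Ca), by positivity, fun m δ hδ h1 h2 => ?_⟩
  have hδ' : (δ : ℂ) ≠ 0 := by exact_mod_cast hδ.ne'
  obtain ⟨a1, a2⟩ := hCa m (δ / 2) (by positivity) h1 h2
  obtain ⟨l1, -⟩ := hCl m (δ / 2) (by positivity) h1 h2
  have hm : m ∈ Icc α γ := ⟨by linarith, by linarith⟩
  set ap := a (m + δ / 2)
  set am := a (m - δ / 2)
  have e2 : (2 * ((δ / 2 : ℝ) : ℂ)) = δ := by push_cast; ring
  rw [e2] at a2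
  have hK : 0 ≤ |β| * (‖B‖ * R * Ca) := by positivity
  have hb : ‖B (ρ m) (ap + am - (2 : ℂ) • a m)‖ ≤ ‖B‖ * R * (Ca * (δ / 2) ^ 2) := by
    refine (B.le_opNorm₂ _ _).trans ?_
    have := hR m hm
    gcongr
  have hn1 : ‖Complex.I / (δ : ℂ)‖ = 1 / δ := by
    rw [norm_div, Complex.norm_I, Complex.norm_real, Real.norm_of_nonneg hδ.le]
  have hn2 : ‖(1 / δ : ℂ)‖ = 1 / δ := by
    rw [norm_div, norm_one, Complex.norm_real, Real.norm_of_nonneg hδ.le]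
  have hq : 1 / δ * (Ca * (δ / 2) ^ 3) = Ca * δ ^ 2 / 8 := by field_simp; norm_num
  have hsq : 0 ≤ Ca * δ ^ 2 := by positivity
  have hsq2 : 0 ≤ Cl * δ ^ 2 := by positivity
  have hsq3 : 0 ≤ |β| * (‖B‖ * R * Ca) * δ ^ 2 := by positivity
  have t1 : ‖(1 / δ : ℂ) • (ap - am - (δ : ℂ) • deriv a m)‖ ≤ Ca * δ ^ 2 / 8 := by
    rw [norm_smul, hn2, ← hq]; gcongr
  have t2 : ‖(Complex.I / δ : ℂ) • (ap - am - (δ : ℂ) • deriv a m)‖ ≤ Ca * δ ^ 2 / 8 := by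
    rw [norm_smul, hn1, ← hq]; gcongr
  constructor
  · have key : (Complex.I / δ) • (ap - am) + (1 / 4 : ℂ) • (l (m + δ / 2) + l (m - δ / 2))
          - (β : ℂ) • B (ρ m) ((1 / 2 : ℂ) • (ap + am))
        = (Complex.I / δ) • (ap - am - (δ : ℂ) • deriv a m)
          + (1 / 4 : ℂ) • (l (m + δ / 2) + l (m - δ / 2) - (2 : ℂ) • l m)
          - (β / 2 : ℂ) • B (ρ m) (ap + am - (2 : ℂ) • a m) := by
      have e1 : (Complex.I / δ) • (ap - am - (δ : ℂ) • deriv a m)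
          = (Complex.I / δ) • (ap - am) - Complex.I • deriv a m := by
        rw [smul_sub, smul_smul, div_mul_cancel₀ _ hδ']
      rw [e1, eq_sub_of_add_eq (heq m (hI hm))]
      simp only [map_sub, map_smul]
      module
    rw [key]
    refine (norm_sub_le_of_le (norm_add_le_of_le t2
      (norm_smul_le _ _)) (norm_smul_le _ _)).trans ?_
    have hnβ : ‖(β / 2 : ℂ)‖ = |β| / 2 := by
      rw [norm_div, Complex.norm_real, Real.norm_eq_abs]; norm_num
    have hn4 : ‖(1 / 4 : ℂ)‖ = 1 / 4 := by norm_num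
    rw [hnβ, hn4]
    have := mul_le_mul_of_nonneg_left hb (abs_nonneg β)
    nlinarith
  · have key : (1 / δ : ℂ) • (ap - am) - deriv a m
        = (1 / δ : ℂ) • (ap - am - (δ : ℂ) • deriv a m) := by
      rw [smul_sub _ (ap - am), smul_smul, one_div, inv_mul_cancel₀ hδ', one_smul]
    rw [key]
    linarith

/-- The leapfrog step for the density is second order accurate along the exact solution. -/
theorem exists_density_residual_le (hJ : ∀ x, ‖J x‖ ≤ ‖x‖) (hs : IsOpen s) (hI : Icc α γ ⊆ s)
    (ha : ContDiffOn ℝ ∞ a s) {ρ : ℝ → H} (hρ : ρ = fun t => B (a t) (J (a t))) :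
    ∃ C, 0 ≤ C ∧ ∀ m δ : ℝ, 0 < δ → α ≤ m - δ → m + δ ≤ γ →
      ‖ρ (m + δ) - ρ (m - δ) - (2 * δ : ℂ) • xi B J (deriv a m)
        ((1 / 2 : ℂ) • (a (m + δ / 2) + a (m - δ / 2)))‖ ≤ C * δ ^ 3 := by
  have hρs : ContDiffOn ℝ ∞ ρ s := hρ ▸ ContDiffOn.bilin ha (J.contDiff.comp_contDiffOn ha)
  have hv := contDiffOn_deriv_of_isOpen hs ha
  obtain ⟨Ca, hCa0, hCa⟩ := exists_centered_le hs ha hI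
  obtain ⟨Cρ, hCρ0, hCρ⟩ := exists_centered_le hs hρs hI
  obtain ⟨Ra, hRa0, hRa⟩ := exists_norm_le_of_contDiffOn ha hI
  obtain ⟨Rv, hRv0, hRv⟩ := exists_norm_le_of_contDiffOn hv hI
  refine ⟨Cρ + 8 * ‖B‖ * (Ra + Rv) * Ca, by positivity, fun m δ hδ h1 h2 => ?_⟩
  obtain ⟨-, r2⟩ := hCρ m δ hδ.le h1 h2
  obtain ⟨a1, -⟩ := hCa m (δ / 2) (by positivity) (by linarith) (by linarith)
  have hm : m ∈ Icc α γ := ⟨by linarith, by linarith⟩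
  have hd : deriv ρ m = xi B J (deriv a m) (a m) := by
    rw [hρ]; exact (hasDerivAt_density (hasDerivAt_of_contDiffOn hs ha (hI hm))).deriv
  have ha' : ‖(1 / 2 : ℂ) • (a (m + δ / 2) + a (m - δ / 2)) - a m‖ ≤ Ca * δ ^ 2 := by
    have : (1 / 2 : ℂ) • (a (m + δ / 2) + a (m - δ / 2)) - a m
        = (1 / 2 : ℂ) • (a (m + δ / 2) + a (m - δ / 2) - (2 : ℂ) • a m) := by module
    rw [this, norm_smul]
    norm_num
    nlinarith [mul_nonneg hCa0 (sq_nonneg δ)]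
  have hx := norm_xi_sub_le (B := B) (J := J) (M := Ra + Rv) hJ (v := deriv a m)
    (v' := deriv a m) (p := (1 / 2 : ℂ) • (a (m + δ / 2) + a (m - δ / 2))) (p' := a m)
    ((hRv m hm).trans (by linarith))
    (norm_average_two_le ((hRa _ ⟨by linarith, by linarith⟩).trans (by linarith))
      ((hRa _ ⟨by linarith, by linarith⟩).trans (by linarith)))
    ((hRv m hm).trans (by linarith)) ((hRa m hm).trans (by linarith))
    (by rw [sub_self, norm_zero]; positivity) ha'
  have key : ∀ X : H, ρ (m + δ) - ρ (m - δ) - (2 * δ : ℂ) • X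
      = (ρ (m + δ) - ρ (m - δ) - (2 * δ : ℂ) • deriv ρ m)
        - (2 * δ : ℂ) • (X - deriv ρ m) := fun X => by module
  have hn : ‖(2 * δ : ℂ)‖ = 2 * δ := by
    rw [norm_mul, Complex.norm_real, Real.norm_of_nonneg hδ.le]; norm_num
  rw [key, hd]
  rw [hd] at r2
  refine (norm_sub_le_of_le r2 (norm_smul_le _ _)).trans ?_
  rw [hn]
  have := mul_le_mul_of_nonneg_left hx (by positivity : 0 ≤ 2 * δ)
  nlinarith

/-- The step for the time derivative is second order accurate along the exact solution. -/
theorem exists_velocity_residual_le (hJ : ∀ x, ‖J x‖ ≤ ‖x‖) (hs : IsOpen s) (hI : Icc α γ ⊆ s)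
    (ha : ContDiffOn ℝ ∞ a s) (hl : ContDiffOn ℝ ∞ l s) {ρ : ℝ → H}
    (hρ : ρ = fun t => B (a t) (J (a t)))
    (heq : ∀ t ∈ s, Complex.I • deriv a t + (1 / 2 : ℂ) • l t = (β : ℂ) • B (ρ t) (a t)) :
    ∃ C, 0 ≤ C ∧ ∀ m δ : ℝ, 0 < δ → α ≤ m - 3 * δ / 2 → m + 3 * δ / 2 ≤ γ →
      ‖(Complex.I / (2 * δ)) • (deriv a (m + δ) - deriv a (m - δ))
        + (1 / 8 : ℂ) • (deriv l (m + δ) + (2 : ℂ) • deriv l m + deriv l (m - δ))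
        - (β : ℂ) • vSource B J ((1 / 2 : ℂ) • (ρ (m + δ) + ρ (m - δ)))
          ((1 / 4 : ℂ) • (deriv a (m + δ) + (2 : ℂ) • deriv a m + deriv a (m - δ)))
          (deriv a m) ((1 / 2 : ℂ) • (a (m + δ / 2) + a (m - δ / 2)))
          ((1 / 4 : ℂ) • (a (m + 3 * δ / 2) + a (m + δ / 2) + a (m - δ / 2)
            + a (m - 3 * δ / 2)))‖ ≤ C * δ ^ 2 := by
  have hρs : ContDiffOn ℝ ∞ ρ s := hρ ▸ ContDiffOn.bilin ha (J.contDiff.comp_contDiffOn ha)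
  have hv := contDiffOn_deriv_of_isOpen hs ha
  have hl' := contDiffOn_deriv_of_isOpen hs hl
  obtain ⟨Ca, hCa0, hCa⟩ := exists_centered_le hs ha hI
  obtain ⟨Cv, hCv0, hCv⟩ := exists_centered_le hs hv hI
  obtain ⟨Cl, hCl0, hCl⟩ := exists_centered_le hs hl' hI
  obtain ⟨Cρ, hCρ0, hCρ⟩ := exists_centered_le hs hρs hI
  obtain ⟨Ra, hRa0, hRa⟩ := exists_norm_le_of_contDiffOn ha hI
  obtain ⟨Rv, hRv0, hRv⟩ := exists_norm_le_of_contDiffOn hv hI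
  obtain ⟨Rρ, hRρ0, hRρ⟩ := exists_norm_le_of_contDiffOn hρs hI
  set M := Ra + Rv + Rρ with hM
  set K := 2 * ‖B‖ * M + 6 * ‖B‖ ^ 2 * M ^ 2 with hK
  have hM0 : 0 ≤ M := by positivity
  have hK0 : 0 ≤ K := by positivity
  refine ⟨Cv + Cl + |β| * (K * (Ca + Cv + Cρ)), by positivity, fun m δ hδ h1 h2 => ?_⟩
  have hδ' : (δ : ℂ) ≠ 0 := by exact_mod_cast hδ.ne'
  obtain ⟨r1, -⟩ := hCρ m δ hδ.le (by linarith) (by linarith)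
  obtain ⟨l1, -⟩ := hCl m δ hδ.le (by linarith) (by linarith)
  obtain ⟨v1, v2⟩ := hCv m δ hδ.le (by linarith) (by linarith)
  obtain ⟨a1, -⟩ := hCa m (δ / 2) (by positivity) (by linarith) (by linarith)
  obtain ⟨a3, -⟩ := hCa m (3 * δ / 2) (by positivity) (by linarith) (by linarith)
  have hm : m ∈ Icc α γ := ⟨by linarith, by linarith⟩
  have ba : ∀ t, α ≤ t → t ≤ γ → ‖a t‖ ≤ M := fun t h h' =>
    (hRa t ⟨h, h'⟩).trans (by linarith)
  have bv : ∀ t, α ≤ t → t ≤ γ → ‖deriv a t‖ ≤ M := fun t h h' =>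
    (hRv t ⟨h, h'⟩).trans (by linarith)
  have bρ : ∀ t, α ≤ t → t ≤ γ → ‖ρ t‖ ≤ M := fun t h h' =>
    (hRρ t ⟨h, h'⟩).trans (by linarith)
  have hD : ∀ c : ℝ, 0 ≤ c → 0 ≤ c * δ ^ 2 := fun c hc => by positivity
  have pa := hD Ca hCa0
  have pv := hD Cv hCv0
  have pρ := hD Cρ hCρ0
  have pl := hD Cl hCl0
  have hsrc := norm_vSource_sub_le (B := B) (J := J) (M := M)
    (D := (Ca + Cv + Cρ) * δ ^ 2) hJ
    (U := (1 / 2 : ℂ) • (ρ (m + δ) + ρ (m - δ))) (U' := ρ m)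
    (w := (1 / 4 : ℂ) • (deriv a (m + δ) + (2 : ℂ) • deriv a m + deriv a (m - δ)))
    (w' := deriv a m) (x := deriv a m) (x' := deriv a m)
    (p := (1 / 2 : ℂ) • (a (m + δ / 2) + a (m - δ / 2))) (p' := a m)
    (y := (1 / 4 : ℂ) • (a (m + 3 * δ / 2) + a (m + δ / 2) + a (m - δ / 2)
            + a (m - 3 * δ / 2))) (y' := a m)
    (norm_average_three_le (bv _ (by linarith) (by linarith)) (bv _ hm.1 hm.2)
      (bv _ (by linarith) (by linarith))) (bv _ hm.1 hm.2)
    (norm_average_two_le (ba _ (by linarith) (by linarith)) (ba _ (by linarith) (by linarith)))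
    (norm_average_four_le (ba _ (by linarith) (by linarith)) (ba _ (by linarith) (by linarith))
      (ba _ (by linarith) (by linarith)) (ba _ (by linarith) (by linarith)))
    (bρ _ hm.1 hm.2) (bv _ hm.1 hm.2) (ba _ hm.1 hm.2)
    (by
      have : (1 / 2 : ℂ) • (ρ (m + δ) + ρ (m - δ)) - ρ m
        = (1 / 2 : ℂ) • (ρ (m + δ) + ρ (m - δ) - (2 : ℂ) • ρ m) := by module
      rw [this, norm_smul]; norm_num; linarith)
    (by
      have : (1 / 4 : ℂ) • (deriv a (m + δ) + (2 : ℂ) • deriv a m + deriv a (m - δ)) - deriv a m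
        = (1 / 4 : ℂ) • (deriv a (m + δ) + deriv a (m - δ) - (2 : ℂ) • deriv a m) := by module
      rw [this, norm_smul]; norm_num; linarith)
    (by rw [sub_self, norm_zero]; positivity)
    (by
      have : (1 / 2 : ℂ) • (a (m + δ / 2) + a (m - δ / 2)) - a m
        = (1 / 2 : ℂ) • (a (m + δ / 2) + a (m - δ / 2) - (2 : ℂ) • a m) := by module
      rw [this, norm_smul]; norm_num; linarith)
    (by
      have : (1 / 4 : ℂ) • (a (m + 3 * δ / 2) + a (m + δ / 2) + a (m - δ / 2)
            + a (m - 3 * δ / 2)) - a m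
        = (1 / 4 : ℂ) • ((a (m + 3 * δ / 2) + a (m - 3 * δ / 2) - (2 : ℂ) • a m)
          + (a (m + δ / 2) + a (m - δ / 2) - (2 : ℂ) • a m)) := by module
      rw [this, norm_smul]
      have h := norm_add_le (a (m + 3 * δ / 2) + a (m - 3 * δ / 2) - (2 : ℂ) • a m)
        (a (m + δ / 2) + a (m - δ / 2) - (2 : ℂ) • a m)
      norm_num
      nlinarith)
  set S := vSource B J ((1 / 2 : ℂ) • (ρ (m + δ) + ρ (m - δ)))
          ((1 / 4 : ℂ) • (deriv a (m + δ) + (2 : ℂ) • deriv a m + deriv a (m - δ)))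
          (deriv a m) ((1 / 2 : ℂ) • (a (m + δ / 2) + a (m - δ / 2)))
          ((1 / 4 : ℂ) • (a (m + 3 * δ / 2) + a (m + δ / 2) + a (m - δ / 2)
            + a (m - 3 * δ / 2)))
  have hmid := deriv_equation (B := B) (J := J) hs ha hl (by rw [hρ] at heq; exact heq) (hI hm)
  rw [show B (a m) (J (a m)) = ρ m by rw [hρ]] at hmid
  have t1 : ‖(Complex.I / (2 * δ)) • (deriv a (m + δ) - deriv a (m - δ)
      - (2 * δ : ℂ) • deriv (deriv a) m)‖ ≤ Cv * δ ^ 2 / 2 := by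
    rw [norm_smul, norm_div, norm_mul, Complex.norm_I, Complex.norm_real,
      Real.norm_of_nonneg hδ.le]
    calc _ ≤ 1 / (‖(2 : ℂ)‖ * δ) * (Cv * δ ^ 3) := by gcongr
      _ = _ := by norm_num; field_simp
  have key : (Complex.I / (2 * δ)) • (deriv a (m + δ) - deriv a (m - δ))
        + (1 / 8 : ℂ) • (deriv l (m + δ) + (2 : ℂ) • deriv l m + deriv l (m - δ)) - (β : ℂ) • S
      = (Complex.I / (2 * δ)) • (deriv a (m + δ) - deriv a (m - δ)
          - (2 * δ : ℂ) • deriv (deriv a) m)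
        + (1 / 8 : ℂ) • (deriv l (m + δ) + deriv l (m - δ) - (2 : ℂ) • deriv l m)
        - (β : ℂ) • (S - vSource B J (ρ m) (deriv a m) (deriv a m) (a m) (a m)) := by
    have e1 : (Complex.I / (2 * δ)) • (deriv a (m + δ) - deriv a (m - δ)
          - (2 * δ : ℂ) • deriv (deriv a) m)
        = (Complex.I / (2 * δ)) • (deriv a (m + δ) - deriv a (m - δ))
          - Complex.I • deriv (deriv a) m := by
      rw [smul_sub, smul_smul, div_mul_cancel₀ _ (mul_ne_zero two_ne_zero hδ')]
    rw [e1, eq_sub_of_add_eq hmid]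
    module
  rw [key]
  refine (norm_sub_le_of_le (norm_add_le_of_le t1
      (norm_smul_le _ _)) (norm_smul_le _ _)).trans ?_
  rw [Complex.norm_real, Real.norm_eq_abs]
  norm_num
  have := mul_le_mul_of_nonneg_left hsrc (abs_nonneg β)
  nlinarith

end Residuals

/-! ### The Crank–Nicolson step on the Fourier side -/

namespace Sob

variable {d : ℕ} {r ρ : ℝ}

/-- The Crank–Nicolson equation on the Fourier side. -/
theorem ft_crankNicolson {δ : ℝ} (hδ : δ ≠ 0) (h0 : 0 ≤ ρ) (h : ρ + 2 ≤ r) {e e' : Sob d r}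
    {F : Sob d ρ} (heq : (Complex.I / δ) • (emb (by linarith) e' - emb (by linarith) e)
      + (1 / 4 : ℂ) • lapS h0 h (e' + e) = F) :
    ∀ᵐ ξ, (1 + (δ * (2 * Real.pi * ‖ξ‖) ^ 2 / 4 : ℝ) * Complex.I) * ft e' ξ
      = (1 - (δ * (2 * Real.pi * ‖ξ‖) ^ 2 / 4 : ℝ) * Complex.I) * ft e ξ
        - Complex.I * δ * ft F ξ := by
  have hle : ρ ≤ r := by linarith
  have hδ' : (δ : ℂ) ≠ 0 := by exact_mod_cast hδ
  rw [← heq]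
  filter_upwards [ft_add ((Complex.I / δ) • (emb hle e' - emb hle e))
    ((1 / 4 : ℂ) • lapS h0 h (e' + e)), ft_smul (Complex.I / δ) (emb hle e' - emb hle e),
    ft_sub (emb hle e') (emb hle e), ft_smul (1 / 4 : ℂ) (lapS h0 h (e' + e)),
    ft_lapS h0 h (e' + e), ft_add e' e] with ξ h1 h2 h3 h4 h5 h6
  rw [h1, h2, h3, h4, h5, h6, ft_emb, ft_emb]
  push_cast
  field_simp
  linear_combination (ft e' ξ - ft e ξ) * 4 * Complex.I_sq

theorem norm_one_sub_mul_I (b : ℝ) : ‖1 - (b : ℂ) * Complex.I‖ = ‖1 + (b : ℂ) * Complex.I‖ := by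
  rw [← Complex.norm_conj]
  simp

theorem one_le_norm_one_add_mul_I (b : ℝ) : 1 ≤ ‖1 + (b : ℂ) * Complex.I‖ := by
  refine le_trans ?_ (Complex.abs_re_le_norm _)
  simp

/-- `(1 - i b) / (1 + i b)` has modulus one and `1 / (1 + i b)` modulus at most one. -/
theorem norm_le_of_cayley {b δ : ℝ} {x y z : ℂ}
    (h : (1 + (b : ℂ) * Complex.I) * x = (1 - (b : ℂ) * Complex.I) * y - Complex.I * δ * z) :
    ‖x‖ ≤ ‖y‖ + |δ| * ‖z‖ := by
  have h1 := one_le_norm_one_add_mul_I b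
  have h2 : ‖1 + (b : ℂ) * Complex.I‖ * ‖x‖ ≤ ‖1 + (b : ℂ) * Complex.I‖ * ‖y‖ + |δ| * ‖z‖ := by
    rw [← norm_mul, h]
    refine (norm_sub_le _ _).trans ?_
    rw [norm_mul, norm_mul, norm_mul, norm_one_sub_mul_I, Complex.norm_I, Complex.norm_real,
      Real.norm_eq_abs, one_mul]
  have h3 : 0 ≤ |δ| * ‖z‖ := by positivity
  by_contra hc
  push Not at hc
  nlinarith

/-- The Crank–Nicolson step does not increase the `H^ρ` norm, up to a source in `H^ρ`. -/
theorem norm_emb_le_of_crankNicolson {δ : ℝ} (hδ : δ ≠ 0) (h0 : 0 ≤ ρ) (h : ρ + 2 ≤ r)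
    {e e' : Sob d r} {F : Sob d ρ}
    (heq : (Complex.I / δ) • (emb (by linarith) e' - emb (by linarith) e)
      + (1 / 4 : ℂ) • lapS h0 h (e' + e) = F) {hle : ρ ≤ r} :
    ‖emb hle e'‖ ≤ ‖emb hle e‖ + |δ| * ‖F‖ := by
  refine norm_le_add_of_ft_le (abs_nonneg _) ?_
  filter_upwards [ft_crankNicolson hδ h0 h heq] with ξ hξ
  exact norm_le_of_cayley hξ

/-- The Crank–Nicolson step does not increase the norm of `H^r`, up to a source in `H^r`: the
equation itself only makes sense in `H^ρ`. -/
theorem norm_le_of_crankNicolson {δ : ℝ} (hδ : δ ≠ 0) (h0 : 0 ≤ ρ) (h : ρ + 2 ≤ r)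
    {e e' F : Sob d r}
    (heq : (Complex.I / δ) • (emb (by linarith) e' - emb (by linarith) e)
      + (1 / 4 : ℂ) • lapS h0 h (e' + e) = emb (by linarith) F) :
    ‖e'‖ ≤ ‖e‖ + |δ| * ‖F‖ := by
  refine norm_le_add_of_ft_le (abs_nonneg _) ?_
  filter_upwards [ft_crankNicolson hδ h0 h heq] with ξ hξ
  exact norm_le_of_cayley hξ

/-- The operator `½ (1 - ¼ i δ Δ)`, which turns the sum `w` of two consecutive velocities into the
component of the velocity that evolves by the Cayley transform of the Laplacian. -/
def wavePart (h0 : 0 ≤ ρ) (h : ρ + 2 ≤ r) (δ : ℝ) (w : Sob d r) : Sob d ρ :=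
  (1 / 2 : ℂ) • emb (by linarith) w - (Complex.I * δ / 8) • lapS h0 h w

theorem ft_wavePart (h0 : 0 ≤ ρ) (h : ρ + 2 ≤ r) (δ : ℝ) (w : Sob d r) :
    ∀ᵐ ξ, ft (wavePart h0 h δ w) ξ
      = 1 / 2 * ((1 + (δ * (2 * Real.pi * ‖ξ‖) ^ 2 / 4 : ℝ) * Complex.I) * ft w ξ) := by
  have hle : ρ ≤ r := by linarith
  filter_upwards [ft_sub ((1 / 2 : ℂ) • emb hle w) ((Complex.I * δ / 8) • lapS h0 h w),
    ft_smul (1 / 2 : ℂ) (emb hle w), ft_smul (Complex.I * δ / 8) (lapS h0 h w),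
    ft_lapS h0 h w] with ξ h1 h2 h3 h4
  rw [wavePart, h1, h2, h3, h4, ft_emb]
  push_cast
  ring

theorem norm_wavePart_le (h0 : 0 ≤ ρ) (h : ρ + 2 ≤ r) {δ : ℝ} (hδ : 0 ≤ δ) (w : Sob d r) :
    ‖wavePart h0 h δ w‖ ≤ (1 + δ) * ‖w‖ := by
  unfold wavePart
  refine (norm_sub_le_of_le (norm_smul_le _ _) (norm_smul_le _ _)).trans ?_
  have h1 := norm_emb_le (by linarith : ρ ≤ r) w
  have h2 := norm_lapS_le h0 h w
  have hn : ‖Complex.I * (δ : ℂ) / 8‖ = δ / 8 := by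
    rw [norm_div, norm_mul, Complex.norm_I, Complex.norm_real, Real.norm_of_nonneg hδ]; norm_num
  rw [hn]
  norm_num
  nlinarith [norm_nonneg w, norm_nonneg (lapS h0 h w)]

/-- The symbol of `1 - ¼ i δ Δ` has modulus at least one. -/
theorem norm_emb_le_wavePart (h0 : 0 ≤ ρ) (h : ρ + 2 ≤ r) (δ : ℝ) (w : Sob d r) {hle : ρ ≤ r} :
    ‖emb hle w‖ ≤ 2 * ‖wavePart h0 h δ w‖ := by
  refine norm_le_of_ft_le ?_
  filter_upwards [ft_wavePart h0 h δ w] with ξ hξ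
  have h1 := one_le_norm_one_add_mul_I (δ * (2 * Real.pi * ‖ξ‖) ^ 2 / 4)
  have h2 : ‖ft w ξ‖ ≤ 2 * ‖ft (wavePart h0 h δ w) ξ‖ := by
    rw [hξ, norm_mul, norm_mul]
    norm_num at h1 ⊢
    nlinarith [norm_nonneg (ft w ξ)]
  have h3 := mul_le_mul_of_nonneg_left h2 (Real.rpow_nonneg (bracket_pos ξ).le (ρ / 2))
  rw [ft_emb]
  linarith

/-- The wave part is propagated by the Cayley transform of the Laplacian. The factor
`1 - ¼ i δ Δ` of `wavePart` cancels the resolvent in front of the source. -/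
theorem norm_wavePart_step_le {δ : ℝ} (hδ : 0 < δ) (h0 : 0 ≤ ρ) (h : ρ + 2 ≤ r)
    {w w' : Sob d r} {f : Sob d ρ}
    (heq : (Complex.I / (2 * δ)) • (emb (by linarith) w' - emb (by linarith) w)
      + (1 / 8 : ℂ) • lapS h0 h (w' + w) = f) :
    ‖wavePart h0 h δ w'‖ ≤ ‖wavePart h0 h δ w‖ + δ * ‖f‖ := by
  have hδ' : (δ : ℂ) ≠ 0 := by exact_mod_cast hδ.ne'
  have heq2 : (Complex.I / δ) • (emb (by linarith) w' - emb (by linarith) w)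
      + (1 / 4 : ℂ) • lapS h0 h (w' + w) = (2 : ℂ) • f := by
    rw [← heq, smul_add, smul_smul, smul_smul]
    congr 2
    · field_simp
    · norm_num
  refine norm_le_add_of_ft_le hδ.le ?_
  filter_upwards [ft_crankNicolson hδ.ne' h0 h heq2, ft_wavePart h0 h δ w, ft_wavePart h0 h δ w',
    ft_smul (2 : ℂ) f] with ξ h1 h2 h3 h4
  rw [h3, h1, h2, h4]
  have e : (1 / 2 : ℂ) * ((1 - (δ * (2 * Real.pi * ‖ξ‖) ^ 2 / 4 : ℝ) * Complex.I) * ft w ξ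
        - Complex.I * δ * (2 * ft f ξ))
      = 1 / 2 * ((1 - (δ * (2 * Real.pi * ‖ξ‖) ^ 2 / 4 : ℝ) * Complex.I) * ft w ξ)
        - Complex.I * δ * ft f ξ := by ring
  rw [e]
  refine (norm_sub_le _ _).trans (le_of_eq ?_)
  simp only [norm_mul, norm_one_sub_mul_I, Complex.norm_I, Complex.norm_real, one_mul,
    Real.norm_of_nonneg hδ.le]

/-- The sum of two consecutive wave parts is `w` up to the source. With
`p = v - wavePart w` and `w = v + v'`, this says that `p' = -p + i δ f`. -/
theorem wavePart_add_wavePart {δ : ℝ} (hδ : δ ≠ 0) (h0 : 0 ≤ ρ) (h : ρ + 2 ≤ r)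
    {w w' : Sob d r} {f : Sob d ρ}
    (heq : (Complex.I / (2 * δ)) • (emb (by linarith) w' - emb (by linarith) w)
      + (1 / 8 : ℂ) • lapS h0 h (w' + w) = f) :
    wavePart h0 h δ w' + wavePart h0 h δ w = emb (by linarith) w - (Complex.I * δ) • f := by
  have hδ' : (δ : ℂ) ≠ 0 := by exact_mod_cast hδ
  have e1 : (Complex.I * δ) • (Complex.I / (2 * δ)) • (emb (by linarith : ρ ≤ r) w'
      - emb (by linarith) w) = (-(1 / 2) : ℂ) • (emb (by linarith) w' - emb (by linarith) w) := by
    rw [smul_smul]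
    congr 1
    field_simp
    exact Complex.I_sq
  rw [← heq, smul_add, e1, map_add]
  unfold wavePart
  module

end Sob

/-! ### The equations as identities in Sobolev spaces -/

namespace Sob

variable {d : ℕ} {r ρ : ℝ}

theorem norm_toL2_le (hr : 0 ≤ r) (u : Sob d r) : ‖u.toL2‖ ≤ ‖u‖ := by
  rw [← Lp.norm_fourier_eq, norm_eq_norm_weighted]
  refine Lp.norm_le_norm_of_ae_le ?_
  filter_upwards [norm_coe_weighted u] with ξ h
  rw [h]
  exact le_mul_of_one_le_left (norm_nonneg _)
    (Real.one_le_rpow (one_le_bracket ξ) (by positivity))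

theorem hasDerivAt_toL2 (hr : 0 ≤ r) {f : ℝ → Sob d r} {f' : Sob d r} {t : ℝ}
    (hf : HasDerivAt f f' t) : HasDerivAt (fun t => (f t).toL2) f'.toL2 t :=
  (((toL2 (d := d) (r := r)).mkContinuous 1 (fun u => by
    rw [one_mul]; exact norm_toL2_le hr u)).restrictScalars ℝ).hasFDerivAt.comp_hasDerivAt t hf

/-- `|u|²` as an element of `H^r`. -/
def density (hr : (d : ℝ) / 2 < r) (u : Sob d r) : Sob d r := mulS hr u (conjS hr u)

theorem coe_density (hr : (d : ℝ) / 2 < r) (u : Sob d r) :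
    (density hr u : E d → ℂ) =ᵐ[volume] fun x => (‖u x‖ : ℂ) ^ 2 := by
  filter_upwards [coe_mulS hr u (conjS hr u), coe_conjS hr u] with x h1 h2
  rw [density, h1, h2, Complex.mul_conj, Complex.normSq_eq_norm_sq]
  push_cast; rfl

theorem emb_density (hr : (d : ℝ) / 2 < r) (hρ : (d : ℝ) / 2 < ρ) (h : ρ ≤ r) (u : Sob d r) :
    emb h (density hr u) = density hρ (emb h u) := by
  refine ext_ae ?_
  filter_upwards [coe_density hr u, coe_density hρ (emb h u)] with x h1 h2
  rw [toL2_emb, h1, h2, toL2_emb]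

/-- The nonlinear Schrödinger equation as an identity in `H^ρ`. -/
theorem equation_of_isNLSSolutionOn {β : ℝ} {S : Set ℝ} (hS : IsOpen S) {φ : ℝ → Sob d r}
    (hφ : IsNLSSolutionOn β S φ) (hsmooth : ContDiffOn ℝ ∞ φ S) (hρ : (d : ℝ) / 2 < ρ)
    (h0 : 0 ≤ ρ) (h : ρ + 2 ≤ r) {t : ℝ} (ht : t ∈ S) {hle : ρ ≤ r} :
    Complex.I • emb hle (deriv φ t) + (1 / 2 : ℂ) • lapS h0 h (φ t)
      = (β : ℂ) • mulS hρ (density hρ (emb hle (φ t))) (emb hle (φ t)) := by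
  obtain ⟨g, hg, hgeq⟩ := hφ.2 t ht
  have h1 : HasDerivAt (fun τ => (φ τ).toL2) g t := hg.hasDerivAt (hS.mem_nhds ht)
  have h2 := hasDerivAt_toL2 (by linarith) (hasDerivAt_of_contDiffOn hS hsmooth ht)
  have h3 : g = (deriv φ t).toL2 := h1.unique h2
  refine ext_ae ?_
  filter_upwards [hgeq, coe_add (Complex.I • emb hle (deriv φ t))
    ((1 / 2 : ℂ) • lapS h0 h (φ t)), coe_smul Complex.I (emb hle (deriv φ t)),
    coe_smul (1 / 2 : ℂ) (lapS h0 h (φ t)),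
    coe_smul (β : ℂ) (mulS hρ (density hρ (emb hle (φ t))) (emb hle (φ t))),
    coe_mulS hρ (density hρ (emb hle (φ t))) (emb hle (φ t)),
    coe_density hρ (emb hle (φ t))] with x h4 h5 h6 h7 h8 h9 h10
  rw [h5, h6, h7, h8, h9, h10, toL2_emb, toL2_emb, toL2_lapS, ← h3, h4]
  ring

theorem coe_xi (hr : (d : ℝ) / 2 < r) (v p : Sob d r) :
    ((xi (mulS hr) (conjS hr) v p : Sob d r) : E d → ℂ) =ᵐ[volume]
      fun x => ((2 * (v x * conj (p x)).re : ℝ) : ℂ) := by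
  filter_upwards [coe_add (mulS hr v (conjS hr p)) (mulS hr p (conjS hr v)),
    coe_mulS hr v (conjS hr p), coe_mulS hr p (conjS hr v), coe_conjS hr p, coe_conjS hr v]
    with x h1 h2 h3 h4 h5
  rw [xi, h1, h2, h3, h4, h5]
  apply Complex.ext <;> simp <;> ring

theorem coe_average_two (u v : Sob d r) :
    (((1 / 2 : ℂ) • (u + v) : Sob d r) : E d → ℂ) =ᵐ[volume] fun x => (u x + v x) / 2 := by
  filter_upwards [coe_smul (1 / 2 : ℂ) (u + v), coe_add u v] with x h1 h2
  rw [h1, h2]; ring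

theorem coe_average_three (u v w : Sob d r) :
    (((1 / 4 : ℂ) • (u + (2 : ℂ) • v + w) : Sob d r) : E d → ℂ) =ᵐ[volume]
      fun x => (u x + 2 * v x + w x) / 4 := by
  filter_upwards [coe_smul (1 / 4 : ℂ) (u + (2 : ℂ) • v + w), coe_add (u + (2 : ℂ) • v) w,
    coe_add u ((2 : ℂ) • v), coe_smul (2 : ℂ) v] with x h1 h2 h3 h4
  rw [h1, h2, h3, h4]; ring

theorem coe_average_four (u v w z : Sob d r) :
    (((1 / 4 : ℂ) • (u + v + w + z) : Sob d r) : E d → ℂ) =ᵐ[volume]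
      fun x => (u x + v x + w x + z x) / 4 := by
  filter_upwards [coe_smul (1 / 4 : ℂ) (u + v + w + z), coe_add (u + v + w) z,
    coe_add (u + v) w, coe_add u v] with x h1 h2 h3 h4
  rw [h1, h2, h3, h4]; ring

/-- `lap` is linear on `H²`. -/
theorem coe_lap_smul (hr : 2 ≤ r) (c : ℂ) (u : Sob d r) :
    (lap (c • u.toL2) : E d → ℂ) =ᵐ[volume] fun x => c * lap u.toL2 x := by
  have h1 : lap (c • u.toL2) = c • lap u.toL2 := by
    rw [← toL2_lapS le_rfl (by simpa using hr) u, ← map_smul, ← map_smul, ← map_smul, toL2_lapS]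
  rw [h1]
  exact Lp.coeFn_smul _ _

/-! The equations of the scheme, given almost everywhere, as identities in `H^ρ`. -/

section Step

variable {β δ : ℝ} {X X' : Fin 7 → Sob d r}

theorem IsStep.equation_φ (hX : IsStep β δ X X') (hρ : (d : ℝ) / 2 < ρ) (h0 : 0 ≤ ρ)
    (h : ρ + 2 ≤ r) {hle : ρ ≤ r} :
    (Complex.I / δ) • (emb hle (X' 4) - emb hle (X 4)) + (1 / 4 : ℂ) • lapS h0 h (X' 4 + X 4)
      = (β : ℂ) • mulS hρ (emb hle (X' 1)) ((1 / 2 : ℂ) • (emb hle (X' 4) + emb hle (X 4))) := by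
  refine ext_ae ?_
  filter_upwards [hX.eq_φ, coe_add ((Complex.I / δ) • (emb hle (X' 4) - emb hle (X 4)))
    ((1 / 4 : ℂ) • lapS h0 h (X' 4 + X 4)),
    coe_smul (Complex.I / δ) (emb hle (X' 4) - emb hle (X 4)),
    coe_sub (emb hle (X' 4)) (emb hle (X 4)), coe_smul (1 / 4 : ℂ) (lapS h0 h (X' 4 + X 4)),
    coe_smul (β : ℂ) (mulS hρ (emb hle (X' 1))
      ((1 / 2 : ℂ) • (emb hle (X' 4) + emb hle (X 4)))),
    coe_mulS hρ (emb hle (X' 1)) ((1 / 2 : ℂ) • (emb hle (X' 4) + emb hle (X 4))),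
    coe_average_two (emb hle (X' 4)) (emb hle (X 4)),
    coe_lap_smul (by linarith) (1 / 2 : ℂ) (X' 4 + X 4)] with x h1 h2 h3 h4 h5 h6 h7 h8 h9
  rw [h9] at h1
  rw [h2, h3, h4, h5, h6, h7, h8]
  simp only [toL2_emb, toL2_lapS, discPhi] at h1 ⊢
  linear_combination h1

theorem IsStep.equation_Υ (hX : IsStep β δ X X') (hδ : δ ≠ 0) (hρ : (d : ℝ) / 2 < ρ)
    {hle : ρ ≤ r} : emb hle (X' 1) - emb hle (X 0) = (2 * δ : ℂ) • xi (mulS hρ) (conjS hρ)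
      (emb hle (X 6)) ((1 / 2 : ℂ) • (emb hle (X 4) + emb hle (X 3))) := by
  have hδ' : (δ : ℂ) ≠ 0 := by exact_mod_cast hδ
  refine ext_ae ?_
  filter_upwards [hX.eq_Υ, coe_sub (emb hle (X' 1)) (emb hle (X 0)),
    coe_smul (2 * δ : ℂ) (xi (mulS hρ) (conjS hρ)
      (emb hle (X 6)) ((1 / 2 : ℂ) • (emb hle (X 4) + emb hle (X 3)))),
    coe_xi hρ (emb hle (X 6)) ((1 / 2 : ℂ) • (emb hle (X 4) + emb hle (X 3))),
    coe_average_two (emb hle (X 4)) (emb hle (X 3))] with x h1 h2 h3 h4 h5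
  rw [h2, h3, h4, h5]
  simp only [toL2_emb]
  rw [div_eq_iff (mul_ne_zero two_ne_zero hδ'), discXi] at h1
  rw [h1, mul_comm]

theorem IsStep.equation_v (hX : IsStep β δ X X') (hρ : (d : ℝ) / 2 < ρ) (h0 : 0 ≤ ρ)
    (h : ρ + 2 ≤ r) {hle : ρ ≤ r} :
    (Complex.I / (2 * δ)) • (emb hle (X' 6) - emb hle (X 5))
        + (1 / 8 : ℂ) • lapS h0 h (X' 6 + (2 : ℂ) • X 6 + X 5)
      = (β : ℂ) • vSource (mulS hρ) (conjS hρ)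
        ((1 / 2 : ℂ) • (emb hle (X' 1) + emb hle (X 0)))
        ((1 / 4 : ℂ) • (emb hle (X' 6) + (2 : ℂ) • emb hle (X 6) + emb hle (X 5)))
        (emb hle (X 6)) ((1 / 2 : ℂ) • (emb hle (X 4) + emb hle (X 3)))
        ((1 / 4 : ℂ) • (emb hle (X' 4) + emb hle (X 4) + emb hle (X 3) + emb hle (X 2))) := by
  unfold vSource
  set U := (1 / 2 : ℂ) • (emb hle (X' 1) + emb hle (X 0)) with hU
  set w := (1 / 4 : ℂ) • (emb hle (X' 6) + (2 : ℂ) • emb hle (X 6) + emb hle (X 5)) with hw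
  set p := (1 / 2 : ℂ) • (emb hle (X 4) + emb hle (X 3)) with hp
  set y := (1 / 4 : ℂ) • (emb hle (X' 4) + emb hle (X 4) + emb hle (X 3) + emb hle (X 2)) with hy
  refine ext_ae ?_
  filter_upwards [hX.eq_v, coe_add ((Complex.I / (2 * δ)) • (emb hle (X' 6) - emb hle (X 5)))
    ((1 / 8 : ℂ) • lapS h0 h (X' 6 + (2 : ℂ) • X 6 + X 5)),
    coe_smul (Complex.I / (2 * δ)) (emb hle (X' 6) - emb hle (X 5)),
    coe_sub (emb hle (X' 6)) (emb hle (X 5)),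
    coe_smul (1 / 8 : ℂ) (lapS h0 h (X' 6 + (2 : ℂ) • X 6 + X 5)),
    coe_lap_smul (by linarith) (1 / 4 : ℂ) (X' 6 + (2 : ℂ) • X 6 + X 5),
    coe_smul (β : ℂ) (mulS hρ U w + mulS hρ (xi (mulS hρ) (conjS hρ) (emb hle (X 6)) p) y),
    coe_add (mulS hρ U w) (mulS hρ (xi (mulS hρ) (conjS hρ) (emb hle (X 6)) p) y),
    coe_mulS hρ U w, coe_mulS hρ (xi (mulS hρ) (conjS hρ) (emb hle (X 6)) p) y,
    coe_xi hρ (emb hle (X 6)) p, coe_average_two (emb hle (X' 1)) (emb hle (X 0)),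
    coe_average_three (emb hle (X' 6)) (emb hle (X 6)) (emb hle (X 5)),
    coe_average_two (emb hle (X 4)) (emb hle (X 3)),
    coe_average_four (emb hle (X' 4)) (emb hle (X 4)) (emb hle (X 3)) (emb hle (X 2))]
    with x h1 h2 h3 h4 h5 h6 h7 h8 h9 h10 h11 hU' hw' hp' hy'
  rw [h6] at h1
  rw [h2, h3, h4, h5, h7, h8, h9, h10, h11, hU', hw', hp', hy']
  simp only [toL2_emb, toL2_lapS, discXi] at h1 ⊢
  linear_combination h1

end Step

/-! The first steps, solved for the Crank–Nicolson form. The source lies in `H^r`, and the step from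
`φ_0` to `φ_{-1}` is a step of length `-δ`. -/

section Initial

variable {β δ : ℝ} {r' : ℝ} {φin Υin : Sob d r'} {X : Fin 7 → Sob d r}

theorem IsInitial.equation_φ_pos (hX : IsInitial β δ φin Υin X) (hδ : δ ≠ 0)
    (hr : (d : ℝ) / 2 < r) (h0 : 0 ≤ ρ) (h : ρ + 2 ≤ r) {hle : ρ ≤ r} :
    (Complex.I / δ) • (emb hle (X 4) - emb hle (X 3)) + (1 / 4 : ℂ) • lapS h0 h (X 4 + X 3)
      = emb hle ((β : ℂ) • mulS hr (X 1) ((1 / 2 : ℂ) • (X 4 + X 3))) := by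
  have hδ' : (δ : ℂ) ≠ 0 := by exact_mod_cast hδ
  rw [map_add (lapS h0 h)]
  refine ext_ae ?_
  filter_upwards [hX.eq_φ_pos, coe_add ((Complex.I / δ) • (emb hle (X 4) - emb hle (X 3)))
    ((1 / 4 : ℂ) • (lapS h0 h (X 4) + lapS h0 h (X 3))),
    coe_smul (Complex.I / δ) (emb hle (X 4) - emb hle (X 3)),
    coe_sub (emb hle (X 4)) (emb hle (X 3)), coe_smul (1 / 4 : ℂ) (lapS h0 h (X 4) + lapS h0 h (X 3)),
    coe_smul (β : ℂ) (mulS hr (X 1) ((1 / 2 : ℂ) • (X 4 + X 3))),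
    coe_mulS hr (X 1) ((1 / 2 : ℂ) • (X 4 + X 3)), coe_average_two (X 4) (X 3),
    coe_add (lapS h0 h (X 4)) (lapS h0 h (X 3))] with x h1 h2 h3 h4 h5 h6 h7 h8 h9
  rw [h2, h3, h4, h5, h9]
  simp only [toL2_emb]
  rw [h6, h7, h8]
  simp only [toL2_lapS, schrodingerOp, ← hX.init_φ] at h1 ⊢
  field_simp
  linear_combination (norm := (ring_nf; simp only [Complex.I_sq]; ring)) 4 * Complex.I * h1

theorem IsInitial.equation_φ_neg (hX : IsInitial β δ φin Υin X) (hδ : δ ≠ 0)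
    (hr : (d : ℝ) / 2 < r) (h0 : 0 ≤ ρ) (h : ρ + 2 ≤ r) {hle : ρ ≤ r} :
    (Complex.I / ((-δ : ℝ) : ℂ)) • (emb hle (X 2) - emb hle (X 3))
        + (1 / 4 : ℂ) • lapS h0 h (X 2 + X 3)
      = emb hle ((β : ℂ) • mulS hr (X 0) ((1 / 2 : ℂ) • (X 2 + X 3))) := by
  have hδ' : (δ : ℂ) ≠ 0 := by exact_mod_cast hδ
  rw [map_add (lapS h0 h)]
  refine ext_ae ?_
  filter_upwards [hX.eq_φ_neg,
    coe_add ((Complex.I / ((-δ : ℝ) : ℂ)) • (emb hle (X 2) - emb hle (X 3)))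
      ((1 / 4 : ℂ) • (lapS h0 h (X 2) + lapS h0 h (X 3))),
    coe_smul (Complex.I / ((-δ : ℝ) : ℂ)) (emb hle (X 2) - emb hle (X 3)),
    coe_sub (emb hle (X 2)) (emb hle (X 3)), coe_smul (1 / 4 : ℂ) (lapS h0 h (X 2) + lapS h0 h (X 3)),
    coe_smul (β : ℂ) (mulS hr (X 0) ((1 / 2 : ℂ) • (X 2 + X 3))),
    coe_mulS hr (X 0) ((1 / 2 : ℂ) • (X 2 + X 3)), coe_average_two (X 2) (X 3),
    coe_add (lapS h0 h (X 2)) (lapS h0 h (X 3))] with x h1 h2 h3 h4 h5 h6 h7 h8 h9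
  rw [h2, h3, h4, h5, h9]
  simp only [toL2_emb]
  rw [h6, h7, h8]
  simp only [toL2_lapS, schrodingerOp, ← hX.init_φ] at h1 ⊢
  push_cast
  field_simp
  linear_combination (norm := (ring_nf; simp only [Complex.I_sq]; ring)) -4 * Complex.I * h1

theorem IsInitial.X_three (hX : IsInitial β δ φin Υin X) {h : r ≤ r'} : X 3 = emb h φin :=
  toL2_injective hX.init_φ

theorem IsInitial.X_zero (hX : IsInitial β δ φin Υin X) {h : r ≤ r'} : X 0 = emb h Υin :=
  toL2_injective hX.init_Υ

theorem IsInitial.X_one (hX : IsInitial β δ φin Υin X) (hr : (d : ℝ) / 2 < r) {h : r ≤ r'} :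
    X 1 = (2 : ℂ) • density hr (emb h φin) - emb h Υin := by
  refine ext_ae ?_
  filter_upwards [hX.eq_Υ, coe_sub ((2 : ℂ) • density hr (emb h φin)) (emb h Υin),
    coe_smul (2 : ℂ) (density hr (emb h φin)), coe_density hr (emb h φin)] with x h1 h2 h3 h4
  rw [h1, h2, h3, h4]; rfl

end Initial
end Sob

/-! ### Stability of one step -/

/-- A discrete Gronwall inequality for an implicit recursion: for `δ K ≤ ½`,
`(1 + K δ) / (1 - K δ) ≤ 1 + 4 K δ`. -/
theorem discrete_gronwall {a : ℕ → ℝ} {K C δ T : ℝ} (hK : 0 ≤ K) (hC : 0 ≤ C) (hδ : 0 < δ)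
    (hδK : δ * K ≤ 1 / 2) (ha : ∀ n, 0 ≤ a n)
    (hstep : ∀ n : ℕ, ((n + 1 : ℕ) : ℝ) * δ ≤ T →
      a (n + 1) ≤ a n + δ * (K * (a n + a (n + 1)) + C * δ ^ 2)) (n : ℕ) (hn : n * δ ≤ T) :
    a n ≤ Real.exp (4 * K * T) * (a 0 + 2 * C * T * δ ^ 2) := by
  have h1 : ∀ n : ℕ, n * δ ≤ T → a n ≤ (1 + 4 * K * δ) ^ n * (a 0 + n * (2 * C * δ ^ 3)) := by
    intro n
    induction n with
    | zero => intro _; simp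
    | succ k ih =>
      intro hk
      have hk' : (k : ℝ) * δ ≤ T := by push_cast at hk; linarith
      have h2 := hstep k hk
      have h3 : a (k + 1) ≤ (1 + 4 * K * δ) * (a k + 2 * C * δ ^ 3) := by
        have hkd : 0 ≤ K * δ := by positivity
        have hc3 : 0 ≤ C * δ ^ 3 := by positivity
        have h4 : (1 - K * δ) * a (k + 1) ≤ (1 + K * δ) * a k + C * δ ^ 3 := by nlinarith
        have h5 : (1 - K * δ) * a (k + 1)
            ≤ (1 - K * δ) * ((1 + 4 * K * δ) * (a k + 2 * C * δ ^ 3)) := by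
          refine h4.trans ?_
          have h6 : (1 + K * δ) ≤ (1 - K * δ) * (1 + 4 * K * δ) := by nlinarith
          have h7 : C * δ ^ 3 ≤ (1 - K * δ) * (1 + 4 * K * δ) * (2 * C * δ ^ 3) := by nlinarith
          nlinarith [mul_le_mul_of_nonneg_right h6 (ha k)]
        exact le_of_mul_le_mul_left h5 (by nlinarith)
      have h8 : (1 : ℝ) ≤ (1 + 4 * K * δ) ^ k := one_le_pow₀ (by nlinarith [mul_nonneg hK hδ.le])
      have h9 : 0 ≤ 2 * C * δ ^ 3 := by positivity
      calc a (k + 1) ≤ (1 + 4 * K * δ) * (a k + 2 * C * δ ^ 3) := h3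
        _ ≤ (1 + 4 * K * δ) * ((1 + 4 * K * δ) ^ k * (a 0 + k * (2 * C * δ ^ 3))
            + (1 + 4 * K * δ) ^ k * (2 * C * δ ^ 3)) := by
          refine mul_le_mul_of_nonneg_left (add_le_add (ih hk') ?_) (by positivity)
          exact le_mul_of_one_le_left h9 h8
        _ = _ := by push_cast; ring
  have h2 : (1 + 4 * K * δ) ^ n ≤ Real.exp (4 * K * T) := by
    calc (1 + 4 * K * δ) ^ n ≤ Real.exp (4 * K * δ) ^ n := by
          refine pow_le_pow_left₀ (by positivity) ?_ n
          linarith [Real.add_one_le_exp (4 * K * δ)]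
      _ = Real.exp (4 * K * (n * δ)) := by rw [← Real.exp_nat_mul]; ring_nf
      _ ≤ _ := Real.exp_le_exp.2 (by gcongr)
  have h3 : (n : ℝ) * (2 * C * δ ^ 3) ≤ 2 * C * T * δ ^ 2 := by
    have : (n * δ) * (2 * C * δ ^ 2) ≤ T * (2 * C * δ ^ 2) := by gcongr
    nlinarith
  refine (h1 n hn).trans ?_
  have := ha 0
  gcongr

section SourceDifferences

variable {H : Type*} [NormedAddCommGroup H] [NormedSpace ℂ H] {B : H →L[ℂ] H →L[ℂ] H}
  {β M D τ : ℝ}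

theorem norm_average_two_sub_le {u v u' v' : H} (hu : ‖u - u'‖ ≤ D) (hv : ‖v - v'‖ ≤ D) :
    ‖(1 / 2 : ℂ) • (u + v) - (1 / 2 : ℂ) • (u' + v')‖ ≤ D := by
  have := norm_average_two_le hu hv
  rwa [show (1 / 2 : ℂ) • (u - u' + (v - v'))
    = (1 / 2 : ℂ) • (u + v) - (1 / 2 : ℂ) • (u' + v') by module] at this

theorem norm_average_three_sub_le {u v w u' v' w' : H} (hu : ‖u - u'‖ ≤ D) (hv : ‖v - v'‖ ≤ D)
    (hw : ‖w - w'‖ ≤ D) :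
    ‖(1 / 4 : ℂ) • (u + (2 : ℂ) • v + w) - (1 / 4 : ℂ) • (u' + (2 : ℂ) • v' + w')‖ ≤ D := by
  have := norm_average_three_le hu hv hw
  rwa [show (1 / 4 : ℂ) • (u - u' + (2 : ℂ) • (v - v') + (w - w'))
    = (1 / 4 : ℂ) • (u + (2 : ℂ) • v + w) - (1 / 4 : ℂ) • (u' + (2 : ℂ) • v' + w')
    by module] at this

theorem norm_average_four_sub_le {u v w z u' v' w' z' : H} (hu : ‖u - u'‖ ≤ D)
    (hv : ‖v - v'‖ ≤ D) (hw : ‖w - w'‖ ≤ D) (hz : ‖z - z'‖ ≤ D) :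
    ‖(1 / 4 : ℂ) • (u + v + w + z) - (1 / 4 : ℂ) • (u' + v' + w' + z')‖ ≤ D := by
  have := norm_average_four_le hu hv hw hz
  rwa [show (1 / 4 : ℂ) • (u - u' + (v - v') + (w - w') + (z - z'))
    = (1 / 4 : ℂ) • (u + v + w + z) - (1 / 4 : ℂ) • (u' + v' + w' + z') by module] at this

/-- The difference of the source `c • n` and of the left-hand side `L` at the exact solution, in terms
of the residual `L - c • n'`. -/
theorem smul_sub_sub_sub (c : ℂ) (n n' L : H) :
    c • (n - n') - (L - c • n') = c • n - L := by module

theorem norm_smul_sub_le_of_le {n n' R : H} {A : ℝ} (hn : ‖n - n'‖ ≤ A * D) (hR : ‖R‖ ≤ τ) :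
    ‖(β : ℂ) • (n - n') - R‖ ≤ |β| * A * D + τ := by
  refine (norm_sub_le_of_le (norm_smul_le _ _) hR).trans ?_
  rw [Complex.norm_real, Real.norm_eq_abs, mul_assoc]
  gcongr

theorem norm_cn_source_sub_le {a a' b b' c c' R : H} (hb : ‖b‖ ≤ M) (hc : ‖c‖ ≤ M)
    (ha : ‖a'‖ ≤ M) (da : ‖a - a'‖ ≤ D) (db : ‖b - b'‖ ≤ D) (dc : ‖c - c'‖ ≤ D) (hR : ‖R‖ ≤ τ) :
    ‖(β : ℂ) • (B a ((1 / 2 : ℂ) • (b + c)) - B a' ((1 / 2 : ℂ) • (b' + c'))) - R‖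
      ≤ |β| * (2 * ‖B‖ * M) * D + τ := by
  refine norm_smul_sub_le_of_le ?_ hR
  refine (norm_bilin_sub_le (norm_average_two_le hb hc) ha da
    (norm_average_two_sub_le db dc)).trans_eq ?_
  ring

end SourceDifferences

/-- The Lipschitz constant of the nonlinear terms of the scheme on the ball of radius `M`, where `b`
is the norm of the product. -/
def stabilityConst (β b M : ℝ) : ℝ := |β| * (2 * b * M + 6 * b ^ 2 * M ^ 2) + 8 * b * M

theorem stabilityConst_nonneg (β : ℝ) {b M : ℝ} (hb : 0 ≤ b) (hM : 0 ≤ M) :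
    0 ≤ stabilityConst β b M := by unfold stabilityConst; positivity

theorem le_stabilityConst (β : ℝ) {b M : ℝ} (hb : 0 ≤ b) (hM : 0 ≤ M) :
    |β| * (2 * b * M) ≤ stabilityConst β b M ∧ 8 * b * M ≤ stabilityConst β b M ∧
      |β| * (2 * b * M + 6 * b ^ 2 * M ^ 2) ≤ stabilityConst β b M := by
  have h1 : 0 ≤ |β| * (2 * b * M) := by positivity
  have h2 : 0 ≤ |β| * (6 * b ^ 2 * M ^ 2) := by positivity
  have h3 : 0 ≤ 8 * b * M := by positivity
  unfold stabilityConst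
  refine ⟨by linarith, by linarith, by linarith⟩

namespace Sob

variable {d : ℕ} {r ρ : ℝ}

/-- The norm in which the scheme is stable: the two components of the velocity are replaced by the
part `½ (1 - ¼ i δ Δ) (v_{n-1/2} + v_{n+1/2})`, propagated by the Cayley transform of the Laplacian,
and by the remainder of `v_{n-1/2}`, which only changes its sign. -/
def errNorm (h0 : 0 ≤ ρ) (h : ρ + 2 ≤ r) (δ : ℝ) (e : Fin 7 → Sob d r) : ℝ :=
  ‖(![emb (by linarith) (e 0), emb (by linarith) (e 1), emb (by linarith) (e 2),
    emb (by linarith) (e 3), emb (by linarith) (e 4),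
    emb (by linarith) (e 5) - wavePart h0 h δ (e 6 + e 5), wavePart h0 h δ (e 6 + e 5)] :
    Fin 7 → Sob d ρ)‖

theorem errNorm_nonneg (h0 : 0 ≤ ρ) (h : ρ + 2 ≤ r) (δ : ℝ) (e : Fin 7 → Sob d r) :
    0 ≤ errNorm h0 h δ e := norm_nonneg _

theorem errNorm_le_iff (h0 : 0 ≤ ρ) (h : ρ + 2 ≤ r) (δ : ℝ) (e : Fin 7 → Sob d r) {A : ℝ}
    (hA : 0 ≤ A) {hle : ρ ≤ r} : errNorm h0 h δ e ≤ A ↔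
      ‖emb hle (e 0)‖ ≤ A ∧ ‖emb hle (e 1)‖ ≤ A ∧ ‖emb hle (e 2)‖ ≤ A ∧ ‖emb hle (e 3)‖ ≤ A ∧
      ‖emb hle (e 4)‖ ≤ A ∧ ‖emb hle (e 5) - wavePart h0 h δ (e 6 + e 5)‖ ≤ A ∧
      ‖wavePart h0 h δ (e 6 + e 5)‖ ≤ A := by
  rw [errNorm, pi_norm_le_iff_of_nonneg hA]
  simp [Fin.forall_fin_succ]

theorem norm_emb_le_errNorm (h0 : 0 ≤ ρ) (h : ρ + 2 ≤ r) (δ : ℝ) (e : Fin 7 → Sob d r)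
    (i : Fin 7) {hle : ρ ≤ r} : ‖emb hle (e i)‖ ≤ 4 * errNorm h0 h δ e := by
  have hN := errNorm_nonneg h0 h δ e
  obtain ⟨a0, a1, a2, a3, a4, a5, a6⟩ := (errNorm_le_iff h0 h δ e (hle := hle) hN).1 le_rfl
  have h5 : ‖emb hle (e 5)‖ ≤ 2 * errNorm h0 h δ e := by
    have := norm_add_le (emb hle (e 5) - wavePart h0 h δ (e 6 + e 5)) (wavePart h0 h δ (e 6 + e 5))
    rw [sub_add_cancel] at this
    linarith
  have h6 : ‖emb hle (e 6)‖ ≤ 4 * errNorm h0 h δ e := by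
    have h7 := norm_emb_le_wavePart h0 h δ (e 6 + e 5) (hle := hle)
    have h8 := norm_sub_le (emb hle (e 6 + e 5)) (emb hle (e 5))
    rw [map_add, add_sub_cancel_right, ← map_add] at h8
    linarith
  fin_cases i
  · exact a0.trans (by linarith)
  · exact a1.trans (by linarith)
  · exact a2.trans (by linarith)
  · exact a3.trans (by linarith)
  · exact a4.trans (by linarith)
  · exact h5.trans (by linarith)
  · exact h6

theorem errNorm_le (h0 : 0 ≤ ρ) (h : ρ + 2 ≤ r) {δ : ℝ} (hδ : 0 ≤ δ) (hδ1 : δ ≤ 1)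
    {e : Fin 7 → Sob d r} {D : ℝ} (he : ∀ i, ‖e i‖ ≤ D) : errNorm h0 h δ e ≤ 5 * D := by
  have hD : 0 ≤ D := (norm_nonneg _).trans (he 0)
  have hle : ρ ≤ r := by linarith
  have hemb : ∀ i, ‖emb hle (e i)‖ ≤ D := fun i => (norm_emb_le hle _).trans (he i)
  have hq : ‖wavePart h0 h δ (e 6 + e 5)‖ ≤ 4 * D := by
    have h1 := norm_wavePart_le h0 h hδ (e 6 + e 5)
    have h2 := norm_add_le_of_le (he 6) (he 5)
    nlinarith [norm_nonneg (e 6 + e 5)]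
  rw [errNorm_le_iff h0 h δ e (by positivity) (hle := hle)]
  refine ⟨(hemb 0).trans (by linarith), (hemb 1).trans (by linarith), (hemb 2).trans (by linarith),
    (hemb 3).trans (by linarith), (hemb 4).trans (by linarith), ?_, by linarith⟩
  have := norm_sub_le (emb hle (e 5)) (wavePart h0 h δ (e 6 + e 5))
  linarith [hemb 5]

/-- One step for the wave function: `x`, `x'` satisfy the equation up to a residual of size `τ`. -/
theorem IsStep.norm_error_φ_le {β δ M D τ : ℝ} (hδ : 0 < δ) (hρ : (d : ℝ) / 2 < ρ) (h0 : 0 ≤ ρ)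
    (h : ρ + 2 ≤ r) {hle : ρ ≤ r} {X X' x x' : Fin 7 → Sob d r} (hX : IsStep β δ X X')
    (hφ : ‖(Complex.I / δ) • (emb hle (x' 4) - emb hle (x 4)) + (1 / 4 : ℂ) • lapS h0 h (x' 4 + x 4)
      - (β : ℂ) • mulS hρ (emb hle (x' 1)) ((1 / 2 : ℂ) • (emb hle (x' 4) + emb hle (x 4)))‖ ≤ τ)
    (bX : ∀ i, ‖emb hle (X i)‖ ≤ M) (bX' : ∀ i, ‖emb hle (X' i)‖ ≤ M)
    (bx' : ∀ i, ‖emb hle (x' i)‖ ≤ M)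
    (de : ∀ i, ‖emb hle (X i) - emb hle (x i)‖ ≤ D)
    (de' : ∀ i, ‖emb hle (X' i) - emb hle (x' i)‖ ≤ D) :
    ‖emb hle (X' 4 - x' 4)‖ ≤ ‖emb hle (X 4 - x 4)‖
      + δ * (|β| * (2 * ‖mulS (d := d) hρ‖ * M) * D + τ) := by
  have hF := norm_cn_source_sub_le (B := mulS hρ) (β := β) (bX' 4) (bX 4) (bx' 1) (de' 1) (de' 4)
    (de 4) hφ
  have heq : (Complex.I / δ) • (emb hle (X' 4 - x' 4) - emb hle (X 4 - x 4))
      + (1 / 4 : ℂ) • lapS h0 h (X' 4 - x' 4 + (X 4 - x 4))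
      = ((Complex.I / δ) • (emb hle (X' 4) - emb hle (X 4))
          + (1 / 4 : ℂ) • lapS h0 h (X' 4 + X 4))
        - ((Complex.I / δ) • (emb hle (x' 4) - emb hle (x 4))
          + (1 / 4 : ℂ) • lapS h0 h (x' 4 + x 4)) := by
    simp only [map_sub, map_add]
    module
  rw [IsStep.equation_φ hX hρ h0 h, ← smul_sub_sub_sub (β : ℂ)] at heq
  refine (norm_emb_le_of_crankNicolson hδ.ne' h0 h heq (hle := hle)).trans ?_
  rw [abs_of_pos hδ]
  gcongr

/-- One step for the density: `x`, `x'` satisfy the equation up to a residual of size `δ τ`. -/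
theorem IsStep.norm_error_Υ_le {β δ M D τ : ℝ} (hδ : 0 < δ) (hρ : (d : ℝ) / 2 < ρ)
    {hle : ρ ≤ r} {X X' x x' : Fin 7 → Sob d r} (hX : IsStep β δ X X')
    (hΥ : ‖emb hle (x' 1) - emb hle (x 0) - (2 * δ : ℂ) • xi (mulS hρ) (conjS hρ)
      (emb hle (x 6)) ((1 / 2 : ℂ) • (emb hle (x 4) + emb hle (x 3)))‖ ≤ δ * τ)
    (bX : ∀ i, ‖emb hle (X i)‖ ≤ M) (bx : ∀ i, ‖emb hle (x i)‖ ≤ M)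
    (de : ∀ i, ‖emb hle (X i) - emb hle (x i)‖ ≤ D) :
    ‖emb hle (X' 1 - x' 1)‖ ≤ ‖emb hle (X 0 - x 0)‖
      + δ * (8 * ‖mulS (d := d) hρ‖ * M * D + τ) := by
  have hF := norm_xi_sub_le (B := mulS hρ) (fun u => (norm_conjS hρ u).le) (bX 6)
    (norm_average_two_le (bX 4) (bX 3)) (bx 6) (norm_average_two_le (bx 4) (bx 3)) (de 6)
    (norm_average_two_sub_le (de 4) (de 3))
  have heq : emb hle (X' 1 - x' 1) = emb hle (X 0 - x 0) + ((emb hle (X' 1) - emb hle (X 0))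
      - (emb hle (x' 1) - emb hle (x 0))) := by
    simp only [map_sub]; abel
  rw [IsStep.equation_Υ hX hδ.ne' hρ, ← smul_sub_sub_sub (2 * δ : ℂ)] at heq
  rw [heq]
  refine (norm_add_le_of_le le_rfl (norm_sub_le_of_le (norm_smul_le _ _) hΥ)).trans ?_
  rw [norm_mul, Complex.norm_real, Real.norm_of_nonneg hδ.le, Complex.norm_ofNat]
  have h1 := mul_le_mul_of_nonneg_left hF (by positivity : 0 ≤ 2 * δ)
  linarith

/-- One step for the velocity: the two components of the splitting of the error are propagated by
isometries, with a source controlled by the error and the residual. -/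
theorem IsStep.norm_error_v_le {β δ M D τ : ℝ} (hδ : 0 < δ) (hρ : (d : ℝ) / 2 < ρ) (h0 : 0 ≤ ρ)
    (h : ρ + 2 ≤ r) {hle : ρ ≤ r} {X X' x x' : Fin 7 → Sob d r} (hX : IsStep β δ X X')
    (hx5 : x' 5 = x 6)
    (hv : ‖(Complex.I / (2 * δ)) • (emb hle (x' 6) - emb hle (x 5))
        + (1 / 8 : ℂ) • lapS h0 h (x' 6 + (2 : ℂ) • x 6 + x 5)
      - (β : ℂ) • vSource (mulS hρ) (conjS hρ)
        ((1 / 2 : ℂ) • (emb hle (x' 1) + emb hle (x 0)))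
        ((1 / 4 : ℂ) • (emb hle (x' 6) + (2 : ℂ) • emb hle (x 6) + emb hle (x 5)))
        (emb hle (x 6)) ((1 / 2 : ℂ) • (emb hle (x 4) + emb hle (x 3)))
        ((1 / 4 : ℂ) • (emb hle (x' 4) + emb hle (x 4) + emb hle (x 3) + emb hle (x 2)))‖ ≤ τ)
    (bX : ∀ i, ‖emb hle (X i)‖ ≤ M) (bX' : ∀ i, ‖emb hle (X' i)‖ ≤ M)
    (bx : ∀ i, ‖emb hle (x i)‖ ≤ M) (bx' : ∀ i, ‖emb hle (x' i)‖ ≤ M)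
    (de : ∀ i, ‖emb hle (X i) - emb hle (x i)‖ ≤ D)
    (de' : ∀ i, ‖emb hle (X' i) - emb hle (x' i)‖ ≤ D) :
    ‖wavePart h0 h δ (X' 6 - x' 6 + (X' 5 - x' 5))‖
        ≤ ‖wavePart h0 h δ (X 6 - x 6 + (X 5 - x 5))‖
          + δ * (|β| * (2 * ‖mulS (d := d) hρ‖ * M + 6 * ‖mulS (d := d) hρ‖ ^ 2 * M ^ 2) * D + τ) ∧
      ‖emb hle (X' 5 - x' 5) - wavePart h0 h δ (X' 6 - x' 6 + (X' 5 - x' 5))‖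
        ≤ ‖emb hle (X 5 - x 5) - wavePart h0 h δ (X 6 - x 6 + (X 5 - x 5))‖
          + δ * (|β| * (2 * ‖mulS (d := d) hρ‖ * M + 6 * ‖mulS (d := d) hρ‖ ^ 2 * M ^ 2) * D
            + τ) := by
  have hs := norm_vSource_sub_le (B := mulS hρ) (fun u => (norm_conjS hρ u).le)
    (norm_average_three_le (bX' 6) (bX 6) (bX 5)) (bX 6) (norm_average_two_le (bX 4) (bX 3))
    (norm_average_four_le (bX' 4) (bX 4) (bX 3) (bX 2)) (norm_average_two_le (bx' 1) (bx 0))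
    (bx 6) (norm_average_two_le (bx 4) (bx 3)) (norm_average_two_sub_le (de' 1) (de 0))
    (norm_average_three_sub_le (de' 6) (de 6) (de 5)) (de 6)
    (norm_average_two_sub_le (de 4) (de 3))
    (norm_average_four_sub_le (de' 4) (de 4) (de 3) (de 2))
  have hF := norm_smul_sub_le_of_le (β := β) hs hv
  have heq : (Complex.I / (2 * δ)) • (emb hle (X' 6 - x' 6 + (X 6 - x 6))
        - emb hle (X 6 - x 6 + (X 5 - x 5)))
      + (1 / 8 : ℂ) • lapS h0 h (X' 6 - x' 6 + (X 6 - x 6) + (X 6 - x 6 + (X 5 - x 5)))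
      = ((Complex.I / (2 * δ)) • (emb hle (X' 6) - emb hle (X 5))
        + (1 / 8 : ℂ) • lapS h0 h (X' 6 + (2 : ℂ) • X 6 + X 5))
      - ((Complex.I / (2 * δ)) • (emb hle (x' 6) - emb hle (x 5))
        + (1 / 8 : ℂ) • lapS h0 h (x' 6 + (2 : ℂ) • x 6 + x 5)) := by
    simp only [map_sub, map_add, map_smul]
    module
  rw [IsStep.equation_v hX hρ h0 h, ← smul_sub_sub_sub (β : ℂ)] at heq
  rw [hX.shift_v, hx5]
  have h1 := norm_wavePart_step_le hδ h0 h heq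
  have h2 := wavePart_add_wavePart hδ.ne' h0 h heq
  have h3 := mul_le_mul_of_nonneg_left hF hδ.le
  refine ⟨h1.trans (by linarith), ?_⟩
  have h4 : emb hle (X 6 - x 6) - wavePart h0 h δ (X' 6 - x' 6 + (X 6 - x 6))
      = (emb hle (X 6 - x 6 + (X 5 - x 5)) - (wavePart h0 h δ (X' 6 - x' 6 + (X 6 - x 6))
          + wavePart h0 h δ (X 6 - x 6 + (X 5 - x 5))))
        - (emb hle (X 5 - x 5) - wavePart h0 h δ (X 6 - x 6 + (X 5 - x 5))) := by
    rw [map_add (emb hle) (X 6 - x 6) (X 5 - x 5)]; abel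
  rw [h4, h2, sub_sub_cancel]
  refine (norm_sub_le_of_le (norm_smul_le _ _) le_rfl).trans ?_
  rw [norm_mul, Complex.norm_I, Complex.norm_real, Real.norm_of_nonneg hδ.le]
  linarith

/-- Stability of one step of the scheme: `x`, `x'` satisfy the equations of the scheme up to
residuals of size `τ`. -/
theorem IsStep.errNorm_le {β δ M τ : ℝ} (hδ : 0 < δ) (hρ : (d : ℝ) / 2 < ρ) (h0 : 0 ≤ ρ)
    (h : ρ + 2 ≤ r) {hle : ρ ≤ r} {X X' x x' : Fin 7 → Sob d r} (hX : IsStep β δ X X')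
    (hx0 : x' 0 = x 1) (hx2 : x' 2 = x 3) (hx3 : x' 3 = x 4) (hx5 : x' 5 = x 6)
    (hφ : ‖(Complex.I / δ) • (emb hle (x' 4) - emb hle (x 4)) + (1 / 4 : ℂ) • lapS h0 h (x' 4 + x 4)
      - (β : ℂ) • mulS hρ (emb hle (x' 1)) ((1 / 2 : ℂ) • (emb hle (x' 4) + emb hle (x 4)))‖ ≤ τ)
    (hΥ : ‖emb hle (x' 1) - emb hle (x 0) - (2 * δ : ℂ) • xi (mulS hρ) (conjS hρ)
      (emb hle (x 6)) ((1 / 2 : ℂ) • (emb hle (x 4) + emb hle (x 3)))‖ ≤ δ * τ)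
    (hv : ‖(Complex.I / (2 * δ)) • (emb hle (x' 6) - emb hle (x 5))
        + (1 / 8 : ℂ) • lapS h0 h (x' 6 + (2 : ℂ) • x 6 + x 5)
      - (β : ℂ) • vSource (mulS hρ) (conjS hρ)
        ((1 / 2 : ℂ) • (emb hle (x' 1) + emb hle (x 0)))
        ((1 / 4 : ℂ) • (emb hle (x' 6) + (2 : ℂ) • emb hle (x 6) + emb hle (x 5)))
        (emb hle (x 6)) ((1 / 2 : ℂ) • (emb hle (x 4) + emb hle (x 3)))
        ((1 / 4 : ℂ) • (emb hle (x' 4) + emb hle (x 4) + emb hle (x 3) + emb hle (x 2)))‖ ≤ τ)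
    (bX : ∀ i, ‖emb hle (X i)‖ ≤ M) (bX' : ∀ i, ‖emb hle (X' i)‖ ≤ M)
    (bx : ∀ i, ‖emb hle (x i)‖ ≤ M) (bx' : ∀ i, ‖emb hle (x' i)‖ ≤ M) :
    errNorm h0 h δ (X' - x') ≤ errNorm h0 h δ (X - x)
      + δ * (4 * stabilityConst β ‖mulS (d := d) hρ‖ M
        * (errNorm h0 h δ (X - x) + errNorm h0 h δ (X' - x')) + τ) := by
  have hN := errNorm_nonneg h0 h δ (X - x)
  have hN' := errNorm_nonneg h0 h δ (X' - x')
  have hM : 0 ≤ M := (norm_nonneg _).trans (bX 0)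
  have hτ : 0 ≤ τ := (norm_nonneg _).trans hφ
  have de : ∀ i, ‖emb hle (X i) - emb hle (x i)‖
      ≤ 4 * (errNorm h0 h δ (X - x) + errNorm h0 h δ (X' - x')) := fun i => by
    rw [← map_sub]
    exact (norm_emb_le_errNorm h0 h δ (X - x) i).trans (by linarith)
  have de' : ∀ i, ‖emb hle (X' i) - emb hle (x' i)‖
      ≤ 4 * (errNorm h0 h δ (X - x) + errNorm h0 h δ (X' - x')) := fun i => by
    rw [← map_sub]
    exact (norm_emb_le_errNorm h0 h δ (X' - x') i).trans (by linarith)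
  have sφ := IsStep.norm_error_φ_le hδ hρ h0 h hX hφ bX bX' bx' de de'
  have sΥ := IsStep.norm_error_Υ_le hδ hρ hX hΥ bX bx de
  obtain ⟨sq, sp⟩ := IsStep.norm_error_v_le hδ hρ h0 h hX hx5 hv bX bX' bx bx' de de'
  obtain ⟨n0, n1, n2, n3, n4, n5, n6⟩ := (errNorm_le_iff h0 h δ (X - x) (hle := hle) hN).1 le_rfl
  simp only [Pi.sub_apply] at n0 n1 n2 n3 n4 n5 n6
  have hb : 0 ≤ ‖mulS (d := d) hρ‖ := (mulS (d := d) hρ).opNorm_nonneg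
  have hiff := fun A hA => errNorm_le_iff h0 h δ (X' - x') (A := A) hA (hle := hle)
  simp only [Pi.sub_apply] at hiff
  generalize errNorm h0 h δ (X - x) = N at *
  generalize errNorm h0 h δ (X' - x') = N' at *
  generalize ‖mulS (d := d) hρ‖ = b at *
  obtain ⟨c1, c2, c3⟩ := le_stabilityConst β hb hM
  have hA := stabilityConst_nonneg β hb hM
  generalize stabilityConst β b M = A at *
  have hD : 0 ≤ 4 * (N + N') := by positivity
  have m1 := mul_le_mul_of_nonneg_left (mul_le_mul_of_nonneg_right c1 hD) hδ.le
  have m2 := mul_le_mul_of_nonneg_left (mul_le_mul_of_nonneg_right c2 hD) hδ.le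
  have m3 := mul_le_mul_of_nonneg_left (mul_le_mul_of_nonneg_right c3 hD) hδ.le
  have hpos : 0 ≤ δ * (4 * A * (N + N') + τ) := by positivity
  rw [hiff _ (by positivity)]
  refine ⟨?_, by linarith, ?_, ?_, by linarith, by linarith, by linarith⟩
  · rw [hX.shift_Υ, hx0]; linarith
  · rw [hX.shift_φ, hx2]; linarith
  · rw [hX.shift_φ', hx3]; linarith

/-- The error `Y - y` of one Crank–Nicolson step of length `δ` (of either sign) from a common datum
`z`, where the numerical solution `Y` uses the potential `Υ` and `y` satisfies the equation with the
potential `Υ'` up to a residual of size `τ`. The element `Λ` of `H^r` is `Δ (y + z)`. -/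
theorem norm_first_step_le {β δ M τ : ℝ} (hδ : δ ≠ 0) (hr : (d : ℝ) / 2 < r) (h0 : 0 ≤ ρ)
    (h : ρ + 2 ≤ r) {hle : ρ ≤ r} {Y y z Υ Υ' Λ : Sob d r}
    (hY : (Complex.I / δ) • (emb hle Y - emb hle z) + (1 / 4 : ℂ) • lapS h0 h (Y + z)
      = emb hle ((β : ℂ) • mulS hr Υ ((1 / 2 : ℂ) • (Y + z))))
    (hΛ : emb hle Λ = lapS h0 h (y + z))
    (hy : ‖(Complex.I / δ) • (y - z) + (1 / 4 : ℂ) • Λ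
      - (β : ℂ) • mulS hr Υ' ((1 / 2 : ℂ) • (y + z))‖ ≤ τ)
    (bY : ‖Y‖ ≤ M) (bz : ‖z‖ ≤ M) (bΥ : ‖Υ'‖ ≤ M)
    (hδM : |δ| * (|β| * ‖mulS (d := d) hr‖ * M) ≤ 1 / 2) :
    ‖Y - y‖ ≤ 2 * |δ| * (|β| * ‖mulS (d := d) hr‖ * M * ‖Υ - Υ'‖ + τ) := by
  have hhalf : ‖(1 / 2 : ℂ) • (Y + z) - (1 / 2 : ℂ) • (y + z)‖ ≤ ‖Y - y‖ := by
    have : (1 / 2 : ℂ) • (Y + z) - (1 / 2 : ℂ) • (y + z) = (1 / 2 : ℂ) • (Y - y) := by module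
    rw [this, norm_smul]
    norm_num
    linarith [norm_nonneg (Y - y)]
  have hF := norm_bilin_sub_le (B := mulS hr) (norm_average_two_le bY bz) bΥ
    (le_refl ‖Υ - Υ'‖) hhalf
  set nl := mulS hr Υ ((1 / 2 : ℂ) • (Y + z))
  set nl' := mulS hr Υ' ((1 / 2 : ℂ) • (y + z))
  set R := (Complex.I / δ) • (y - z) + (1 / 4 : ℂ) • Λ - (β : ℂ) • nl' with hR
  have heq : (Complex.I / δ) • (emb hle (Y - y) - emb hle 0)
      + (1 / 4 : ℂ) • lapS h0 h (Y - y + 0) = emb hle ((β : ℂ) • (nl - nl') - R) := by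
    have h1 : emb hle ((β : ℂ) • (nl - nl') - R)
        = emb hle ((β : ℂ) • nl) - emb hle ((Complex.I / δ) • (y - z) + (1 / 4 : ℂ) • Λ) := by
      rw [← map_sub, hR]; congr 1; module
    have h2 : emb hle ((Complex.I / δ) • (y - z) + (1 / 4 : ℂ) • Λ)
        = (Complex.I / δ) • emb hle (y - z) + (1 / 4 : ℂ) • lapS h0 h (y + z) := by
      rw [map_add, map_smul, map_smul, hΛ]
    rw [h1, ← hY, h2]
    simp only [map_sub, map_add, map_zero]
    module
  have h1 := norm_le_of_crankNicolson hδ h0 h heq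
  have h2 : ‖(β : ℂ) • (nl - nl') - R‖
      ≤ |β| * (‖mulS (d := d) hr‖ * (‖Υ - Υ'‖ * M + M * ‖Y - y‖)) + τ := by
    refine (norm_sub_le_of_le (norm_smul_le _ _) hy).trans ?_
    rw [Complex.norm_real, Real.norm_eq_abs]
    gcongr
  rw [norm_zero, zero_add] at h1
  have h3 := h1.trans (mul_le_mul_of_nonneg_left h2 (abs_nonneg δ))
  have h4 := mul_le_mul_of_nonneg_right hδM (norm_nonneg (Y - y))
  linarith

end Sob

/-! ### Consistency of the exact solution -/

namespace Sob

variable {d : ℕ} {ρ r r' : ℝ}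

@[simp] theorem emb_emb (h : ρ ≤ r) (h' : r ≤ r') (u : Sob d r') :
    emb h (emb h' u) = emb (h.trans h') u := rfl

theorem lapS_emb (h0 : 0 ≤ ρ) (h : ρ + 2 ≤ r) (h' : r ≤ r') (u : Sob d r') :
    lapS h0 h (emb h' u) = lapS h0 (h.trans h') u :=
  toL2_injective (by rw [toL2_lapS, toL2_lapS, toL2_emb])

/-- The vector of the exact solution as an element of `(H^r)^7`. -/
def exactSob (hr : (d : ℝ) / 2 < r) (h : r ≤ r') (φ : ℝ → Sob d r') (δ t : ℝ) : Fin 7 → Sob d r :=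
  ![density hr (emb h (φ (t - δ / 2))), density hr (emb h (φ (t + δ / 2))),
    emb h (φ (t - δ)), emb h (φ t), emb h (φ (t + δ)),
    emb h (deriv φ (t - δ / 2)), emb h (deriv φ (t + δ / 2))]

theorem exactVec_ae_eq (hr : (d : ℝ) / 2 < r) (h : r ≤ r') (φ : ℝ → Sob d r') (δ t : ℝ)
    (i : Fin 7) : exactVec φ δ t i =ᵐ[volume] exactSob hr h φ δ t i := by
  fin_cases i
  · exact (coe_density hr (emb h (φ (t - δ / 2)))).symm
  · exact (coe_density hr (emb h (φ (t + δ / 2)))).symm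
  all_goals exact Filter.EventuallyEq.rfl

section Curve

variable {S : Set ℝ} {φ : ℝ → Sob d r'}

theorem contDiffOn_clm_comp (L : Sob d r' →L[ℂ] Sob d ρ) (hsmooth : ContDiffOn ℝ ∞ φ S) :
    ContDiffOn ℝ ∞ (fun t => L (φ t)) S :=
  (L.restrictScalars ℝ).contDiff.comp_contDiffOn hsmooth

theorem deriv_clm_comp (hS : IsOpen S) (L : Sob d r' →L[ℂ] Sob d ρ)
    (hsmooth : ContDiffOn ℝ ∞ φ S) {t : ℝ} (ht : t ∈ S) :
    deriv (fun t => L (φ t)) t = L (deriv φ t) :=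
  ((L.restrictScalars ℝ).hasFDerivAt.comp_hasDerivAt t
    (hasDerivAt_of_contDiffOn hS hsmooth ht)).deriv

variable {β α γ : ℝ}

theorem exists_norm_exactSob_le (hS : IsOpen S) (hI : Set.Icc α γ ⊆ S)
    (hsmooth : ContDiffOn ℝ ∞ φ S) (hr : (d : ℝ) / 2 < r) (h : r ≤ r') :
    ∃ M, 0 ≤ M ∧ ∀ δ t : ℝ, 0 < δ → α ≤ t - δ → t + δ ≤ γ → ∀ i,
      ‖exactSob hr h φ δ t i‖ ≤ M := by
  have ha := contDiffOn_clm_comp (emb h) hsmooth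
  have hρ : ContDiffOn ℝ ∞ (fun t => density hr (emb h (φ t))) S :=
    ContDiffOn.bilin ha ((conjS hr).contDiff.comp_contDiffOn ha)
  have hv := contDiffOn_clm_comp (emb h) (contDiffOn_deriv_of_isOpen hS hsmooth)
  obtain ⟨Ca, hCa0, hCa⟩ := exists_norm_le_of_contDiffOn ha hI
  obtain ⟨Cρ, hCρ0, hCρ⟩ := exists_norm_le_of_contDiffOn hρ hI
  obtain ⟨Cv, hCv0, hCv⟩ := exists_norm_le_of_contDiffOn hv hI
  refine ⟨Ca + Cρ + Cv, by linarith, fun δ t hδ h1 h2 i => ?_⟩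
  fin_cases i
  · exact (hCρ (t - δ / 2) ⟨by linarith, by linarith⟩).trans (by linarith)
  · exact (hCρ (t + δ / 2) ⟨by linarith, by linarith⟩).trans (by linarith)
  · exact (hCa (t - δ) ⟨by linarith, by linarith⟩).trans (by linarith)
  · exact (hCa t ⟨by linarith, by linarith⟩).trans (by linarith)
  · exact (hCa (t + δ) ⟨by linarith, by linarith⟩).trans (by linarith)
  · exact (hCv (t - δ / 2) ⟨by linarith, by linarith⟩).trans (by linarith)
  · exact (hCv (t + δ / 2) ⟨by linarith, by linarith⟩).trans (by linarith)

/-- Consistency: the exact solution satisfies the three equations of one step of the scheme up to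
residuals of second order. -/
theorem exists_exactSob_residual_le (hS : IsOpen S) (hI : Set.Icc α γ ⊆ S)
    (hφ : IsNLSSolutionOn β S φ) (hsmooth : ContDiffOn ℝ ∞ φ S) (hρ : (d : ℝ) / 2 < ρ)
    (hr : (d : ℝ) / 2 < r) (h0 : 0 ≤ ρ) (h : ρ + 2 ≤ r) (h' : r ≤ r') {hle : ρ ≤ r} :
    ∃ C, 0 ≤ C ∧ ∀ δ t : ℝ, 0 < δ → α ≤ t - δ → t + 2 * δ ≤ γ →
      ∀ x x' : Fin 7 → Sob d r, x = exactSob hr h' φ δ t → x' = exactSob hr h' φ δ (t + δ) →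
      ‖(Complex.I / δ) • (emb hle (x' 4) - emb hle (x 4)) + (1 / 4 : ℂ) • lapS h0 h (x' 4 + x 4)
        - (β : ℂ) • mulS hρ (emb hle (x' 1)) ((1 / 2 : ℂ) • (emb hle (x' 4) + emb hle (x 4)))‖
          ≤ C * δ ^ 2 ∧
      ‖emb hle (x' 1) - emb hle (x 0) - (2 * δ : ℂ) • xi (mulS hρ) (conjS hρ)
        (emb hle (x 6)) ((1 / 2 : ℂ) • (emb hle (x 4) + emb hle (x 3)))‖ ≤ δ * (C * δ ^ 2) ∧
      ‖(Complex.I / (2 * δ)) • (emb hle (x' 6) - emb hle (x 5))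
          + (1 / 8 : ℂ) • lapS h0 h (x' 6 + (2 : ℂ) • x 6 + x 5)
        - (β : ℂ) • vSource (mulS hρ) (conjS hρ)
          ((1 / 2 : ℂ) • (emb hle (x' 1) + emb hle (x 0)))
          ((1 / 4 : ℂ) • (emb hle (x' 6) + (2 : ℂ) • emb hle (x 6) + emb hle (x 5)))
          (emb hle (x 6)) ((1 / 2 : ℂ) • (emb hle (x 4) + emb hle (x 3)))
          ((1 / 4 : ℂ) • (emb hle (x' 4) + emb hle (x 4) + emb hle (x 3) + emb hle (x 2)))‖
          ≤ C * δ ^ 2 := by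
  have hJ : ∀ u, ‖conjS (d := d) hρ u‖ ≤ ‖u‖ := fun u => (norm_conjS hρ u).le
  have hlast := h.trans h'
  have hlast' := hle.trans h'
  have ha := contDiffOn_clm_comp (emb hlast') hsmooth
  have hl := contDiffOn_clm_comp (lapS h0 hlast) hsmooth
  have hd : ContDiffOn ℝ ∞ (fun t => density hρ (emb hlast' (φ t))) S :=
    ContDiffOn.bilin ha ((conjS hρ).contDiff.comp_contDiffOn ha)
  have heq : ∀ t ∈ S, Complex.I • deriv (fun t => emb hlast' (φ t)) t
      + (1 / 2 : ℂ) • lapS h0 hlast (φ t)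
      = (β : ℂ) • mulS hρ (density hρ (emb hlast' (φ t))) (emb hlast' (φ t)) := fun t ht => by
    rw [deriv_clm_comp hS _ hsmooth ht]
    exact equation_of_isNLSSolutionOn hS hφ hsmooth hρ h0 hlast ht
  obtain ⟨C₁, hC₁, H₁⟩ := exists_cn_residual_le hS hI ha hl hd heq
  obtain ⟨C₂, hC₂, H₂⟩ := exists_density_residual_le hJ hS hI ha
    (ρ := fun t => density hρ (emb hlast' (φ t))) rfl
  obtain ⟨C₃, hC₃, H₃⟩ := exists_velocity_residual_le hJ hS hI ha hl
    (ρ := fun t => density hρ (emb hlast' (φ t))) rfl heq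
  refine ⟨C₁ + C₂ + C₃, by positivity, ?_⟩
  rintro δ t hδ h1 h2 x x' rfl rfl
  have p1 : 0 ≤ C₁ * δ ^ 2 := by positivity
  have p2 : 0 ≤ C₂ * δ ^ 2 := by positivity
  have p3 : 0 ≤ C₃ * δ ^ 2 := by positivity
  have q1 := (H₁ (t + 3 * δ / 2) δ hδ (by linarith) (by linarith)).1
  have q2 := H₂ (t + δ / 2) δ hδ (by linarith) (by linarith)
  have q3 := H₃ (t + δ / 2) δ hδ (by linarith) (by linarith)
  have hmem : ∀ x, α ≤ x → x ≤ γ → x ∈ S := fun x h h' => hI ⟨h, h'⟩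
  have hderiv : ∀ x, α ≤ x → x ≤ γ →
      deriv (fun t => emb hlast' (φ t)) x = emb hlast' (deriv φ x) ∧
      deriv (fun t => lapS h0 hlast (φ t)) x = lapS h0 hlast (deriv φ x) := fun x h h' =>
    ⟨deriv_clm_comp hS _ hsmooth (hmem x h h'), deriv_clm_comp hS _ hsmooth (hmem x h h')⟩
  rw [show t + 3 * δ / 2 + δ / 2 = t + δ + δ by ring, show t + 3 * δ / 2 - δ / 2 = t + δ by ring,
    show t + 3 * δ / 2 = t + δ + δ / 2 by ring] at q1
  simp only [show t + δ / 2 + δ = t + δ + δ / 2 by ring, show t + δ / 2 - δ = t - δ / 2 by ring,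
    show t + δ / 2 + δ / 2 = t + δ by ring, show t + δ / 2 - δ / 2 = t by ring,
    show t + δ / 2 + 3 * δ / 2 = t + δ + δ by ring, show t + δ / 2 - 3 * δ / 2 = t - δ by ring,
    (hderiv (t + δ / 2) (by linarith) (by linarith)).1,
    (hderiv (t + δ + δ / 2) (by linarith) (by linarith)).1,
    (hderiv (t - δ / 2) (by linarith) (by linarith)).1,
    (hderiv (t + δ / 2) (by linarith) (by linarith)).2,
    (hderiv (t + δ + δ / 2) (by linarith) (by linarith)).2,
    (hderiv (t - δ / 2) (by linarith) (by linarith)).2] at q2 q3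
  simp only [exactSob, Matrix.cons_val, map_add (lapS h0 h), map_smul (lapS h0 h), emb_emb,
    emb_density hr hρ, lapS_emb]
  refine ⟨q1.trans (by linarith), q2.trans ?_, q3.trans (by linarith)⟩
  have := mul_le_mul_of_nonneg_left (by linarith : C₂ * δ ^ 2 ≤ (C₁ + C₂ + C₃) * δ ^ 2) hδ.le
  linarith

end Curve
end Sob

/-! ### The initial error and the error bound -/

namespace Sob

variable {d : ℕ} {ρ r r' : ℝ} {S : Set ℝ} {φ : ℝ → Sob d r'} {β α γ M : ℝ}

/-- The error of the initial vector in the stronger norm `H^r`. The velocities, which are difference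
quotients, lose a factor `δ`; it is gained back in the first step from the exact datum `φ 0`. -/
theorem exists_initial_error_le (hS : IsOpen S) (hI : Set.Icc α γ ⊆ S)
    (hφ : IsNLSSolutionOn β S φ) (hsmooth : ContDiffOn ℝ ∞ φ S)
    (hr : (d : ℝ) / 2 < r) (hr' : (d : ℝ) / 2 < r') (h0 : 0 ≤ ρ) (h : ρ + 2 ≤ r)
    (h' : r + 2 ≤ r') {hle : r ≤ r'} (hM : 0 ≤ M) :
    ∃ C, 0 ≤ C ∧ ∀ δ : ℝ, 0 < δ → δ ≤ 1 → α ≤ -δ → δ ≤ γ →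
      δ * (|β| * ‖mulS (d := d) hr‖ * M) ≤ 1 / 2 →
      (∀ i, ‖exactSob hr hle φ δ 0 i‖ ≤ M) →
      ∀ (Υ : Sob d r') (X : Fin 7 → Sob d r), IsInitial β δ (φ 0) Υ X → (∀ i, ‖X i‖ ≤ M) →
      ∀ i, ‖X i - exactSob hr hle φ δ 0 i‖ ≤ C * (‖Υ - density hr' (φ (-δ / 2))‖ + δ ^ 2) := by
  have hr0 : 0 ≤ r := by linarith
  have ha := contDiffOn_clm_comp (emb hle) hsmooth
  have hl := contDiffOn_clm_comp (lapS hr0 h') hsmooth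
  have hd : ContDiffOn ℝ ∞ (fun t => density hr (emb hle (φ t))) S :=
    ContDiffOn.bilin ha ((conjS hr).contDiff.comp_contDiffOn ha)
  have heq : ∀ t ∈ S, Complex.I • deriv (fun t => emb hle (φ t)) t
      + (1 / 2 : ℂ) • lapS hr0 h' (φ t)
      = (β : ℂ) • mulS hr (density hr (emb hle (φ t))) (emb hle (φ t)) := fun t ht => by
    rw [deriv_clm_comp hS _ hsmooth ht]
    exact equation_of_isNLSSolutionOn hS hφ hsmooth hr hr0 h' ht
  obtain ⟨C₁, hC₁, H₁⟩ := exists_cn_residual_le hS hI ha hl hd heq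
  obtain ⟨C₂, hC₂, H₂⟩ := exists_centered_le hS hd hI
  have hb : 0 ≤ ‖mulS (d := d) hr‖ := (mulS (d := d) hr).opNorm_nonneg
  obtain ⟨L, hL⟩ : ∃ L, L = |β| * ‖mulS (d := d) hr‖ * M := ⟨_, rfl⟩
  have hL0 : 0 ≤ L := by rw [hL]; positivity
  have hK : 0 ≤ L * (1 + C₂) + C₁ := by positivity
  refine ⟨1 + C₂ + 2 * (L * (1 + C₂) + C₁) + C₁, by positivity, ?_⟩
  intro δ hδ hδ1 hα hγ hδL bx Υ X hX bX
  have hδ' : (δ : ℂ) ≠ 0 := by exact_mod_cast hδ.ne'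
  have hderiv : ∀ x, α ≤ x → x ≤ γ →
      deriv (fun t => emb hle (φ t)) x = emb hle (deriv φ x) := fun x h h' =>
    deriv_clm_comp hS _ hsmooth (hI ⟨h, h'⟩)
  obtain ⟨p1, p2⟩ := H₁ (δ / 2) δ hδ (by linarith) (by linarith)
  obtain ⟨m1, m2⟩ := H₁ (-(δ / 2)) δ hδ (by linarith) (by linarith)
  obtain ⟨c1, -⟩ := H₂ 0 (δ / 2) (by linarith) (by linarith) (by linarith)
  rw [hderiv _ (by linarith) (by linarith)] at p2 m2
  rw [add_halves, sub_self] at p1 p2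
  rw [neg_add_cancel, show -(δ / 2) - δ / 2 = -δ by ring] at m1 m2
  rw [zero_add, zero_sub] at c1
  have x0 : exactSob hr hle φ δ 0 0 = density hr (emb hle (φ (-(δ / 2)))) := by simp [exactSob]
  have x1 : exactSob hr hle φ δ 0 1 = density hr (emb hle (φ (δ / 2))) := by simp [exactSob]
  have x2 : exactSob hr hle φ δ 0 2 = emb hle (φ (-δ)) := by simp [exactSob]
  have x3 : exactSob hr hle φ δ 0 3 = emb hle (φ 0) := by simp [exactSob]
  have x4 : exactSob hr hle φ δ 0 4 = emb hle (φ δ) := by simp [exactSob]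
  have x5 : exactSob hr hle φ δ 0 5 = emb hle (deriv φ (-(δ / 2))) := by simp [exactSob]
  have x6 : exactSob hr hle φ δ 0 6 = emb hle (deriv φ (δ / 2)) := by simp [exactSob]
  have b0 := bx 0
  have b1 := bx 1
  rw [x0] at b0
  rw [x1] at b1
  have X0 := IsInitial.X_zero hX (h := hle)
  have X1 := IsInitial.X_one hX hr (h := hle)
  have X3 := IsInitial.X_three hX (h := hle)
  have b3 := bX 3
  rw [neg_div]
  -- `e0`, …, `e6` bound the errors of the seven components of the initial vector
  have e0 : ‖X 0 - density hr (emb hle (φ (-(δ / 2))))‖ ≤ ‖Υ - density hr' (φ (-(δ / 2)))‖ := by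
    rw [X0, ← emb_density hr' hr hle, ← map_sub]
    exact norm_emb_le hle _
  generalize ‖Υ - density hr' (φ (-(δ / 2)))‖ = ε at *
  have hε : 0 ≤ ε := (norm_nonneg _).trans e0
  obtain ⟨E, hE⟩ : ∃ E, E = ε + δ ^ 2 := ⟨_, rfl⟩
  have hδE : δ ^ 2 ≤ E := by rw [hE]; linarith
  have hεE : ε ≤ E := by rw [hE]; linarith [sq_nonneg δ]
  have hE0 : 0 ≤ E := hε.trans hεE
  have hC₁E : C₁ * δ ^ 2 ≤ C₁ * E := mul_le_mul_of_nonneg_left hδE hC₁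
  have hC₂E : 0 ≤ C₂ * E := mul_nonneg hC₂ hE0
  have hC₁E' : 0 ≤ C₁ * E := mul_nonneg hC₁ hE0
  have hKE := mul_nonneg hK hE0
  rw [← hE]
  have e1 : ‖X 1 - density hr (emb hle (φ (δ / 2)))‖ ≤ (1 + C₂) * E := by
    have : X 1 - density hr (emb hle (φ (δ / 2)))
        = -(density hr (emb hle (φ (δ / 2))) + density hr (emb hle (φ (-(δ / 2))))
            - (2 : ℂ) • density hr (emb hle (φ 0)))
          - (X 0 - density hr (emb hle (φ (-(δ / 2))))) := by
      rw [X1, X0]; abel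
    rw [this]
    refine (norm_sub_le_of_le (norm_neg _).le e0).trans ?_
    have h1 : C₂ * (δ / 2) ^ 2 ≤ C₂ * E :=
      mul_le_mul_of_nonneg_left (by nlinarith [sq_nonneg δ]) hC₂
    linarith
  -- both first steps have a potential with an error `D` and a residual of size `τ`
  have hfirst : ∀ D τ : ℝ, D ≤ (1 + C₂) * E → τ ≤ C₁ * E →
      2 * δ * (L * D + τ) ≤ δ * (2 * (L * (1 + C₂) + C₁) * E) := fun D τ h1 h2 => by
    have h3 := mul_le_mul_of_nonneg_left h1 hL0
    have h4 : 2 * (L * D + τ) ≤ 2 * (L * (1 + C₂) + C₁) * E := by linarith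
    have h5 := mul_le_mul_of_nonneg_left h4 hδ.le
    linarith
  have e4 : ‖X 4 - emb hle (φ δ)‖ ≤ δ * (2 * (L * (1 + C₂) + C₁) * E) := by
    have h1 := IsInitial.equation_φ_pos hX hδ.ne' hr h0 h (hle := by linarith)
    rw [X3] at h1
    have h2 := norm_first_step_le hδ.ne' hr h0 h h1 (y := emb hle (φ δ))
      (Λ := lapS hr0 h' (φ δ) + lapS hr0 h' (φ 0)) (by
        rw [map_add, map_add, lapS_emb, lapS_emb]
        exact congrArg₂ (· + ·) (toL2_injective (by simp)) (toL2_injective (by simp)))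
      p1 (bX 4) (X3 ▸ b3) b1 (by rw [abs_of_pos hδ]; exact hδL)
    rw [abs_of_pos hδ, ← hL] at h2
    exact h2.trans (hfirst _ _ e1 hC₁E)
  have e2 : ‖X 2 - emb hle (φ (-δ))‖ ≤ δ * (2 * (L * (1 + C₂) + C₁) * E) := by
    have h1 := IsInitial.equation_φ_neg hX hδ.ne' hr h0 h (hle := by linarith)
    rw [X3] at h1
    have hswap : (Complex.I / (δ : ℂ)) • (emb hle (φ 0) - emb hle (φ (-δ)))
        = (Complex.I / ((-δ : ℝ) : ℂ)) • (emb hle (φ (-δ)) - emb hle (φ 0)) := by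
      rw [Complex.ofReal_neg, div_neg, neg_smul, ← smul_neg, neg_sub]
    rw [hswap, add_comm (lapS hr0 h' (φ 0)), add_comm (emb hle (φ 0))] at m1
    have h2 := norm_first_step_le (neg_ne_zero.2 hδ.ne') hr h0 h h1 (y := emb hle (φ (-δ)))
      (Λ := lapS hr0 h' (φ (-δ)) + lapS hr0 h' (φ 0)) (by
        rw [map_add, map_add, lapS_emb, lapS_emb]
        exact congrArg₂ (· + ·) (toL2_injective (by simp)) (toL2_injective (by simp)))
      m1 (bX 2) (X3 ▸ b3) b0 (by rw [abs_neg, abs_of_pos hδ]; exact hδL)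
    rw [abs_neg, abs_of_pos hδ, ← hL] at h2
    exact h2.trans (hfirst _ _ (e0.trans (by linarith)) hC₁E)
  -- the difference quotients of the errors `e2`, `e4` are bounded because these are `O(δ)`
  have hquot : ∀ u v : Sob d r, ‖u‖ ≤ δ * (2 * (L * (1 + C₂) + C₁) * E) → ‖v‖ ≤ C₁ * δ ^ 2 →
      ‖(1 / δ : ℂ) • u + v‖ ≤ 2 * (L * (1 + C₂) + C₁) * E + C₁ * E := fun u v hu hv => by
    refine (norm_add_le_of_le (norm_smul_le _ _) hv).trans (add_le_add ?_ hC₁E)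
    rw [norm_div, norm_one, Complex.norm_real, Real.norm_of_nonneg hδ.le]
    calc _ ≤ 1 / δ * (δ * (2 * (L * (1 + C₂) + C₁) * E)) :=
          mul_le_mul_of_nonneg_left hu (by positivity)
      _ = _ := by rw [← mul_assoc, one_div, inv_mul_cancel₀ hδ.ne', one_mul]
  have e6 : ‖X 6 - emb hle (deriv φ (δ / 2))‖ ≤ 2 * (L * (1 + C₂) + C₁) * E + C₁ * E := by
    have h1 := hquot _ _ e4 p2
    rwa [show (1 / δ : ℂ) • (X 4 - emb hle (φ δ)) + ((1 / δ : ℂ) • (emb hle (φ δ) - emb hle (φ 0))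
      - emb hle (deriv φ (δ / 2))) = X 6 - emb hle (deriv φ (δ / 2)) by
        rw [hX.eq_v_pos, X3]; module] at h1
  have e5 : ‖X 5 - emb hle (deriv φ (-(δ / 2)))‖ ≤ 2 * (L * (1 + C₂) + C₁) * E + C₁ * E := by
    rw [← norm_neg, neg_sub] at e2
    have h1 := hquot _ _ e2 m2
    rwa [show (1 / δ : ℂ) • (emb hle (φ (-δ)) - X 2)
      + ((1 / δ : ℂ) • (emb hle (φ 0) - emb hle (φ (-δ))) - emb hle (deriv φ (-(δ / 2))))
      = X 5 - emb hle (deriv φ (-(δ / 2))) by rw [hX.eq_v_neg, X3]; module] at h1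
  have hδK : δ * (2 * (L * (1 + C₂) + C₁) * E) ≤ 2 * (L * (1 + C₂) + C₁) * E :=
    mul_le_of_le_one_left (by linarith) hδ1
  intro i
  fin_cases i
  · exact (x0 ▸ e0).trans (by linarith)
  · exact (x1 ▸ e1).trans (by linarith)
  · exact (x2 ▸ e2).trans (by linarith)
  · change ‖X 3 - exactSob hr hle φ δ 0 3‖ ≤ _
    rw [x3, X3, sub_self, norm_zero]; linarith
  · exact (x4 ▸ e4).trans (by linarith)
  · exact (x5 ▸ e5).trans (by linarith)
  · exact (x6 ▸ e6).trans (by linarith)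

/-- The error bound for numerical solutions which are bounded by `M` in `(H^r)^7`. -/
theorem exists_error_le {T : ℝ} (hT : 0 < T) (hα : α < 0) (hγ : T < γ) (hS : IsOpen S)
    (hI : Set.Icc α γ ⊆ S)
    (hφ : IsNLSSolutionOn β S φ) (hsmooth : ContDiffOn ℝ ∞ φ S) (hρ : (d : ℝ) / 2 < ρ)
    (hr' : (d : ℝ) / 2 < r') (h0 : 0 ≤ ρ) (h : ρ + 2 ≤ r) (h' : r + 2 ≤ r') {hle : ρ ≤ r}
    {hle' : r ≤ r'} (hr : (d : ℝ) / 2 < r) (M : ℝ) :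
    ∃ C : ℝ, 0 < C ∧ ∃ δ₁ : ℝ, 0 < δ₁ ∧ ∀ δ : ℝ, 0 < δ → δ < δ₁ →
      ∀ (Υ : Sob d r') (X : ℕ → Fin 7 → Sob d r), IsNumericalSolution β δ T (φ 0) Υ X →
      (∀ n : ℕ, n * δ ≤ T → ‖X n‖ ≤ M) → ∀ n : ℕ, n * δ ≤ T → ∀ i,
      ‖emb hle (X n i - exactSob hr hle' φ δ (n * δ) i)‖
        ≤ C * (‖Υ - density hr' (φ (-δ / 2))‖ + δ ^ 2) := by
  obtain ⟨Mx, hMx, Hx⟩ := exists_norm_exactSob_le hS hI hsmooth hr hle'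
  obtain ⟨N, hN⟩ : ∃ N, N = max M Mx := ⟨_, rfl⟩
  have hMN : M ≤ N := hN ▸ le_max_left _ _
  have hMxN : Mx ≤ N := hN ▸ le_max_right _ _
  have hN0 : 0 ≤ N := hMx.trans hMxN
  obtain ⟨Cr, hCr, Hr⟩ := exists_exactSob_residual_le hS hI hφ hsmooth hρ hr h0 h hle' (hle := hle)
  obtain ⟨Ci, hCi, Hi⟩ := exists_initial_error_le hS hI hφ hsmooth hr hr' h0 h h' (hle := hle') hN0
  have hb : 0 ≤ ‖mulS (d := d) hρ‖ := (mulS (d := d) hρ).opNorm_nonneg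
  have hb' : 0 ≤ ‖mulS (d := d) hr‖ := (mulS (d := d) hr).opNorm_nonneg
  obtain ⟨K, hK⟩ : ∃ K, K = 4 * stabilityConst β ‖mulS (d := d) hρ‖ N := ⟨_, rfl⟩
  have hK0 : 0 ≤ K := by rw [hK]; linarith [stabilityConst_nonneg β hb hN0]
  obtain ⟨L, hL⟩ : ∃ L, L = |β| * ‖mulS (d := d) hr‖ * N := ⟨_, rfl⟩
  have hL0 : 0 ≤ L := by rw [hL]; exact mul_nonneg (mul_nonneg (abs_nonneg β) hb') hN0
  refine ⟨4 * (Real.exp (4 * K * T) * (5 * Ci + 2 * Cr * T)) + 1, by positivity,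
    min (min (-α) (γ - T)) (min 1 (1 / (2 * (K + L + 1)))),
    lt_min (lt_min (by linarith) (by linarith)) (lt_min one_pos (by positivity)), ?_⟩
  intro δ hδ hδ₁ Υ X hX bX n hn i
  obtain ⟨⟨d1, d2⟩, d3, d4⟩ : (δ < -α ∧ δ < γ - T) ∧ δ < 1 ∧ δ < 1 / (2 * (K + L + 1)) := by
    simpa only [lt_min_iff] using hδ₁
  have d5 : δ * (K + L + 1) ≤ 1 / 2 := by
    have h1 : δ * (2 * (K + L + 1)) < 1 := (lt_div_iff₀ (by positivity)).1 d4
    linarith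
  have hδK : δ * K ≤ 1 / 2 := by nlinarith [mul_nonneg hδ.le hL0]
  have hδL : δ * L ≤ 1 / 2 := by nlinarith [mul_nonneg hδ.le hK0]
  have hnδ : ∀ n : ℕ, 0 ≤ (n : ℝ) * δ := fun n => by positivity
  have bXN : ∀ n : ℕ, n * δ ≤ T → ∀ i, ‖X n i‖ ≤ N := fun n hn i =>
    (norm_le_pi_norm _ i).trans ((bX n hn).trans hMN)
  have bxN : ∀ n : ℕ, n * δ ≤ T → ∀ i, ‖exactSob hr hle' φ δ (n * δ) i‖ ≤ N := fun n hn i =>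
    (Hx δ (n * δ) hδ (by linarith [hnδ n]) (by linarith) i).trans hMxN
  have hstep : ∀ n : ℕ, ((n + 1 : ℕ) : ℝ) * δ ≤ T →
      errNorm h0 h δ (X (n + 1) - exactSob hr hle' φ δ ((n + 1 : ℕ) * δ))
        ≤ errNorm h0 h δ (X n - exactSob hr hle' φ δ (n * δ))
          + δ * (K * (errNorm h0 h δ (X n - exactSob hr hle' φ δ (n * δ))
            + errNorm h0 h δ (X (n + 1) - exactSob hr hle' φ δ ((n + 1 : ℕ) * δ)))
            + Cr * δ ^ 2) := fun n hn => by
    have ht : ((n + 1 : ℕ) : ℝ) * δ = n * δ + δ := by push_cast; ring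
    have hn' : (n : ℝ) * δ ≤ T := by linarith
    have bx := bxN n hn'
    have bx' := bxN (n + 1) hn
    have hnn := hnδ n
    have hT' : (n : ℝ) * δ + δ ≤ T := ht ▸ hn
    rw [ht] at bx' ⊢
    obtain ⟨r1, r2, r3⟩ := Hr δ (n * δ) hδ (by linarith) (by linarith) _ _ rfl rfl
    have hemb : ∀ u : Sob d r, ‖u‖ ≤ N → ‖emb hle u‖ ≤ N := fun u hu => (norm_emb_le hle u).trans hu
    have hs1 : (n : ℝ) * δ + δ - δ / 2 = n * δ + δ / 2 := by ring
    have hs2 : (n : ℝ) * δ + δ - δ = n * δ := by ring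
    rw [hK]
    exact IsStep.errNorm_le hδ hρ h0 h (hX.2 n hn)
      (by simp [exactSob, hs1]) (by simp [exactSob]) (by simp [exactSob])
      (by simp [exactSob, hs1]) r1 r2 r3
      (fun i => hemb _ (bXN n hn' i)) (fun i => hemb _ (bXN (n + 1) hn i))
      (fun i => hemb _ (bx i)) (fun i => hemb _ (bx' i))
  -- the errors are bounded in terms of the initial error, which is measured in `H^r`
  have hG := discrete_gronwall (a := fun n => errNorm h0 h δ (X n - exactSob hr hle' φ δ (n * δ)))
    hK0 hCr hδ hδK (fun n => errNorm_nonneg h0 h δ _) hstep n hn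
  have hT0 : ((0 : ℕ) : ℝ) * δ ≤ T := by rw [Nat.cast_zero, zero_mul]; exact hT.le
  have bx0 := bxN 0 hT0
  rw [Nat.cast_zero, zero_mul] at bx0
  have hinit := Hi δ hδ d3.le (by linarith) (by linarith) (by rw [← hL]; exact hδL) bx0 Υ (X 0) hX.1
    (bXN 0 hT0)
  have h00 := errNorm_le h0 h hδ.le d3.le (e := X 0 - exactSob hr hle' φ δ 0) hinit
  have hfin := norm_emb_le_errNorm h0 h δ (X n - exactSob hr hle' φ δ (n * δ)) i (hle := hle)
  simp only [Nat.cast_zero, zero_mul, Pi.sub_apply] at hG hfin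
  refine hfin.trans ((mul_le_mul_of_nonneg_left hG (by norm_num)).trans ?_)
  generalize errNorm h0 h δ (X 0 - exactSob hr hle' φ δ 0) = a₀ at *
  have hε : 0 ≤ ‖Υ - density hr' (φ (-δ / 2))‖ := norm_nonneg _
  generalize ‖Υ - density hr' (φ (-δ / 2))‖ = ε at *
  have h1 : a₀ + 2 * Cr * T * δ ^ 2 ≤ (5 * Ci + 2 * Cr * T) * (ε + δ ^ 2) := by
    have : 0 ≤ 2 * Cr * T * ε := by positivity
    linarith
  have h2 := mul_le_mul_of_nonneg_left h1 (Real.exp_pos (4 * K * T)).le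
  have h3 : 0 ≤ ε + δ ^ 2 := by positivity
  linarith

end Sob

end Relaxation

end

/-! ### The error estimate -/

theorem mainTheorem1 (d : ℕ) (hd : d = 1 ∨ d = 2 ∨ d = 3) (s : ℝ) (hs : (d : ℝ) / 2 < s)
    (β : ℝ) (φin : Relaxation.Sob d (s + 4))
    -- the maximal solution, and its smoothness on `(-δt₀, Tstar)`
    (Tstar : EReal) (hTstar : 0 < Tstar)
    (δt₀ : ℝ) (hδt₀ : 0 < δt₀)
    (φ : ℝ → Relaxation.Sob d (s + 4)) (hφ0 : φ 0 = φin)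
    (hφ : Relaxation.IsNLSSolutionOn β {t : ℝ | -δt₀ < t ∧ (t : EReal) < Tstar} φ)
    (hmax : Relaxation.BoundsLifespan β φin Tstar)
    (hsmooth : ContDiffOn ℝ ∞ φ {t : ℝ | -δt₀ < t ∧ (t : EReal) < Tstar})
    (T : ℝ) (hT : 0 < T) (hTT : (T : EReal) < Tstar)
    -- the numerical solution is well defined and uniformly bounded
    (R₁ R₂ : ℝ) (hR₁ : 0 < R₁) (hR₂ : 0 < R₂)
    (hnum : ∀ Υ : Relaxation.Sob d (s + 4), Relaxation.IsRealValued Υ → ‖Υ‖ ≤ R₁ →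
      ∀ δt : ℝ, 0 < δt → δt < δt₀ →
        ∃ X : ℕ → Fin 7 → Relaxation.Sob d (s + 2),
          Relaxation.IsNumericalSolution β δt T φin Υ X ∧
          (∀ n : ℕ, n * δt ≤ T → ‖X n‖ ≤ R₂) ∧
          ∀ Y : ℕ → Fin 7 → Relaxation.Sob d (s + 2),
            Relaxation.IsNumericalSolution β δt T φin Υ Y → ∀ n : ℕ, n * δt ≤ T → Y n = X n) :
    ∃ C : ℝ, 0 < C ∧ ∃ δt₁ : ℝ, 0 < δt₁ ∧ δt₁ < δt₀ ∧ ((T + δt₁ : ℝ) : EReal) ≤ Tstar ∧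
      ∀ Υ : Relaxation.Sob d (s + 4), Relaxation.IsRealValued Υ → ‖Υ‖ ≤ R₁ →
        ∀ (n : ℕ) (δt : ℝ), 0 < δt → δt < δt₁ → n * δt ≤ T →
          ∀ X : ℕ → Fin 7 → Relaxation.Sob d (s + 2),
            Relaxation.IsNumericalSolution β δt T φin Υ X →
            Relaxation.sobolevENorm7 s
                (fun i x => X n i x - Relaxation.exactVec φ δt (n * δt) i x)
              ≤ ENNReal.ofReal C *
                (Relaxation.sobolevENorm (s + 4)
                    (fun x => Υ x - (‖φ (-δt / 2) x‖ : ℂ) ^ 2)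
                  + ENNReal.ofReal (δt ^ 2)) := by
  have hd0 : (0 : ℝ) ≤ (d : ℝ) / 2 := by positivity
  have hs0 : 0 ≤ s := hd0.trans hs.le
  have hr : (d : ℝ) / 2 < s + 2 := by linarith
  have hr' : (d : ℝ) / 2 < s + 4 := by linarith
  have hS : IsOpen {t : ℝ | -δt₀ < t ∧ (t : EReal) < Tstar} :=
    isOpen_Ioi.inter (isOpen_Iio.preimage continuous_coe_real_ereal)
  -- the compact interval `[-δt₀/2, γ]` of existence contains all times `t - δt`, `t + δt` in use
  obtain ⟨γ, hγ, hγ'⟩ := EReal.lt_iff_exists_real_btwn.1 hTT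
  have hγ := EReal.coe_lt_coe_iff.1 hγ
  have hI : Set.Icc (-δt₀ / 2) γ ⊆ {t : ℝ | -δt₀ < t ∧ (t : EReal) < Tstar} := fun t ht =>
    ⟨by linarith [ht.1], (EReal.coe_le_coe_iff.2 ht.2).trans_lt hγ'⟩
  obtain ⟨C, hC, δ₁, hδ₁, H⟩ := Relaxation.Sob.exists_error_le hT (by linarith) hγ hS hI hφ hsmooth
    hs hr' hs0 le_rfl (by linarith) (hle := by linarith) (hle' := by linarith) hr R₂
  refine ⟨C, hC, min (δt₀ / 2) (min δ₁ (γ - T)), lt_min (by linarith) (lt_min hδ₁ (by linarith)),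
    (min_le_left _ _).trans_lt (by linarith), ?_, ?_⟩
  · refine le_trans (EReal.coe_le_coe_iff.2 ?_) hγ'.le
    have h1 : min (δt₀ / 2) (min δ₁ (γ - T)) ≤ γ - T := (min_le_right _ _).trans (min_le_right _ _)
    linarith
  intro Υ hΥ hΥR n δt hδt hδt' hn X hX
  obtain ⟨h1, h2, -⟩ : δt < δt₀ / 2 ∧ δt < δ₁ ∧ δt < γ - T := by
    simpa only [lt_min_iff] using hδt'
  obtain ⟨Z, -, hZ, hXZ⟩ := hnum Υ hΥ hΥR δt hδt (by linarith)
  -- by uniqueness, `X` is the numerical solution for which the bound `R₂` is known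
  have key := H δt hδt h2 Υ X (hφ0 ▸ hX) (fun n hn => (hXZ X hX n hn) ▸ hZ n hn) n hn
  have hE : Relaxation.sobolevENorm (s + 4) (fun x => Υ x - (‖φ (-δt / 2) x‖ : ℂ) ^ 2)
      = ‖Υ - Relaxation.Sob.density hr' (φ (-δt / 2))‖ₑ := by
    refine Relaxation.Sob.sobolevENorm_eq_of_ae ?_
    filter_upwards [Relaxation.Sob.coe_sub Υ (Relaxation.Sob.density hr' (φ (-δt / 2))),
      Relaxation.Sob.coe_density hr' (φ (-δt / 2))] with x h3 h4
    rw [h3, h4]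
  rw [hE, ← ofReal_norm, ← ENNReal.ofReal_add (norm_nonneg _) (sq_nonneg _),
    ← ENNReal.ofReal_mul hC.le]
  refine iSup_le fun i => ?_
  rw [Relaxation.Sob.sobolevENorm_eq_of_ae (r := s)
    (u := Relaxation.Sob.emb (by linarith) (X n i - Relaxation.Sob.exactSob hr (by linarith) φ δt
      (n * δt) i)), ← ofReal_norm]
  · exact ENNReal.ofReal_le_ofReal (key i)
  · filter_upwards [Relaxation.Sob.coe_sub (X n i)
      (Relaxation.Sob.exactSob hr (by linarith) φ δt (n * δt) i),
      Relaxation.Sob.exactVec_ae_eq hr (by linarith) φ δt (n * δt) i] with x h3 h4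
    rw [Relaxation.Sob.toL2_emb, h3, h4]
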